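/- **Theorem 3.6.** Let $k$ be a field. Let $\operatorname{mod}(k)$ be the category of finite-dimensional $k$-vector spaces and $\operatorname{gr}(k[x])$ the category of finitely generated $\mathbb{Z}$-graded $k[x]$-modules ($\deg x=1$) with degree-preserving $k[x]$-linear maps. Let $\mathcal{C}$ (the "$\mathbb{Z}D_\infty$-category") be the pullback $$\operatorname{mod}(k)\oplus\operatorname{mod}(k)\longrightarrow \operatorname{mod}(k)\longleftarrow \operatorname{gr}(k[x]),$$ where the left functor sends $(V_0,V_1)$ to $V_0\oplus V_1$ and the right functor sends $M$ to $(M_x)_0$, the degree-zero part of the localization of $M$ at $x$. That is, an object of $\mathcal{C}$ is a finitely generated graded $k[x]$-module $M$ together with finite-dimensional vector spaces $V_0,V_1$ and an isomorphism $V_0\oplus V_1\cong (M_x)_0$, and a morphism is a triple of maps between the $M$'s, the $V_0$'s and the $V_1$'s compatible with these isomorphisms. This is a $k$-linear abelian category. Then $\mathcal{C}$ satisfies Serre duality. Explicitly: for all $X,Y\in\mathcal{C}$ the space $\bigoplus_{i\ge 0}\operatorname{Ext}^i_{\mathcal{C}}(X,Y)$ is finite-dimensional over $k$; for all $A,B$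 in the bounded derived category $D^b(\mathcal{C})$ the space $\bigoplus_{i\in\mathbb{Z}}\operatorname{Hom}_{D^b(\mathcal{C})}(A,B[i])$ is finite-dimensional over $k$; and there exist a $k$-linear auto-equivalence $F$ of $D^b(\mathcal{C})$ and $k$-linear isomorphisms $$\operatorname{Hom}_{D^b(\mathcal{C})}(A,B)\longrightarrow \operatorname{Hom}_{D^b(\mathcal{C})}(B,FA)^*$$ natural in $A,B\in D^b(\mathcal{C})$, where $(-)^*$ denotes the $k$-dual. -/

import Mathlib

open CategoryTheory CategoryTheory.Limits

universe w w' u v v₁ v₂ v₃ u₁ u₂ u₃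

namespace ZDInf

lemma isIso_map_comparison {P : Type u} [Category.{v} P] [Preadditive P]
    {A : Type u₁} [Category.{v₁} A] [Abelian A] [HasKernels P] [HasCokernels P]
    (F : P ⥤ A) [F.PreservesZeroMorphisms]
    [∀ {X Y : P} (f : X ⟶ Y), PreservesLimit (parallelPair f 0) F]
    [∀ {X Y : P} (f : X ⟶ Y), PreservesColimit (parallelPair f 0) F]
    {X Y : P} (f : X ⟶ Y) : IsIso (F.map (Abelian.coimageImageComparison f)) :=
  IsIso.of_isIso_fac_right (Abelian.PreservesCoimage.hom_coimageImageComparison F f).symm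

/-! ### The categorical pullback of exact functors between abelian categories is abelian

Mathlib's `CategoricalPullback L R` has as objects the triples `(a, b, L a ≅ R b)` and as morphisms
the compatible pairs of morphisms. All structure is componentwise. -/

section Pullback

variable {A : Type u₁} [Category.{v₁} A] {B : Type u₂} [Category.{v₂} B]
  {T : Type u₃} [Category.{v₃} T] {L : A ⥤ T} {R : B ⥤ T}

section Preadditive

variable [Preadditive A] [Preadditive B] [Preadditive T] [L.Additive] [R.Additive]
  {x y : CategoricalPullback L R}

instance : Zero (x ⟶ y) := ⟨⟨0, 0, by simp⟩⟩
instance : Add (x ⟶ y) := ⟨fun f g => ⟨f.fst + g.fst, f.snd + g.snd, by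
  simp [Functor.map_add, Preadditive.add_comp, Preadditive.comp_add]⟩⟩
instance : Neg (x ⟶ y) := ⟨fun f => ⟨-f.fst, -f.snd, by simp [Functor.map_neg]⟩⟩
instance : Sub (x ⟶ y) := ⟨fun f g => ⟨f.fst - g.fst, f.snd - g.snd, by
  simp [Functor.map_sub, Preadditive.sub_comp, Preadditive.comp_sub]⟩⟩
instance : SMul ℕ (x ⟶ y) := ⟨fun n f => ⟨n • f.fst, n • f.snd, by
  simp [Functor.map_nsmul, Preadditive.nsmul_comp, Preadditive.comp_nsmul]⟩⟩
instance : SMul ℤ (x ⟶ y) := ⟨fun n f => ⟨n • f.fst, n • f.snd, by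
  simp [Functor.map_zsmul, Preadditive.zsmul_comp, Preadditive.comp_zsmul]⟩⟩

def pairHom (f : x ⟶ y) : (x.fst ⟶ y.fst) × (x.snd ⟶ y.snd) := (f.fst, f.snd)

lemma pairHom_injective : Function.Injective (pairHom (x := x) (y := y)) := by
  intro f g h
  exact CategoricalPullback.hom_ext (congrArg Prod.fst h) (congrArg Prod.snd h)

instance : AddCommGroup (x ⟶ y) :=
  pairHom_injective.addCommGroup pairHom rfl (fun _ _ => rfl) (fun _ => rfl) (fun _ _ => rfl)
    (fun _ _ => rfl) (fun _ _ => rfl)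

instance : Preadditive (CategoricalPullback L R) where
  add_comp _ _ _ f f' g :=
    CategoricalPullback.hom_ext (Preadditive.add_comp _ _ _ f.fst f'.fst g.fst)
      (Preadditive.add_comp _ _ _ f.snd f'.snd g.snd)
  comp_add _ _ _ f g g' :=
    CategoricalPullback.hom_ext (Preadditive.comp_add _ _ _ f.fst g.fst g'.fst)
      (Preadditive.comp_add _ _ _ f.snd g.snd g'.snd)

instance : (CategoricalPullback.π₁ L R).Additive where
instance : (CategoricalPullback.π₂ L R).Additive where

variable {k : Type u} [Ring k] [Linear k A] [Linear k B] [Linear k T] [L.Linear k] [R.Linear k]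

instance : SMul k (x ⟶ y) := ⟨fun c f => ⟨c • f.fst, c • f.snd, by
  simp [Functor.map_smul, Linear.smul_comp, Linear.comp_smul]⟩⟩

def pairHomAdd : (x ⟶ y) →+ (x.fst ⟶ y.fst) × (x.snd ⟶ y.snd) where
  toFun := pairHom
  map_zero' := rfl
  map_add' _ _ := rfl

instance : Module k (x ⟶ y) :=
  Function.Injective.module k pairHomAdd pairHom_injective (fun _ _ => rfl)

instance : Linear k (CategoricalPullback L R) where
  smul_comp _ _ _ c f g :=
    CategoricalPullback.hom_ext (Linear.smul_comp _ _ _ c f.fst g.fst)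
      (Linear.smul_comp _ _ _ c f.snd g.snd)
  comp_smul _ _ _ f c g :=
    CategoricalPullback.hom_ext (Linear.comp_smul _ _ _ f.fst c g.fst)
      (Linear.comp_smul _ _ _ f.snd c g.snd)

end Preadditive

section Limits

variable {J : Type w} [Category.{w'} J] (K : J ⥤ CategoricalPullback L R)

def diagIso : (K ⋙ CategoricalPullback.π₁ L R) ⋙ L ≅ (K ⋙ CategoricalPullback.π₂ L R) ⋙ R :=
  NatIso.ofComponents (fun j => (K.obj j).iso) (fun f => (K.map f).w)

section

variable {K} {c₁ : Cone (K ⋙ CategoricalPullback.π₁ L R)}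
  {c₂ : Cone (K ⋙ CategoricalPullback.π₂ L R)} (h₁ : IsLimit c₁) (h₂ : IsLimit c₂)
  [PreservesLimit (K ⋙ CategoricalPullback.π₁ L R) L]
  [PreservesLimit (K ⋙ CategoricalPullback.π₂ L R) R]

noncomputable def conePtIso : L.obj c₁.pt ≅ R.obj c₂.pt :=
  IsLimit.conePointsIsoOfNatIso (isLimitOfPreserves L h₁) (isLimitOfPreserves R h₂) (diagIso K)

lemma conePtIso_hom_comp (j : J) :
    (conePtIso h₁ h₂).hom ≫ R.map (c₂.π.app j) = L.map (c₁.π.app j) ≫ (K.obj j).iso.hom :=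
  IsLimit.conePointsIsoOfNatIso_hom_comp (isLimitOfPreserves L h₁) (isLimitOfPreserves R h₂)
    (diagIso K) j

noncomputable def pullbackCone : Cone K where
  pt := ⟨c₁.pt, c₂.pt, conePtIso h₁ h₂⟩
  π :=
    { app j := ⟨c₁.π.app j, c₂.π.app j, (conePtIso_hom_comp h₁ h₂ j).symm⟩
      naturality _ _ f := CategoricalPullback.hom_ext (c₁.π.naturality f) (c₂.π.naturality f) }

noncomputable def isLimitPullbackCone : IsLimit (pullbackCone h₁ h₂) where
  lift s :=
    { fst := h₁.lift ((CategoricalPullback.π₁ L R).mapCone s)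
      snd := h₂.lift ((CategoricalPullback.π₂ L R).mapCone s)
      w := by
        refine (isLimitOfPreserves R h₂).hom_ext (fun j => ?_)
        have e1 : h₁.lift ((CategoricalPullback.π₁ L R).mapCone s) ≫ c₁.π.app j = (s.π.app j).fst :=
          h₁.fac _ j
        have e2 : h₂.lift ((CategoricalPullback.π₂ L R).mapCone s) ≫ c₂.π.app j = (s.π.app j).snd :=
          h₂.fac _ j
        have e3 := (s.π.app j).w
        have e4 := conePtIso_hom_comp h₁ h₂ j
        generalize h₁.lift ((CategoricalPullback.π₁ L R).mapCone s) = l₁ at e1 ⊢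
        generalize h₂.lift ((CategoricalPullback.π₂ L R).mapCone s) = l₂ at e2 ⊢
        change (L.map (X := s.pt.fst) l₁ ≫ (conePtIso h₁ h₂).hom) ≫ R.map (c₂.π.app j) =
          (s.pt.iso.hom ≫ R.map (X := s.pt.snd) l₂) ≫ R.map (c₂.π.app j)
        change L.map (s.π.app j).fst ≫ (K.obj j).iso.hom =
          s.pt.iso.hom ≫ R.map (s.π.app j).snd at e3
        rw [← e1, ← e2] at e3
        erw [Functor.map_comp, Functor.map_comp] at e3
        rw [Category.assoc, Category.assoc, e4]
        exact (Category.assoc _ _ _).symm.trans e3 }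
  fac s j := CategoricalPullback.hom_ext (h₁.fac _ j) (h₂.fac _ j)
  uniq s m hm := CategoricalPullback.hom_ext
    (h₁.uniq ((CategoricalPullback.π₁ L R).mapCone s) _
      (fun j => congrArg CategoricalPullback.Hom.fst (hm j)))
    (h₂.uniq ((CategoricalPullback.π₂ L R).mapCone s) _
      (fun j => congrArg CategoricalPullback.Hom.snd (hm j)))

end

variable [HasLimit (K ⋙ CategoricalPullback.π₁ L R)] [HasLimit (K ⋙ CategoricalPullback.π₂ L R)]
  [PreservesLimit (K ⋙ CategoricalPullback.π₁ L R) L]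
  [PreservesLimit (K ⋙ CategoricalPullback.π₂ L R) R]

lemma hasLimit_pullback : HasLimit K :=
  ⟨⟨_, isLimitPullbackCone (limit.isLimit (K ⋙ CategoricalPullback.π₁ L R))
    (limit.isLimit (K ⋙ CategoricalPullback.π₂ L R))⟩⟩

lemma preservesLimit_π₁ : PreservesLimit K (CategoricalPullback.π₁ L R) :=
  preservesLimit_of_preserves_limit_cone
    (isLimitPullbackCone (limit.isLimit (K ⋙ CategoricalPullback.π₁ L R))
      (limit.isLimit (K ⋙ CategoricalPullback.π₂ L R)))
    (limit.isLimit (K ⋙ CategoricalPullback.π₁ L R))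

lemma preservesLimit_π₂ : PreservesLimit K (CategoricalPullback.π₂ L R) :=
  preservesLimit_of_preserves_limit_cone
    (isLimitPullbackCone (limit.isLimit (K ⋙ CategoricalPullback.π₁ L R))
      (limit.isLimit (K ⋙ CategoricalPullback.π₂ L R)))
    (limit.isLimit (K ⋙ CategoricalPullback.π₂ L R))

end Limits

section Colimits

variable {J : Type w} [Category.{w'} J] (K : J ⥤ CategoricalPullback L R)

section

variable {K} {c₁ : Cocone (K ⋙ CategoricalPullback.π₁ L R)}
  {c₂ : Cocone (K ⋙ CategoricalPullback.π₂ L R)} (h₁ : IsColimit c₁) (h₂ : IsColimit c₂)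
  [PreservesColimit (K ⋙ CategoricalPullback.π₁ L R) L]
  [PreservesColimit (K ⋙ CategoricalPullback.π₂ L R) R]

noncomputable def coconePtIso : L.obj c₁.pt ≅ R.obj c₂.pt :=
  IsColimit.coconePointsIsoOfNatIso (isColimitOfPreserves L h₁) (isColimitOfPreserves R h₂)
    (diagIso K)

lemma comp_coconePtIso_hom (j : J) :
    L.map (c₁.ι.app j) ≫ (coconePtIso h₁ h₂).hom = (K.obj j).iso.hom ≫ R.map (c₂.ι.app j) :=
  IsColimit.comp_coconePointsIsoOfNatIso_hom (isColimitOfPreserves L h₁)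
    (isColimitOfPreserves R h₂) (diagIso K) j

noncomputable def pullbackCocone : Cocone K where
  pt := ⟨c₁.pt, c₂.pt, coconePtIso h₁ h₂⟩
  ι :=
    { app j := ⟨c₁.ι.app j, c₂.ι.app j, comp_coconePtIso_hom h₁ h₂ j⟩
      naturality _ _ f := CategoricalPullback.hom_ext (c₁.ι.naturality f) (c₂.ι.naturality f) }

noncomputable def isColimitPullbackCocone : IsColimit (pullbackCocone h₁ h₂) where
  desc s :=
    { fst := h₁.desc ((CategoricalPullback.π₁ L R).mapCocone s)
      snd := h₂.desc ((CategoricalPullback.π₂ L R).mapCocone s)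
      w := by
        refine (isColimitOfPreserves L h₁).hom_ext (fun j => ?_)
        have e1 : c₁.ι.app j ≫ h₁.desc ((CategoricalPullback.π₁ L R).mapCocone s) =
            (s.ι.app j).fst := h₁.fac _ j
        have e2 : c₂.ι.app j ≫ h₂.desc ((CategoricalPullback.π₂ L R).mapCocone s) =
            (s.ι.app j).snd := h₂.fac _ j
        have e3 := (s.ι.app j).w
        have e4 := comp_coconePtIso_hom h₁ h₂ j
        generalize h₁.desc ((CategoricalPullback.π₁ L R).mapCocone s) = l₁ at e1 ⊢
        generalize h₂.desc ((CategoricalPullback.π₂ L R).mapCocone s) = l₂ at e2 ⊢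
        change L.map (c₁.ι.app j) ≫ L.map (Y := s.pt.fst) l₁ ≫ s.pt.iso.hom =
          L.map (c₁.ι.app j) ≫ (coconePtIso h₁ h₂).hom ≫ R.map (Y := s.pt.snd) l₂
        change L.map (s.ι.app j).fst ≫ s.pt.iso.hom =
          (K.obj j).iso.hom ≫ R.map (s.ι.app j).snd at e3
        rw [← e1, ← e2] at e3
        erw [Functor.map_comp, Functor.map_comp] at e3
        rw [reassoc_of% e4]
        exact ((Category.assoc _ _ _).symm.trans e3).trans (Category.assoc _ _ _).symm }
  fac s j := CategoricalPullback.hom_ext (h₁.fac _ j) (h₂.fac _ j)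
  uniq s m hm := CategoricalPullback.hom_ext
    (h₁.uniq ((CategoricalPullback.π₁ L R).mapCocone s) _
      (fun j => congrArg CategoricalPullback.Hom.fst (hm j)))
    (h₂.uniq ((CategoricalPullback.π₂ L R).mapCocone s) _
      (fun j => congrArg CategoricalPullback.Hom.snd (hm j)))

end

variable [HasColimit (K ⋙ CategoricalPullback.π₁ L R)]
  [HasColimit (K ⋙ CategoricalPullback.π₂ L R)]
  [PreservesColimit (K ⋙ CategoricalPullback.π₁ L R) L]
  [PreservesColimit (K ⋙ CategoricalPullback.π₂ L R) R]

lemma hasColimit_pullback : HasColimit K :=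
  ⟨⟨_, isColimitPullbackCocone (colimit.isColimit (K ⋙ CategoricalPullback.π₁ L R))
    (colimit.isColimit (K ⋙ CategoricalPullback.π₂ L R))⟩⟩

lemma preservesColimit_π₁ : PreservesColimit K (CategoricalPullback.π₁ L R) :=
  preservesColimit_of_preserves_colimit_cocone
    (isColimitPullbackCocone (colimit.isColimit (K ⋙ CategoricalPullback.π₁ L R))
      (colimit.isColimit (K ⋙ CategoricalPullback.π₂ L R)))
    (colimit.isColimit (K ⋙ CategoricalPullback.π₁ L R))

lemma preservesColimit_π₂ : PreservesColimit K (CategoricalPullback.π₂ L R) :=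
  preservesColimit_of_preserves_colimit_cocone
    (isColimitPullbackCocone (colimit.isColimit (K ⋙ CategoricalPullback.π₁ L R))
      (colimit.isColimit (K ⋙ CategoricalPullback.π₂ L R)))
    (colimit.isColimit (K ⋙ CategoricalPullback.π₂ L R))

end Colimits

variable [Abelian A] [Abelian B] [Preadditive T] [L.Additive] [R.Additive]
  [PreservesFiniteLimits L] [PreservesFiniteLimits R]
  [PreservesFiniteColimits L] [PreservesFiniteColimits R]

instance (J : Type) [SmallCategory J] [FinCategory J] :
    HasLimitsOfShape J (CategoricalPullback L R) := ⟨fun K => hasLimit_pullback K⟩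

instance (J : Type) [SmallCategory J] [FinCategory J] :
    HasColimitsOfShape J (CategoricalPullback L R) := ⟨fun K => hasColimit_pullback K⟩

instance : HasFiniteLimits (CategoricalPullback L R) := ⟨fun _ => inferInstance⟩
instance : HasFiniteColimits (CategoricalPullback L R) := ⟨fun _ => inferInstance⟩

instance : PreservesFiniteLimits (CategoricalPullback.π₁ L R) :=
  ⟨fun _ => ⟨fun {K} => preservesLimit_π₁ K⟩⟩
instance : PreservesFiniteLimits (CategoricalPullback.π₂ L R) :=
  ⟨fun _ => ⟨fun {K} => preservesLimit_π₂ K⟩⟩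
instance : PreservesFiniteColimits (CategoricalPullback.π₁ L R) :=
  ⟨fun _ => ⟨fun {K} => preservesColimit_π₁ K⟩⟩
instance : PreservesFiniteColimits (CategoricalPullback.π₂ L R) :=
  ⟨fun _ => ⟨fun {K} => preservesColimit_π₂ K⟩⟩

instance {x y : CategoricalPullback L R} (f : x ⟶ y) :
    IsIso (Abelian.coimageImageComparison f) := by
  rw [CategoricalPullback.isIso_iff]
  exact ⟨isIso_map_comparison (CategoricalPullback.π₁ L R) f,
    isIso_map_comparison (CategoricalPullback.π₂ L R) f⟩

noncomputable instance : Abelian (CategoricalPullback L R) :=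
  Abelian.ofCoimageImageComparisonIsIso

end Pullback

/-! ### The product of two abelian categories is abelian (componentwise) -/

section Product

variable {A : Type u₁} [Category.{v₁} A] {B : Type u₂} [Category.{v₂} B]

instance [Preadditive A] [Preadditive B] : Preadditive (A × B) where
  homGroup x y := inferInstanceAs (AddCommGroup ((x.1 ⟶ y.1) × (x.2 ⟶ y.2)))
  add_comp _ _ _ f f' g :=
    Prod.ext (Preadditive.add_comp _ _ _ f.1 f'.1 g.1) (Preadditive.add_comp _ _ _ f.2 f'.2 g.2)
  comp_add _ _ _ f g g' :=
    Prod.ext (Preadditive.comp_add _ _ _ f.1 g.1 g'.1) (Preadditive.comp_add _ _ _ f.2 g.2 g'.2)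

instance (k : Type u) [Ring k] [Preadditive A] [Preadditive B] [Linear k A] [Linear k B] :
    Linear k (A × B) where
  homModule x y := inferInstanceAs (Module k ((x.1 ⟶ y.1) × (x.2 ⟶ y.2)))
  smul_comp _ _ _ c f g :=
    Prod.ext (Linear.smul_comp _ _ _ c f.1 g.1) (Linear.smul_comp _ _ _ c f.2 g.2)
  comp_smul _ _ _ f c g :=
    Prod.ext (Linear.comp_smul _ _ _ f.1 c g.1) (Linear.comp_smul _ _ _ f.2 c g.2)

instance [Preadditive A] [Preadditive B] : (CategoryTheory.Prod.fst A B).Additive where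
instance [Preadditive A] [Preadditive B] : (CategoryTheory.Prod.snd A B).Additive where

section Limits

variable {J : Type w} [Category.{w'} J] {K : J ⥤ A × B}

def prodCone (c₁ : Cone (K ⋙ CategoryTheory.Prod.fst A B))
    (c₂ : Cone (K ⋙ CategoryTheory.Prod.snd A B)) : Cone K where
  pt := (c₁.pt, c₂.pt)
  π :=
    { app j := (c₁.π.app j, c₂.π.app j)
      naturality _ _ f := Prod.ext (c₁.π.naturality f) (c₂.π.naturality f) }

def isLimitProdCone {c₁ : Cone (K ⋙ CategoryTheory.Prod.fst A B)}
    {c₂ : Cone (K ⋙ CategoryTheory.Prod.snd A B)} (h₁ : IsLimit c₁) (h₂ : IsLimit c₂) :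
    IsLimit (prodCone c₁ c₂) where
  lift s := (h₁.lift ((CategoryTheory.Prod.fst A B).mapCone s),
    h₂.lift ((CategoryTheory.Prod.snd A B).mapCone s))
  fac s j := Prod.ext (h₁.fac _ j) (h₂.fac _ j)
  uniq s m hm := Prod.ext
    (h₁.uniq ((CategoryTheory.Prod.fst A B).mapCone s) _ (fun j => congrArg Prod.fst (hm j)))
    (h₂.uniq ((CategoryTheory.Prod.snd A B).mapCone s) _ (fun j => congrArg Prod.snd (hm j)))

def prodCocone (c₁ : Cocone (K ⋙ CategoryTheory.Prod.fst A B))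
    (c₂ : Cocone (K ⋙ CategoryTheory.Prod.snd A B)) : Cocone K where
  pt := (c₁.pt, c₂.pt)
  ι :=
    { app j := (c₁.ι.app j, c₂.ι.app j)
      naturality _ _ f := Prod.ext (c₁.ι.naturality f) (c₂.ι.naturality f) }

def isColimitProdCocone {c₁ : Cocone (K ⋙ CategoryTheory.Prod.fst A B)}
    {c₂ : Cocone (K ⋙ CategoryTheory.Prod.snd A B)} (h₁ : IsColimit c₁) (h₂ : IsColimit c₂) :
    IsColimit (prodCocone c₁ c₂) where
  desc s := (h₁.desc ((CategoryTheory.Prod.fst A B).mapCocone s),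
    h₂.desc ((CategoryTheory.Prod.snd A B).mapCocone s))
  fac s j := Prod.ext (h₁.fac _ j) (h₂.fac _ j)
  uniq s m hm := Prod.ext
    (h₁.uniq ((CategoryTheory.Prod.fst A B).mapCocone s) _ (fun j => congrArg Prod.fst (hm j)))
    (h₂.uniq ((CategoryTheory.Prod.snd A B).mapCocone s) _ (fun j => congrArg Prod.snd (hm j)))

end Limits

variable [Abelian A] [Abelian B]

instance (J : Type) [SmallCategory J] [FinCategory J] : HasLimitsOfShape J (A × B) :=
  ⟨fun K => ⟨⟨_, isLimitProdCone (limit.isLimit (K ⋙ CategoryTheory.Prod.fst A B))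
    (limit.isLimit (K ⋙ CategoryTheory.Prod.snd A B))⟩⟩⟩

instance (J : Type) [SmallCategory J] [FinCategory J] : HasColimitsOfShape J (A × B) :=
  ⟨fun K => ⟨⟨_, isColimitProdCocone (colimit.isColimit (K ⋙ CategoryTheory.Prod.fst A B))
    (colimit.isColimit (K ⋙ CategoryTheory.Prod.snd A B))⟩⟩⟩

instance : HasFiniteLimits (A × B) := ⟨fun _ => inferInstance⟩
instance : HasFiniteColimits (A × B) := ⟨fun _ => inferInstance⟩

instance : PreservesFiniteLimits (CategoryTheory.Prod.fst A B) :=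
  ⟨fun _ => ⟨fun {K} => preservesLimit_of_preserves_limit_cone
    (isLimitProdCone (limit.isLimit (K ⋙ CategoryTheory.Prod.fst A B))
      (limit.isLimit (K ⋙ CategoryTheory.Prod.snd A B)))
    (limit.isLimit (K ⋙ CategoryTheory.Prod.fst A B))⟩⟩

instance : PreservesFiniteLimits (CategoryTheory.Prod.snd A B) :=
  ⟨fun _ => ⟨fun {K} => preservesLimit_of_preserves_limit_cone
    (isLimitProdCone (limit.isLimit (K ⋙ CategoryTheory.Prod.fst A B))
      (limit.isLimit (K ⋙ CategoryTheory.Prod.snd A B)))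
    (limit.isLimit (K ⋙ CategoryTheory.Prod.snd A B))⟩⟩

instance : PreservesFiniteColimits (CategoryTheory.Prod.fst A B) :=
  ⟨fun _ => ⟨fun {K} => preservesColimit_of_preserves_colimit_cocone
    (isColimitProdCocone (colimit.isColimit (K ⋙ CategoryTheory.Prod.fst A B))
      (colimit.isColimit (K ⋙ CategoryTheory.Prod.snd A B)))
    (colimit.isColimit (K ⋙ CategoryTheory.Prod.fst A B))⟩⟩

instance : PreservesFiniteColimits (CategoryTheory.Prod.snd A B) :=
  ⟨fun _ => ⟨fun {K} => preservesColimit_of_preserves_colimit_cocone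
    (isColimitProdCocone (colimit.isColimit (K ⋙ CategoryTheory.Prod.fst A B))
      (colimit.isColimit (K ⋙ CategoryTheory.Prod.snd A B)))
    (colimit.isColimit (K ⋙ CategoryTheory.Prod.snd A B))⟩⟩

instance {x y : A × B} (f : x ⟶ y) : IsIso (Abelian.coimageImageComparison f) := by
  rw [isIso_prod_iff]
  exact ⟨isIso_map_comparison (CategoryTheory.Prod.fst A B) f,
    isIso_map_comparison (CategoryTheory.Prod.snd A B) f⟩

noncomputable instance : Abelian (A × B) := Abelian.ofCoimageImageComparisonIsIso

end Product

/-! ### The three corners of the pullback diagram -/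

section Concrete

open Polynomial DirectSum

variable (k : Type u) [Field k]

/-- `mod(k)`: finite dimensional `k`-vector spaces. -/
abbrev Vec := FGModuleCat.{u} k

/-- The functor `mod(k) ⊕ mod(k) ⥤ mod(k)` sending `(V₁, V₂)` to `V₁ ⊕ V₂`. -/
noncomputable def sumFunctor : Vec k × Vec k ⥤ Vec k where
  obj V := FGModuleCat.of k (V.1 × V.2)
  map f := FGModuleCat.ofHom (f.1.hom.hom.prodMap f.2.hom.hom)

noncomputable def diagAdjSum : Functor.diag (Vec k) ⊣ sumFunctor k :=
  Adjunction.mkOfHomEquiv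
    { homEquiv X V :=
        { toFun f := FGModuleCat.ofHom (f.1.hom.hom.prod f.2.hom.hom)
          invFun g := (FGModuleCat.ofHom (LinearMap.fst k V.1 V.2 ∘ₗ g.hom.hom),
            FGModuleCat.ofHom (LinearMap.snd k V.1 V.2 ∘ₗ g.hom.hom))
          left_inv _ := rfl
          right_inv _ := rfl }
      homEquiv_naturality_left_symm _ _ := rfl
      homEquiv_naturality_right _ _ := rfl }

noncomputable def sumAdjDiag : sumFunctor k ⊣ Functor.diag (Vec k) :=
  Adjunction.mkOfHomEquiv
    { homEquiv V X :=
        { toFun g := (FGModuleCat.ofHom (g.hom.hom ∘ₗ LinearMap.inl k V.1 V.2),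
            FGModuleCat.ofHom (g.hom.hom ∘ₗ LinearMap.inr k V.1 V.2))
          invFun f := FGModuleCat.ofHom (f.1.hom.hom.coprod f.2.hom.hom)
          left_inv g := by
            apply (ModuleCat.isFG k).ι.map_injective
            exact ModuleCat.hom_ext (LinearMap.coprod_comp_inl_inr g.hom.hom)
          right_inv f := by
            refine Prod.ext ?_ ?_
            · apply (ModuleCat.isFG k).ι.map_injective
              exact ModuleCat.hom_ext (LinearMap.coprod_inl f.1.hom.hom f.2.hom.hom)
            · apply (ModuleCat.isFG k).ι.map_injective
              exact ModuleCat.hom_ext (LinearMap.coprod_inr f.1.hom.hom f.2.hom.hom) }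
      homEquiv_naturality_left_symm f g := by
        ext x
        rfl
      homEquiv_naturality_right f g := rfl }

instance : PreservesFiniteLimits (sumFunctor k) :=
  haveI := (diagAdjSum k).rightAdjoint_preservesLimits
  inferInstance
instance : PreservesFiniteColimits (sumFunctor k) :=
  haveI := (sumAdjDiag k).leftAdjoint_preservesColimits
  inferInstance
instance : (sumFunctor k).Additive where
  map_add := rfl
instance : (sumFunctor k).Linear k where
  map_smul _ _ := rfl

/-- `Gr(k[x])`: a `ℤ`-graded `k[x]`-module, with `x` in degree one, is a family of `k`-vector
spaces `M n` (`n : ℤ`) with `k`-linear maps `x : M n ⟶ M (n + 1)`, that is, a functor from the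
poset `ℤ` to `k`-vector spaces: `M n ⟶ M (n + j)` is multiplication by `x ^ j`. Morphisms are the
natural transformations, i.e. the `k[x]`-linear maps preserving degrees. -/
abbrev GrMod := ℤ ⥤ ModuleCat.{u} k

variable {k}

/-- Multiplication by `x` on the direct sum of all the graded pieces. -/
noncomputable def mulX (M : GrMod k) : Module.End k (⨁ n : ℤ, M.obj n) :=
  DirectSum.toModule k ℤ _ fun n =>
    DirectSum.lof k ℤ (fun n => M.obj n) (n + 1) ∘ₗ (M.map (homOfLE (by lia : n ≤ n + 1))).hom

/-- The `k[x]`-module underlying a graded `k[x]`-module: `⨁ n, M n` with `X` acting by `mulX`. -/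
abbrev Total (M : GrMod k) : Type u := Module.AEval' (mulX M)

lemma mulX_lof (M : GrMod k) (n : ℤ) (m : M.obj n) :
    mulX M (DirectSum.lof k ℤ (fun n => M.obj n) n m) =
      DirectSum.lof k ℤ (fun n => M.obj n) (n + 1)
        ((M.map (homOfLE (by lia : n ≤ n + 1))).hom m) := by
  simp [mulX]

noncomputable def sumMap {M N : GrMod k} (f : M ⟶ N) :
    (⨁ n : ℤ, M.obj n) →ₗ[k] (⨁ n : ℤ, N.obj n) :=
  DirectSum.lmap fun n => (f.app n).hom

lemma sumMap_mulX {M N : GrMod k} (f : M ⟶ N) (m : ⨁ n : ℤ, M.obj n) :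
    sumMap f (mulX M m) = mulX N (sumMap f m) := by
  suffices h : sumMap f ∘ₗ mulX M = mulX N ∘ₗ sumMap f from LinearMap.congr_fun h m
  ext n x : 2
  have := ConcreteCategory.congr_hom (f.naturality (homOfLE (by lia : n ≤ n + 1))) x
  simp only [LinearMap.comp_apply, mulX_lof, sumMap, DirectSum.lmap_lof]
  congr 1

noncomputable def totalMap {M N : GrMod k} (f : M ⟶ N) : Total M →ₗ[k[X]] Total N :=
  LinearMap.ofAEval _ ((Module.AEval'.of (mulX N)).toLinearMap ∘ₗ sumMap f) (fun m => by
    rw [LinearMap.comp_apply, LinearMap.comp_apply, Module.End.smul_def, sumMap_mulX]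
    exact (Module.AEval'.X_smul_of _ _).symm)

lemma totalMap_injective {M N : GrMod k} (f : M ⟶ N)
    (h : ∀ n, Function.Injective (f.app n).hom) : Function.Injective (totalMap f) :=
  (Module.AEval'.of (mulX N)).injective.comp
    (((DirectSum.lmap_injective _).2 h).comp (Module.AEval'.of (mulX M)).symm.injective)

lemma totalMap_surjective {M N : GrMod k} (f : M ⟶ N)
    (h : ∀ n, Function.Surjective (f.app n).hom) : Function.Surjective (totalMap f) :=
  (Module.AEval'.of (mulX N)).surjective.comp
    (((DirectSum.lmap_surjective _).2 h).comp (Module.AEval'.of (mulX M)).symm.surjective)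

variable (k) in
/-- A graded module is finitely generated if its underlying `k[x]`-module is. -/
def isFG : ObjectProperty (GrMod k) := fun M => Module.Finite k[X] (Total M)

instance : (isFG k).IsClosedUnderSubobjects where
  prop_of_mono {M N} f _ hN := by
    have : Module.Finite k[X] (Total N) := hN
    exact Module.Finite.of_injective (totalMap f) (totalMap_injective f fun n =>
      (ModuleCat.mono_iff_injective (f.app n)).1 inferInstance)

instance : (isFG k).IsClosedUnderQuotients where
  prop_of_epi {M N} f _ hM := by
    have : Module.Finite k[X] (Total M) := hM
    exact Module.Finite.of_surjective (totalMap f) (totalMap_surjective f fun n =>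
      (ModuleCat.epi_iff_surjective (f.app n)).1 inferInstance)

instance : (isFG k).IsClosedUnderFiniteProducts where
  isClosedUnderLimitsOfShape J _ := ⟨by
    rintro M ⟨p⟩
    have (j : J) : Module.Finite k[X] (Total (p.diag.obj ⟨j⟩)) := p.prop_diag_obj ⟨j⟩
    refine Module.Finite.of_injective (LinearMap.pi fun j : J => totalMap (p.π.app ⟨j⟩)) ?_
    rw [injective_iff_map_eq_zero]
    intro m hm
    obtain ⟨m, rfl⟩ := (Module.AEval'.of (mulX M)).surjective m
    have hm' (j : J) : sumMap (p.π.app ⟨j⟩) m = 0 :=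
      (Module.AEval'.of (mulX _)).injective (by
        rw [map_zero]; exact congrFun hm j)
    suffices h : m = 0 by rw [h, map_zero]
    refine DFinsupp.ext fun n => ?_
    refine Concrete.isLimit_ext _
      (isLimitOfPreserves ((evaluation ℤ (ModuleCat.{u} k)).obj n) p.isLimit) _ _ fun ⟨j⟩ => ?_
    have := congrArg (fun z => z n) (hm' j)
    exact this.trans (map_zero ((p.π.app ⟨j⟩).app n).hom).symm⟩

instance : (isFG k).ContainsZero where
  exists_zero := by
    obtain ⟨Z, hZ⟩ := HasZeroObject.zero (C := GrMod k)
    refine ⟨Z, hZ, ?_⟩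
    have : Subsingleton (⨁ n : ℤ, Z.obj n) := by
      refine ⟨fun a b => DFinsupp.ext fun n => ?_⟩
      have := ModuleCat.subsingleton_of_isZero
        (((evaluation ℤ (ModuleCat.{u} k)).obj n).map_isZero hZ)
      exact this.elim _ _
    have : Subsingleton (Total Z) := (Module.AEval'.of (mulX Z)).symm.injective.subsingleton
    exact inferInstanceAs (Module.Finite k[X] (Total Z))

variable (k) in
/-- `gr(k[x])`: finitely generated graded `k[x]`-modules. -/
abbrev FGGrMod := (isFG k).FullSubcategory

instance : PreservesFiniteLimits (isFG k).ι :=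
  haveI := (isFG k).preservesKernels_ι
  Functor.preservesFiniteLimits_of_preservesKernels _
instance : PreservesFiniteColimits (isFG k).ι :=
  haveI := (isFG k).preservesCokernels_ι
  Functor.preservesFiniteColimits_of_preservesCokernels _

instance : PreservesFiniteLimits (colim (J := ℤ) (C := ModuleCat.{u} k)) :=
  haveI : AB5OfSize.{0, 0} (ModuleCat.{u} k) := AB5OfSize_of_univLE.{0, 0, u, u} _
  inferInstance

instance : (colim (J := ℤ) (C := ModuleCat.{u} k)).Linear k where
  map_smul f r := by
    refine colimit.hom_ext fun n => ?_
    simp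

noncomputable def totalToColim (M : GrMod k) : (⨁ n : ℤ, M.obj n) →ₗ[k] (colimit M : ModuleCat.{u} k) :=
  DirectSum.toModule k ℤ _ fun n => (colimit.ι M n).hom

lemma totalToColim_mulX (M : GrMod k) (m : ⨁ n : ℤ, M.obj n) :
    totalToColim M (mulX M m) = totalToColim M m := by
  suffices h : totalToColim M ∘ₗ mulX M = totalToColim M from LinearMap.congr_fun h m
  ext n x : 2
  have := ConcreteCategory.congr_hom (colimit.w M (homOfLE (by lia : n ≤ n + 1))) x
  simp only [LinearMap.comp_apply, mulX_lof, totalToColim, DirectSum.toModule_lof]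
  exact this

lemma totalToColim_surjective (M : GrMod k) : Function.Surjective (totalToColim M) := by
  rw [← LinearMap.range_eq_top, ← Submodule.ker_mkQ (LinearMap.range (totalToColim M)),
    LinearMap.ker_eq_top]
  have h : ModuleCat.ofHom (LinearMap.range (totalToColim M)).mkQ = 0 := by
    refine colimit.hom_ext fun n => ?_
    ext m
    refine (Submodule.Quotient.mk_eq_zero _).2
      ⟨DirectSum.lof k ℤ (fun n => M.obj n) n m, ?_⟩
    simp [totalToColim]
    rfl
  exact congrArg ModuleCat.Hom.hom h

lemma totalToColim_smul (M : GrMod k) (p : k[X]) (m : Total M) :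
    totalToColim M ((Module.AEval'.of (mulX M)).symm (p • m)) =
      p.eval 1 • totalToColim M ((Module.AEval'.of (mulX M)).symm m) := by
  induction p using Polynomial.induction_on' with
  | add p q hp hq => rw [add_smul, map_add, map_add, hp, hq, eval_add, add_smul]
  | monomial n a =>
    rw [← C_mul_X_pow_eq_monomial, mul_smul, Module.AEval.C_smul, map_smul, map_smul]
    simp only [eval_mul, eval_C, eval_pow, eval_X, one_pow, mul_one]
    congr 1
    induction n with
    | zero => simp
    | succ n ih => 
      rw [pow_succ', mul_smul, Module.AEval'.of_symm_X_smul, totalToColim_mulX, ih]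

/-- `(M_x)₀` is finite dimensional when `M` is finitely generated. -/
lemma finite_colimit (M : GrMod k) (hM : isFG k M) :
    Module.Finite k (colimit M : ModuleCat.{u} k) := by
  classical
  obtain ⟨s, hs⟩ := hM
  let g : Total M → (colimit M : ModuleCat.{u} k) := fun m =>
    totalToColim M ((Module.AEval'.of (mulX M)).symm m)
  refine ⟨s.image g, eq_top_iff.2 fun y _ => ?_⟩
  obtain ⟨m, rfl⟩ := totalToColim_surjective M y
  have key (t : Total M) (ht : t ∈ Submodule.span k[X] (s : Set (Total M))) :
      g t ∈ Submodule.span k (↑(s.image g) : Set (colimit M : ModuleCat.{u} k)) := by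
    induction ht using Submodule.span_induction with
    | mem x hx => exact Submodule.subset_span (by simpa using ⟨x, hx, rfl⟩)
    | zero => simp [g]
    | add x y _ _ hx hy => simpa [g] using add_mem hx hy
    | smul p x _ hx =>
      change totalToColim M _ ∈ _
      rw [totalToColim_smul]
      exact Submodule.smul_mem _ _ hx
  simpa [g] using key (Module.AEval'.of (mulX M) m) (hs ▸ Submodule.mem_top)

variable (k) in
/-- The functor `gr(k[x]) ⥤ mod(k)`, `M ↦ (M_x)₀`: localize at `x` and take the degree zero part.
An element of `(M_x)₀` is a fraction `m / x ^ n` with `m` homogeneous of degree `n`, and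
`m / x ^ n = x m / x ^ (n + 1)`. So `(M_x)₀` is the colimit of the maps `x : M n ⟶ M (n + 1)`,
in which the class of `m : M n` stands for `m / x ^ n`. -/
noncomputable def locDegreeZero : FGGrMod k ⥤ Vec k :=
  (ModuleCat.isFG k).lift ((isFG k).ι ⋙ colim) fun M => finite_colimit M.obj M.property

instance : (locDegreeZero k).Additive where
  map_add {M N f g} := by
    apply (ModuleCat.isFG k).ι.map_injective
    exact ((isFG k).ι ⋙ colim (J := ℤ) (C := ModuleCat.{u} k)).map_add (f := f) (g := g)

instance : (locDegreeZero k).Linear k where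
  map_smul f r := by
    apply (ModuleCat.isFG k).ι.map_injective
    exact (colim (J := ℤ) (C := ModuleCat.{u} k)).map_smul r f.hom

instance : PreservesFiniteLimits (locDegreeZero k) where
  preservesFiniteLimits J _ _ := ⟨fun {K} =>
    haveI : PreservesLimit K (locDegreeZero k ⋙ (ModuleCat.isFG k).ι) :=
      inferInstanceAs (PreservesLimit K ((isFG k).ι ⋙ colim (J := ℤ) (C := ModuleCat.{u} k)))
    preservesLimit_of_reflects_of_preserves (locDegreeZero k) (ModuleCat.isFG k).ι⟩

instance : PreservesFiniteColimits (locDegreeZero k) where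
  preservesFiniteColimits J _ _ := ⟨fun {K} =>
    haveI : PreservesColimit K (locDegreeZero k ⋙ (ModuleCat.isFG k).ι) :=
      inferInstanceAs (PreservesColimit K ((isFG k).ι ⋙ colim (J := ℤ) (C := ModuleCat.{u} k)))
    preservesColimit_of_reflects_of_preserves (locDegreeZero k) (ModuleCat.isFG k).ι⟩

end Concrete

/-! ### The category and Serre duality -/

/-- The category `C`, i.e. the pullback of
`mod(k) ⊕ mod(k) ⥤ mod(k)`, `(V₁, V₂) ↦ V₁ ⊕ V₂`, and `gr(k[x]) ⥤ mod(k)`, `M ↦ (M_x)₀`. -/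
abbrev ZDCategory (k : Type u) [Field k] := CategoricalPullback (sumFunctor k) (locDegreeZero k)

section SerreDuality

open DirectSum

variable (k : Type u) [Field k]

/-- A Serre functor on a `k`-linear category `D`: a `k`-linear auto-equivalence `F` with
isomorphisms `Hom(A, B) ≃ Hom(B, F A)^*` natural in `A` and `B`. -/
structure SerreFunctor (D : Type u₁) [Category.{v₁} D] [Preadditive D] [Linear k D] where
  equiv : D ≌ D
  additive : equiv.functor.Additive
  linear : equiv.functor.Linear k
  iso (A B : D) : (A ⟶ B) ≃ₗ[k] Module.Dual k (B ⟶ equiv.functor.obj A)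
  naturality_left {A A' B : D} (f : A' ⟶ A) (g : A ⟶ B) (h : B ⟶ equiv.functor.obj A') :
    iso A' B (f ≫ g) h = iso A B g (h ≫ equiv.functor.map f)
  naturality_right {A B B' : D} (g : A ⟶ B) (f : B ⟶ B') (h : B' ⟶ equiv.functor.obj A) :
    iso A B' (g ≫ f) h = iso A B g (f ≫ h)

/-- A `k`-linear triangulated category is Ext-finite if `⨁ i, Hom(A, B[i])` is finite dimensional
for all `A` and `B`. -/
def TriangulatedExtFinite (D : Type u₁) [Category.{v₁} D] [Preadditive D] [Linear k D]
    [HasShift D ℤ] : Prop :=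
  ∀ A B : D, Module.Finite k (⨁ i : ℤ, (A ⟶ B⟦i⟧))

/-- A `k`-linear abelian category is Ext-finite if `⨁ i, Extⁱ(A, B)` is finite dimensional
for all `A` and `B`. -/
def AbelianExtFinite (C : Type u₁) [Category.{v₁} C] [Abelian C] [Linear k C]
    [HasExt.{w'} C] : Prop :=
  ∀ A B : C, Module.Finite k (⨁ i : ℕ, Abelian.Ext A B i)

/-- A `k`-linear triangulated category satisfies Serre duality if it is Ext-finite and has a
Serre functor. -/
def TriangulatedSerreDuality (D : Type u₁) [Category.{v₁} D] [Preadditive D] [Linear k D]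
    [HasShift D ℤ] : Prop :=
  TriangulatedExtFinite k D ∧ Nonempty (SerreFunctor k D)

/-- The bounded derived category of `C`. -/
abbrev BoundedDerivedCategory (C : Type u₁) [Category.{v₁} C] [Abelian C]
    [HasDerivedCategory.{w} C] :=
  (DerivedCategory.TStructure.t (C := C)).bounded.FullSubcategory

/-- A `k`-linear abelian category satisfies Serre duality if it is Ext-finite and its bounded
derived category satisfies Serre duality. -/
def SatisfiesSerreDuality (C : Type u₁) [Category.{v₁} C] [Abelian C] [Linear k C]
    [HasDerivedCategory.{w} C] [HasExt.{w'} C] : Prop :=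
  AbelianExtFinite.{w'} k C ∧ TriangulatedSerreDuality k (BoundedDerivedCategory C)

end SerreDuality

end ZDInf

/-!
The objects `free k n j`, that is `k[x](-n)` with `V j = k` and the other vector space zero,
generate `D^b(C)` as a triangulated category: a nonzero vector in the lowest degree of an object
gives an epimorphism onto some `free k n j` or onto a cokernel of a map between two of them, and
the kernel is smaller. Embedding `free k m j` into `free k a j` with torsion cokernel, for `a`
small, shows that `Ext^i` into `free k m j` vanishes for `i ≥ 2`, and that
`Ext¹(free k n i, free k m j)` is `k` for `i ≠ j` and `n < m` and zero otherwise, whereas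
`Hom(free k n i, free k m j)` is `k` for `i = j` and `m ≤ n` and zero otherwise. Composition is
nonzero wherever it can be, so `(free k (n + 1) (!i))[1]` is dual to `free k n i` when tested on
the generators, hence when tested on all objects by the five lemma. Finally, the objects that have
a Serre dual and those that are Serre duals form triangulated subcategories, so every object is of
both kinds, and the Serre duals assemble to an equivalence.
-/

namespace ZDInf

/-! ### Linear algebra -/

section LinearAlgebra

open DirectSum

lemma exact_lmap {R ι : Type*} [Semiring R] {L M N : ι → Type*}
    [∀ i, AddCommMonoid (L i)] [∀ i, Module R (L i)] [∀ i, AddCommMonoid (M i)]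
    [∀ i, Module R (M i)] [∀ i, AddCommMonoid (N i)] [∀ i, Module R (N i)]
    {f : ∀ i, L i →ₗ[R] M i} {g : ∀ i, M i →ₗ[R] N i} (h : ∀ i, Function.Exact (f i) (g i)) :
    Function.Exact (DirectSum.lmap f) (DirectSum.lmap g) := by
  rw [LinearMap.exact_iff, DirectSum.ker_lmap, DirectSum.range_lmap]
  simp only [fun i => LinearMap.exact_iff.1 (h i)]

lemma finite_directSum_of_injective {R ι κ : Type*} [Semiring R] {M : ι → Type*} {N : κ → Type*}
    [∀ i, AddCommMonoid (M i)] [∀ i, Module R (M i)] [∀ j, AddCommMonoid (N j)]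
    [∀ j, Module R (N j)] {e : κ → ι} (he : Function.Injective e) (u : ∀ j, M (e j) ≃ₗ[R] N j)
    [Module.Finite R (⨁ i, M i)] : Module.Finite R (⨁ j, N j) := by
  classical
  let c : (⨁ i, M i) →ₗ[R] ⨁ j, M (e j) :=
    { toFun := DFinsupp.comapDomain e he
      map_add' := DFinsupp.comapDomain_add e he
      map_smul' := DFinsupp.comapDomain_smul e he }
  have hc : Function.Surjective c := fun y => by
    induction y using DirectSum.induction_on with
    | zero => exact ⟨0, map_zero c⟩
    | of j x => exact ⟨DirectSum.of M (e j) x, DFinsupp.comapDomain_single e he j x⟩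
    | add y y' hy hy' =>
      obtain ⟨x, rfl⟩ := hy
      obtain ⟨x', rfl⟩ := hy'
      exact ⟨x + x', map_add c x x'⟩
  have := Module.Finite.of_surjective c hc
  exact Module.Finite.equiv (DirectSum.congrLinearEquiv u)

section Ring

variable {R L M N : Type*} [Ring R] [AddCommGroup L] [Module R L] [AddCommGroup M] [Module R M]
  [AddCommGroup N] [Module R N] {f : L →ₗ[R] M} {g : M →ₗ[R] N}

lemma exact_neg_right (h : Function.Exact f g) : Function.Exact f (-g) := fun y => by
  simpa using h y

lemma exact_neg_left (h : Function.Exact f g) : Function.Exact (-f) g := by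
  rw [LinearMap.exact_iff, LinearMap.range_neg, LinearMap.exact_iff.1 h]

lemma finite_of_exact [IsNoetherianRing R] (h : Function.Exact f g) [Module.Finite R L]
    [Module.Finite R N] : Module.Finite R M :=
  Module.Finite.of_exact (f := f) (g := g.rangeRestrict)
    (fun y => by simpa [Subtype.ext_iff] using h y) g.surjective_rangeRestrict

lemma finite_directSum_of_subsingleton [IsNoetherianRing R] {ι : Type*} {M : ι → Type*}
    [∀ i, AddCommGroup (M i)] [∀ i, Module R (M i)] [∀ i, Module.Finite R (M i)]
    {s : Set ι} (hs : s.Finite) (h : ∀ i ∉ s, Subsingleton (M i)) :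
    Module.Finite R (⨁ i, M i) := by
  have := hs.to_subtype
  refine Module.Finite.of_injective (LinearMap.pi fun i : s => DirectSum.component R ι M i)
    fun x y hxy => DirectSum.ext_component R fun i => ?_
  by_cases hi : i ∈ s
  · exact congrFun hxy ⟨i, hi⟩
  · exact (h i hi).elim _ _

end Ring

section Field

variable {k U V W : Type*} [Field k] [AddCommGroup U] [Module k U] [AddCommGroup V] [Module k V]
  [AddCommGroup W] [Module k W]

lemma exact_dualMap {α : U →ₗ[k] V} {β : V →ₗ[k] W} (h : Function.Exact α β) :
    Function.Exact β.dualMap α.dualMap := by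
  rw [LinearMap.exact_iff, LinearMap.range_dualMap_eq_dualAnnihilator_ker,
    LinearMap.ker_dualMap_eq_dualAnnihilator_range, LinearMap.exact_iff.1 h]

lemma exists_dual_comp_eq_and (α : U →ₗ[k] V) (β : W →ₗ[k] V) (a : Module.Dual k U)
    (b : Module.Dual k W) (h : ∀ x y, α x = β y → a x = b y) :
    ∃ η : Module.Dual k V, (∀ x, η (α x) = a x) ∧ ∀ y, η (β y) = b y := by
  have : a.coprod (-b) ∈ LinearMap.range (α.coprod (-β)).dualMap := by
    rw [LinearMap.range_dualMap_eq_dualAnnihilator_ker, Submodule.mem_dualAnnihilator]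
    rintro ⟨x, y⟩ hxy
    have := h x y (by simpa [sub_eq_zero, ← sub_eq_add_neg] using hxy)
    simp [this]
  obtain ⟨η, hη⟩ := this
  exact ⟨η, fun x => by simpa using LinearMap.congr_fun hη (x, 0),
    fun y => by simpa using LinearMap.congr_fun hη (0, y)⟩

end Field

end LinearAlgebra

section RankLeOne

variable {k : Type*} [Field k] {V W : Type*} [AddCommGroup V] [Module k V] [AddCommGroup W]
  [Module k W]

lemma exists_smul_eq_of_rank_le_one (h : Module.rank k V ≤ 1) {v : V} (hv : v ≠ 0) (w : V) :
    ∃ c : k, c • v = w := by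
  obtain ⟨x, hx⟩ := rank_le_one_iff.1 h
  obtain ⟨a, rfl⟩ := hx v
  obtain ⟨b, rfl⟩ := hx w
  exact ⟨b * a⁻¹, by rw [smul_smul, inv_mul_cancel_right₀ (left_ne_zero_of_smul hv)]⟩

lemma rank_le_one_of_forall_exists_smul
    (h : ∀ v w : V, ∃ (x : V) (a b : k), a • x = v ∧ b • x = w) : Module.rank k V ≤ 1 := by
  rcases subsingleton_or_nontrivial V with hV | hV
  · exact rank_le_one 0 fun w => ⟨0, Subsingleton.elim _ _⟩
  obtain ⟨v, hv⟩ := exists_ne (0 : V)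
  refine rank_le_one v fun w => ?_
  obtain ⟨x, a, b, rfl, rfl⟩ := h v w
  exact ⟨b * a⁻¹, by rw [smul_smul, inv_mul_cancel_right₀ (left_ne_zero_of_smul hv)]⟩

lemma exists_dual_injective_of_rank_le_one (h : Module.rank k V ≤ 1) :
    ∃ φ : Module.Dual k V, Function.Injective φ :=
  lift_rank_le_iff_exists_linearMap.1 <| by
    rwa [Module.rank_self, Cardinal.lift_one, Cardinal.lift_le_one_iff]

lemma finite_of_rank_le_one (h : Module.rank k V ≤ 1) : Module.Finite k V :=
  Module.rank_lt_aleph0_iff.1 (h.trans_lt Cardinal.one_lt_aleph0)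

lemma bijective_of_rank_le_one (b : V →ₗ[k] Module.Dual k W) (hW : Module.rank k W ≤ 1)
    (hb : ∀ v w, v ≠ 0 → w ≠ 0 → b v w ≠ 0) (h : Nontrivial V ↔ Nontrivial W) :
    Function.Bijective b := by
  rcases subsingleton_or_nontrivial V with hV | hV
  · have hW' : Subsingleton W := not_nontrivial_iff_subsingleton.1 fun hW' =>
      not_nontrivial_iff_subsingleton.2 hV (h.2 hW')
    exact ⟨fun _ _ _ => Subsingleton.elim _ _, fun φ => ⟨0, Subsingleton.elim _ _⟩⟩
  have hW' := h.1 hV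
  obtain ⟨v, hv⟩ := exists_ne (0 : V)
  obtain ⟨w, hw⟩ := exists_ne (0 : W)
  refine ⟨(injective_iff_map_eq_zero b).2 fun x hx => ?_, fun φ => ⟨(φ w / b v w) • v, ?_⟩⟩
  · by_contra hx'
    exact hb x w hx' hw (by rw [hx, LinearMap.zero_apply])
  · refine LinearMap.ext fun x => ?_
    obtain ⟨c, rfl⟩ := exists_smul_eq_of_rank_le_one hW hw x
    rw [map_smul, map_smul, map_smul, LinearMap.smul_apply,
      smul_eq_mul (φ w / _), div_mul_cancel₀ _ (hb v w hv hw)]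

end RankLeOne

/-! ### Serre duals -/

section MapEquiv

variable (R : Type*) [Semiring R] {C : Type u₁} [Category.{v₁} C] [Preadditive C] [Linear R C]
  {D : Type u₂} [Category.{v₂} D] [Preadditive D] [Linear R D] (F : C ⥤ D) [F.Full] [F.Faithful]
  [F.Additive] [F.Linear R]

/-- The action of a fully faithful linear functor on morphisms, as a linear isomorphism. -/
noncomputable def mapEquiv (X Y : C) : (X ⟶ Y) ≃ₗ[R] (F.obj X ⟶ F.obj Y) :=
  LinearEquiv.ofBijective (F.mapLinearMap R) ⟨F.map_injective, F.map_surjective⟩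

end MapEquiv

section SerrePairing

variable {k : Type u} [Field k] {D : Type u₁} [Category.{v₁} D] [Preadditive D] [Linear k D]

/-- The pairing `Hom(A, B) × Hom(B, S) → k` given by composition and a functional on
`Hom(A, S)`, in curried form. -/
def serrePairing {A S : D} (η : Module.Dual k (A ⟶ S)) (B : D) :
    (A ⟶ B) →ₗ[k] Module.Dual k (B ⟶ S) :=
  (LinearMap.llcomp k (B ⟶ S) (A ⟶ S) k η) ∘ₗ Linear.comp A B S

@[simp]
lemma serrePairing_apply {A S : D} (η : Module.Dual k (A ⟶ S)) {B : D} (f : A ⟶ B)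
    (g : B ⟶ S) : serrePairing η B f g = η (f ≫ g) := rfl

/-- `S` is a Serre dual of `A`: the functional `η` identifies `Hom(A, -)` with `Hom(-, S)^*`. -/
def IsSerreDual {A S : D} (η : Module.Dual k (A ⟶ S)) : Prop :=
  ∀ B : D, Function.Bijective (serrePairing η B)

lemma bijective_serrePairing_congr {A B S : D} {η : Module.Dual k (A ⟶ S)}
    (h : Function.Bijective (serrePairing η B)) {A' B' S' : D} {η' : Module.Dual k (A' ⟶ S')}
    (e : (A ⟶ B) ≃ₗ[k] (A' ⟶ B')) (e' : (B ⟶ S) ≃ₗ[k] (B' ⟶ S'))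
    (he : ∀ f g, η' (e f ≫ e' g) = η (f ≫ g)) : Function.Bijective (serrePairing η' B') := by
  have : serrePairing η' B' =
      e'.symm.dualMap.toLinearMap ∘ₗ serrePairing η B ∘ₗ e.symm.toLinearMap := by
    ext f g
    simp [← he]
  rw [this]
  exact e'.symm.dualMap.bijective.comp (h.comp e.symm.bijective)

lemma bijective_serrePairing_of_iso {A B B' S : D} {η : Module.Dual k (A ⟶ S)}
    (h : Function.Bijective (serrePairing η B)) (e : B ≅ B') :
    Function.Bijective (serrePairing η B') :=
  bijective_serrePairing_congr h (Linear.homCongr k (Iso.refl A) e)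
    (Linear.homCongr k e (Iso.refl S)) fun f g => by simp [Linear.homCongr_apply]

lemma bijective_serrePairing_of_rank_le_one {A B S : D} {η : Module.Dual k (A ⟶ S)}
    (hη : Function.Injective η) {V W : Type*} [AddCommGroup V] [Module k V] [AddCommGroup W]
    [Module k W] (e : V ≃ₗ[k] (A ⟶ B)) (e' : W ≃ₗ[k] (B ⟶ S)) (hW : Module.rank k W ≤ 1)
    (he : ∀ v w, v ≠ 0 → w ≠ 0 → e v ≫ e' w ≠ 0) (h : Nontrivial V ↔ Nontrivial W) :
    Function.Bijective (serrePairing η B) := by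
  let b : V →ₗ[k] Module.Dual k W :=
    e'.dualMap.toLinearMap ∘ₗ serrePairing η B ∘ₗ e.toLinearMap
  have hb : Function.Bijective b := bijective_of_rank_le_one b hW
    (fun v w hv hw => (map_ne_zero_iff η hη).2 (he v w hv hw)) h
  exact (Function.Bijective.of_comp_iff _ e.bijective).1
    ((Function.Bijective.of_comp_iff' e'.dualMap.bijective _).1 hb)

open ZeroObject in
lemma isSerreDual_zero [HasZeroObject D] : IsSerreDual (0 : Module.Dual k ((0 : D) ⟶ 0)) := fun B =>
  ⟨fun f g _ => (isZero_zero D).eq_of_src f g, fun φ => ⟨0, LinearMap.ext fun g => by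
    simp [(isZero_zero D).eq_of_tgt g 0]⟩⟩

namespace IsSerreDual

variable {A S : D} {η : Module.Dual k (A ⟶ S)}

lemma of_iso (h : IsSerreDual η) {A' S' : D} (a : A ≅ A') (s : S ≅ S') :
    IsSerreDual (η ∘ₗ (Linear.homCongr k a s).symm.toLinearMap) := fun B =>
  bijective_serrePairing_congr (h B) (Linear.homCongr k a (Iso.refl B))
    (Linear.homCongr k (Iso.refl B) s) fun f g => by
      simp [Linear.homCongr_apply, Linear.homCongr_symm_apply]

lemma map (h : IsSerreDual η) (F : D ⥤ D) [F.IsEquivalence] [F.Additive] [F.Linear k] :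
    ∃ η' : Module.Dual k (F.obj A ⟶ F.obj S),
      IsSerreDual η' ∧ ∀ f : A ⟶ S, η' (F.map f) = η f := by
  have he (f : A ⟶ S) : η ((mapEquiv k F A S).symm (F.map f)) = η f :=
    congrArg η ((mapEquiv k F A S).symm_apply_apply f)
  refine ⟨η ∘ₗ (mapEquiv k F A S).symm.toLinearMap, fun B => ?_, he⟩
  refine bijective_serrePairing_of_iso (bijective_serrePairing_congr (h (F.objPreimage B))
    (mapEquiv k F _ _) (mapEquiv k F _ _) fun f g => ?_) (F.objObjPreimageIso B)
  rw [← he, F.map_comp]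
  rfl

variable [∀ X Y : D, Module.Finite k (X ⟶ Y)]

lemma bijective_flip (h : IsSerreDual η) (B : D) :
    Function.Bijective (serrePairing η B).flip := by
  have : (serrePairing η B).flip =
      (LinearEquiv.ofBijective _ (h B)).toLinearMap.dualMap ∘ₗ
        (Module.evalEquiv k (B ⟶ S)).toLinearMap := rfl
  rw [this]
  exact ((LinearEquiv.ofBijective _ (h B)).dualMap.bijective).comp
    (Module.evalEquiv k (B ⟶ S)).bijective

lemma exists_comp_eq (h : IsSerreDual η) {B : D} (φ : Module.Dual k (A ⟶ B)) :
    ∃ g : B ⟶ S, ∀ f : A ⟶ B, η (f ≫ g) = φ f := by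
  obtain ⟨g, hg⟩ := (h.bijective_flip B).2 φ
  exact ⟨g, LinearMap.congr_fun hg⟩

lemma hom_ext (h : IsSerreDual η) {B : D} {g g' : B ⟶ S}
    (hg : ∀ f : A ⟶ B, η (f ≫ g) = η (f ≫ g')) : g = g' :=
  (h.bijective_flip B).1 (LinearMap.ext hg)

lemma nonempty_iso (h : IsSerreDual η) {S' : D} {η' : Module.Dual k (A ⟶ S')}
    (h' : IsSerreDual η') : Nonempty (S ≅ S') := by
  obtain ⟨a, ha⟩ := h.exists_comp_eq η'
  obtain ⟨b, hb⟩ := h'.exists_comp_eq η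
  exact ⟨b, a, h.hom_ext fun f => by simp [← Category.assoc, ha, hb],
    h'.hom_ext fun f => by simp [← Category.assoc, ha, hb]⟩

end IsSerreDual

end SerrePairing

section SerreFunctor

variable {k : Type u} [Field k] {D : Type u₁} [Category.{v₁} D] [Preadditive D] [Linear k D]
  [∀ X Y : D, Module.Finite k (X ⟶ Y)] {S : D → D} {η : ∀ A : D, Module.Dual k (A ⟶ S A)}
  (h : ∀ A, IsSerreDual (η A))

/-- The morphism of Serre duals `S A ⟶ S A'` induced by `f : A ⟶ A'`. -/
noncomputable def serreMap {A A' : D} (f : A ⟶ A') : S A ⟶ S A' :=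
  ((h A').exists_comp_eq (η A ∘ₗ Linear.leftComp k _ f)).choose

lemma comp_serreMap {A A' : D} (f : A ⟶ A') (g : A' ⟶ S A) :
    η A' (g ≫ serreMap h f) = η A (f ≫ g) :=
  ((h A').exists_comp_eq (η A ∘ₗ Linear.leftComp k _ f)).choose_spec g

lemma serreMap_add {A B : D} (f g : A ⟶ B) :
    serreMap h (f + g) = serreMap h f + serreMap h g :=
  (h B).hom_ext fun t => by
    simp only [comp_serreMap, Preadditive.comp_add, Preadditive.add_comp, map_add]

lemma serreMap_smul {A B : D} (r : k) (f : A ⟶ B) :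
    serreMap h (r • f) = r • serreMap h f :=
  (h B).hom_ext fun t => by
    simp only [comp_serreMap, Linear.comp_smul, Linear.smul_comp, map_smul]

/-- The Serre functor obtained from a choice of Serre duals. -/
noncomputable def serreFunctorOfDuals : D ⥤ D where
  obj := S
  map f := serreMap h f
  map_id A := (h A).hom_ext fun f => by simp [comp_serreMap]
  map_comp {A B C} f g := (h C).hom_ext fun t => by
    rw [comp_serreMap, ← Category.assoc t, comp_serreMap, ← Category.assoc g t, comp_serreMap,
      Category.assoc]

instance : (serreFunctorOfDuals h).Additive where
  map_add := serreMap_add h _ _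

instance : (serreFunctorOfDuals h).Linear k where
  map_smul f r := serreMap_smul h r f

lemma serreMap_bijective (A B : D) :
    Function.Bijective (serreMap h : (A ⟶ B) → (S A ⟶ S B)) := by
  have e : (serrePairing (η B) (S A)).flip ∘ (serreMap h : (A ⟶ B) → (S A ⟶ S B)) =
      serrePairing (η A) B :=
    funext fun f => LinearMap.ext (comp_serreMap h f)
  rw [← Function.Bijective.of_comp_iff' ((h B).bijective_flip (S A)), e]
  exact h A B

include h in
lemma nonempty_serreFunctor (hS : ∀ B : D, ∃ A : D, Nonempty (S A ≅ B)) :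
    Nonempty (SerreFunctor k D) := by
  let F := serreFunctorOfDuals h
  have : F.Full := ⟨(serreMap_bijective h _ _).2⟩
  have : F.Faithful := ⟨fun e => (serreMap_bijective h _ _).1 e⟩
  have : F.EssSurj := ⟨hS⟩
  have : F.IsEquivalence := { }
  exact ⟨{
    equiv := F.asEquivalence
    additive := inferInstanceAs F.Additive
    linear := inferInstanceAs (F.Linear k)
    iso A B := LinearEquiv.ofBijective _ (h A B)
    naturality_left {A A' B} f g := fun (t : B ⟶ S A') => by
      change η A' ((f ≫ g) ≫ t) = η A (g ≫ t ≫ serreMap h f)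
      rw [← Category.assoc g t, comp_serreMap, Category.assoc]
    naturality_right {A B B'} g f := fun (t : B' ⟶ S A) =>
      congrArg (η A) (Category.assoc g f t) }⟩

end SerreFunctor

/-! ### Serre duality and triangles -/

section HomExact

variable {R : Type*} [Semiring R] {C : Type u₁} [Category.{v₁} C] [Preadditive C] [Linear R C]
  {A B E : C} {f : A ⟶ B} {g : B ⟶ E} (w : f ≫ g = 0)

include w

lemma exact_leftComp {X : C} (h : ∀ t : B ⟶ X, f ≫ t = 0 → ∃ s, t = g ≫ s) :
    Function.Exact (Linear.leftComp R X g) (Linear.leftComp R X f) := fun t =>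
  ⟨fun ht => (h t ht).imp fun _ hs => hs.symm, by rintro ⟨s, rfl⟩; simp [reassoc_of% w]⟩

lemma exact_rightComp {X : C} (h : ∀ t : X ⟶ B, t ≫ g = 0 → ∃ s, t = s ≫ f) :
    Function.Exact (Linear.rightComp R X f) (Linear.rightComp R X g) := fun t =>
  ⟨fun ht => (h t ht).imp fun _ hs => hs.symm, by rintro ⟨s, rfl⟩; simp [w]⟩

end HomExact

section Triangles

open Pretriangulated

variable {D : Type u₁} [Category.{v₁} D] [Preadditive D]
  [HasZeroObject D] [HasShift D ℤ] [∀ n : ℤ, (shiftFunctor D n).Additive] [Pretriangulated D]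

lemma yoneda_exact_shift {T : Triangle D} (hT : T ∈ distTriang D) {X : D}
    (f : T.obj₁⟦(1 : ℤ)⟧ ⟶ X) (hf : T.mor₃ ≫ f = 0) : ∃ g, f = T.mor₁⟦(1 : ℤ)⟧' ≫ g := by
  obtain ⟨g, hg⟩ : ∃ g : T.obj₂⟦(1 : ℤ)⟧ ⟶ X, f = (-(T.mor₁⟦(1 : ℤ)⟧')) ≫ g :=
    Triangle.yoneda_exact₂ _ (rot_of_distTriang _ (rot_of_distTriang _ hT)) f hf
  exact ⟨-g, by rw [hg, Preadditive.neg_comp, Preadditive.comp_neg]⟩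

section

variable (R : Type*) [Semiring R] [Linear R D] {T : Triangle D} (hT : T ∈ distTriang D) (X : D)

include hT

lemma exact_leftComp_obj₂ :
    Function.Exact (Linear.leftComp R X T.mor₂) (Linear.leftComp R X T.mor₁) :=
  exact_leftComp (comp_distTriang_mor_zero₁₂ _ hT) (Triangle.yoneda_exact₂ _ hT)

lemma exact_leftComp_obj₃ :
    Function.Exact (Linear.leftComp R X T.mor₃) (Linear.leftComp R X T.mor₂) :=
  exact_leftComp (comp_distTriang_mor_zero₂₃ _ hT) (Triangle.yoneda_exact₃ _ hT)

lemma exact_leftComp_shift :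
    Function.Exact (Linear.leftComp R X (T.mor₁⟦(1 : ℤ)⟧')) (Linear.leftComp R X T.mor₃) :=
  exact_leftComp (comp_distTriang_mor_zero₃₁ _ hT) (yoneda_exact_shift hT)

lemma exact_rightComp_obj₂ :
    Function.Exact (Linear.rightComp R X T.mor₁) (Linear.rightComp R X T.mor₂) :=
  exact_rightComp (comp_distTriang_mor_zero₁₂ _ hT) (Triangle.coyoneda_exact₂ _ hT)

lemma exact_rightComp_obj₃ :
    Function.Exact (Linear.rightComp R X T.mor₂) (Linear.rightComp R X T.mor₃) :=
  exact_rightComp (comp_distTriang_mor_zero₂₃ _ hT) (Triangle.coyoneda_exact₃ _ hT)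

lemma exact_rightComp_shift :
    Function.Exact (Linear.rightComp R X T.mor₃) (Linear.rightComp R X (T.mor₁⟦(1 : ℤ)⟧')) :=
  exact_rightComp (comp_distTriang_mor_zero₃₁ _ hT) fun t ht => Triangle.coyoneda_exact₁ _ hT t ht

end

variable {k : Type u} [Field k] [Linear k D]

lemma bijective_serrePairing_obj₃ {T : Triangle D} (hT : T ∈ distTriang D) {A S : D}
    {η : Module.Dual k (A ⟶ S)}
    (h₁ : Function.Bijective (serrePairing η T.obj₁))
    (h₂ : Function.Bijective (serrePairing η T.obj₂))
    (h₁' : Function.Bijective (serrePairing η (T.obj₁⟦(1 : ℤ)⟧)))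
    (h₂' : Function.Bijective (serrePairing η (T.obj₂⟦(1 : ℤ)⟧))) :
    Function.Bijective (serrePairing η T.obj₃) := by
  refine LinearMap.bijective_of_surjective_of_bijective_of_bijective_of_injective
    (Linear.rightComp k A T.mor₁) (Linear.rightComp k A T.mor₂) (Linear.rightComp k A T.mor₃)
    (Linear.rightComp k A (T.mor₁⟦(1 : ℤ)⟧'))
    (Linear.leftComp k S T.mor₁).dualMap (Linear.leftComp k S T.mor₂).dualMap
    (Linear.leftComp k S T.mor₃).dualMap (Linear.leftComp k S (T.mor₁⟦(1 : ℤ)⟧')).dualMap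
    _ _ _ _ _ ?_ ?_ ?_ ?_ (exact_rightComp_obj₂ k hT A) (exact_rightComp_obj₃ k hT A)
    (exact_rightComp_shift k hT A) (exact_dualMap (exact_leftComp_obj₂ k hT S))
    (exact_dualMap (exact_leftComp_obj₃ k hT S)) (exact_dualMap (exact_leftComp_shift k hT S))
    h₁.2 h₂ h₁' h₂'.1
  all_goals
    ext f g
    simp

section Cone

variable {T T' : Triangle D} (hT : T ∈ distTriang D) (hT' : T' ∈ distTriang D)
  {η₁ : Module.Dual k (T.obj₁ ⟶ T'.obj₁)} {η₂ : Module.Dual k (T.obj₂ ⟶ T'.obj₂)}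
  (comm : ∀ g : T.obj₂ ⟶ T'.obj₁, η₂ (g ≫ T'.mor₁) = η₁ (T.mor₁ ≫ g))

include hT hT' comm

lemma exists_dual_obj₃ (η₁' : Module.Dual k (T.obj₁⟦(1 : ℤ)⟧ ⟶ T'.obj₁⟦(1 : ℤ)⟧))
    (hη₁' : ∀ f, η₁' (f⟦(1 : ℤ)⟧') = η₁ f) :
    ∃ η₃ : Module.Dual k (T.obj₃ ⟶ T'.obj₃), (∀ x, η₃ (x ≫ T'.mor₂) = η₂ (T.mor₂ ≫ x)) ∧
      ∀ y, η₃ (T.mor₃ ≫ y) = -η₁' (y ≫ T'.mor₃) := by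
  refine exists_dual_comp_eq_and (Linear.rightComp k T.obj₃ T'.mor₂)
    (Linear.leftComp k T'.obj₃ T.mor₃) (η₂ ∘ₗ Linear.leftComp k _ T.mor₂)
    (-(η₁' ∘ₗ Linear.rightComp k _ T'.mor₃)) fun x y hxy => ?_
  obtain ⟨w, hw, hw'⟩ : ∃ w : T.obj₂⟦(1 : ℤ)⟧ ⟶ T'.obj₁⟦(1 : ℤ)⟧,
      (-(T.mor₁⟦(1 : ℤ)⟧')) ≫ w = y ≫ T'.mor₃ ∧
        (-(T.mor₂⟦(1 : ℤ)⟧')) ≫ x⟦(1 : ℤ)⟧' = w ≫ (-(T'.mor₁⟦(1 : ℤ)⟧')) :=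
    complete_distinguished_triangle_morphism _ _
      (rot_of_distTriang _ (rot_of_distTriang _ hT)) (rot_of_distTriang _ hT') x y hxy.symm
  obtain ⟨w, rfl⟩ := (shiftFunctor D (1 : ℤ)).map_surjective w
  have e : T.mor₂ ≫ x = w ≫ T'.mor₁ :=
    (shiftFunctor D (1 : ℤ)).map_injective (by simpa using hw')
  have e' : y ≫ T'.mor₃ = -(T.mor₁ ≫ w)⟦(1 : ℤ)⟧' := by
    simpa using hw.symm
  simp only [LinearMap.comp_apply, Linear.leftComp_apply, LinearMap.neg_apply,
    Linear.rightComp_apply, e, e', comm, map_neg, hη₁', neg_neg]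

lemma IsSerreDual.exists_obj₃ [∀ n : ℤ, (shiftFunctor D n).Linear k]
    (h₁ : IsSerreDual η₁) (h₂ : IsSerreDual η₂) :
    ∃ η₃ : Module.Dual k (T.obj₃ ⟶ T'.obj₃), IsSerreDual η₃ := by
  obtain ⟨η₁', h₁', e₁⟩ := h₁.map (shiftFunctor D (1 : ℤ))
  obtain ⟨η₂', h₂', e₂⟩ := h₂.map (shiftFunctor D (1 : ℤ))
  obtain ⟨η₃, hη₂, hη₁⟩ := exists_dual_obj₃ hT hT' comm η₁' e₁
  have comm' (g : T.obj₂⟦(1 : ℤ)⟧ ⟶ T'.obj₁⟦(1 : ℤ)⟧) :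
      η₂' (g ≫ T'.mor₁⟦(1 : ℤ)⟧') = η₁' (T.mor₁⟦(1 : ℤ)⟧' ≫ g) := by
    obtain ⟨g, rfl⟩ := (shiftFunctor D (1 : ℤ)).map_surjective g
    rw [← Functor.map_comp, ← Functor.map_comp, e₁, e₂, comm]
  refine ⟨η₃, fun B => LinearMap.bijective_of_surjective_of_bijective_of_bijective_of_injective
    (Linear.leftComp k B (T.mor₁⟦(1 : ℤ)⟧')) (Linear.leftComp k B T.mor₃)
    (Linear.leftComp k B T.mor₂) (Linear.leftComp k B T.mor₁)
    (Linear.rightComp k B (T'.mor₁⟦(1 : ℤ)⟧')).dualMap (-(Linear.rightComp k B T'.mor₃).dualMap)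
    (Linear.rightComp k B T'.mor₂).dualMap (Linear.rightComp k B T'.mor₁).dualMap
    (serrePairing η₂' B) (serrePairing η₁' B) _ (serrePairing η₂ B) (serrePairing η₁ B)
    ?_ ?_ ?_ ?_ (exact_leftComp_shift k hT B) (exact_leftComp_obj₃ k hT B)
    (exact_leftComp_obj₂ k hT B)
    (exact_neg_right (exact_dualMap (exact_rightComp_shift k hT' B)))
    (exact_neg_left (exact_dualMap (exact_rightComp_obj₃ k hT' B)))
    (exact_dualMap (exact_rightComp_obj₂ k hT' B))
    (h₂' B).2 (h₁' B) (h₂ B) (h₁ B).1⟩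
  · ext f g
    simpa using comm' (f ≫ g)
  · ext f g
    simp [hη₁]
  · ext f g
    simpa using hη₂ (f ≫ g)
  · ext f g
    simpa using comm (f ≫ g)

end Cone

end Triangles

section GradedHom

open DirectSum

variable {k : Type u} [Field k] {D : Type u₁} [Category.{v₁} D] [Preadditive D] [Linear k D]
  [HasShift D ℤ]

/-- The graded vector space `⨁ n, Hom(A, B[n])`. -/
abbrev GradedHom (A B : D) : Type v₁ := ⨁ n : ℤ, (A ⟶ B⟦n⟧)

variable (k) in
/-- The objects `B` with `⨁ n, Hom(A, B[n])` finite dimensional. -/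
def extFiniteFrom (A : D) : ObjectProperty D := fun B => Module.Finite k (GradedHom A B)

variable (k) in
/-- The objects `A` with `⨁ n, Hom(A, B[n])` finite dimensional. -/
def extFiniteTo (B : D) : ObjectProperty D := fun A => Module.Finite k (GradedHom A B)

instance (A : D) : (extFiniteFrom k A).IsClosedUnderIsomorphisms where
  of_iso e (_ : Module.Finite k _) := Module.Finite.equiv <| DirectSum.congrLinearEquiv
    fun n => Linear.homCongr k (Iso.refl A) ((shiftFunctor D n).mapIso e)

instance (B : D) : (extFiniteTo k B).IsClosedUnderIsomorphisms where
  of_iso e (_ : Module.Finite k _) := Module.Finite.equiv <| DirectSum.congrLinearEquiv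
    fun n => Linear.homCongr k e (Iso.refl (B⟦n⟧))

lemma finite_hom_of_triangulatedExtFinite (h : TriangulatedExtFinite k D) (A B : D) :
    Module.Finite k (A ⟶ B) := by
  have := h A B
  have : Module.Finite k (A ⟶ B⟦(0 : ℤ)⟧) :=
    .of_surjective (DirectSum.component k ℤ (fun n : ℤ => A ⟶ B⟦n⟧) 0) fun f =>
      ⟨DirectSum.lof k ℤ (fun n : ℤ => A ⟶ B⟦n⟧) 0 f, DirectSum.component.lof_self ..⟩
  exact Module.Finite.equiv (Linear.homCongr k (Iso.refl A) ((shiftFunctorZero D ℤ).app B))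

variable [∀ n : ℤ, (shiftFunctor D n).Additive] [∀ n : ℤ, (shiftFunctor D n).Linear k]

/-- The isomorphism `Hom(A, B[m]) ≃ Hom(A[a], B[n])` given by the shift, for `m + a = n`. -/
noncomputable def shiftHomEquiv (A B : D) {m a n : ℤ}
    (h : m + a = n) : (A ⟶ B⟦m⟧) ≃ₗ[k] (A⟦a⟧ ⟶ B⟦n⟧) :=
  mapEquiv k (shiftFunctor D a) A (B⟦m⟧) ≪≫ₗ
  Linear.homCongr k (Iso.refl _) ((shiftFunctorAdd' D m a n h).symm.app B)

lemma extFiniteTo_shift {A B : D} (h : extFiniteTo k B A) (a : ℤ) :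
    extFiniteTo k B (A⟦a⟧) :=
  have : Module.Finite k (GradedHom A B) := h
  finite_directSum_of_injective (M := fun n : ℤ => A ⟶ B⟦n⟧) (add_left_injective (-a)) fun n =>
    shiftHomEquiv A B (neg_add_cancel_right n a)

end GradedHom

section Generation

open Pretriangulated DirectSum ZeroObject

variable {k : Type u} [Field k] {D : Type u₁} [Category.{v₁} D] [Preadditive D] [HasShift D ℤ]
  [HasZeroObject D] [∀ n : ℤ, (shiftFunctor D n).Additive] [Pretriangulated D]

lemma isTriangulated_of_cone (P : ObjectProperty D) [P.IsClosedUnderIsomorphisms] (zero : P 0)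
    (shift : ∀ X (n : ℤ), P X → P (X⟦n⟧))
    (cone : ∀ T : Triangle D, T ∈ distTriang D → P T.obj₁ → P T.obj₂ → P T.obj₃) :
    P.IsTriangulated :=
  have : P.ContainsZero := ⟨0, isZero_zero D, zero⟩
  have : P.IsStableUnderShift ℤ := ⟨fun n => ⟨fun X => shift X n⟩⟩
  have : P.IsTriangulatedClosed₃ := .mk' cone
  have : P.IsTriangulatedClosed₂ := .of_isTriangulatedClosed₃
  { }

/-- The objects `G i` generate the triangulated category `D`: no proper strictly full
triangulated subcategory contains all of them. -/
def Generates {ι : Type*} (G : ι → D) : Prop :=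
  ∀ (P : ObjectProperty D) [P.IsTriangulated] [P.IsClosedUnderIsomorphisms],
    (∀ i, P (G i)) → ∀ X, P X

variable [Linear k D]

section PerfectPairing

variable {A S : D} (η : Module.Dual k (A ⟶ S))

/-- The objects `B` such that `η` induces perfect pairings between `Hom(A, B[n])` and
`Hom(B[n], S)` for all `n`. -/
def perfectPairing : ObjectProperty D := fun B =>
  ∀ n : ℤ, Function.Bijective (serrePairing η (B⟦n⟧))

instance : (perfectPairing η).IsClosedUnderIsomorphisms where
  of_iso e h n := bijective_serrePairing_of_iso (h n) ((shiftFunctor D n).mapIso e)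

instance : (perfectPairing η).IsTriangulated :=
  isTriangulated_of_cone _
    (fun n => by
      have h0 : IsZero ((0 : D)⟦n⟧) := (shiftFunctor D n).map_isZero (isZero_zero D)
      refine ⟨fun f g _ => h0.eq_of_tgt f g, fun φ => ⟨0, LinearMap.ext fun g => ?_⟩⟩
      simp [h0.eq_of_src g 0])
    (fun _ m h n => bijective_serrePairing_of_iso (h _) ((shiftFunctorAdd D m n).app _))
    fun T hT h₁ h₂ n => bijective_serrePairing_obj₃ (Triangle.shift_distinguished _ hT n)
      (h₁ n) (h₂ n) (bijective_serrePairing_of_iso (h₁ _) ((shiftFunctorAdd D n 1).app _))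
      (bijective_serrePairing_of_iso (h₂ _) ((shiftFunctorAdd D n 1).app _))

lemma isSerreDual_of_generates {ι : Type*} {G : ι → D} (hG : Generates G)
    (h : ∀ (j : ι) (n : ℤ), Function.Bijective (serrePairing η ((G j)⟦n⟧))) : IsSerreDual η :=
  fun B => bijective_serrePairing_of_iso (hG (perfectPairing η) h B 0)
    ((shiftFunctorZero D ℤ).app B)

end PerfectPairing

section ExtFinite

instance (A : D) : (extFiniteFrom k A).IsTriangulated :=
  isTriangulated_of_cone _
    (by
      have (n : ℤ) : Subsingleton (A ⟶ (0 : D)⟦n⟧) :=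
        ⟨((shiftFunctor D n).map_isZero (isZero_zero D)).eq_of_tgt⟩
      exact inferInstanceAs (Module.Finite k (⨁ n : ℤ, (A ⟶ (0 : D)⟦n⟧))))
    (fun X m (_ : Module.Finite k _) => finite_directSum_of_injective
      (M := fun n : ℤ => A ⟶ X⟦n⟧) (add_right_injective m) fun n =>
      Linear.homCongr k (Iso.refl A) ((shiftFunctorAdd D m n).app X))
    fun T hT (_ : Module.Finite k _) (_ : Module.Finite k (GradedHom A T.obj₂)) => by
      have : Module.Finite k (⨁ n : ℤ, (A ⟶ T.obj₁⟦n⟧⟦(1 : ℤ)⟧)) :=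
        finite_directSum_of_injective (M := fun n : ℤ => A ⟶ T.obj₁⟦n⟧) (add_left_injective 1)
          fun n => Linear.homCongr k (Iso.refl A) ((shiftFunctorAdd D n 1).app _)
      exact finite_of_exact <| exact_lmap (L := fun n : ℤ => A ⟶ T.obj₂⟦n⟧)
        (N := fun n : ℤ => A ⟶ T.obj₁⟦n⟧⟦(1 : ℤ)⟧) fun n =>
          exact_rightComp_obj₃ k (Triangle.shift_distinguished _ hT n) A

variable [∀ n : ℤ, (shiftFunctor D n).Linear k]

instance (B : D) : (extFiniteTo k B).IsTriangulated :=
  isTriangulated_of_cone _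
    (by
      have (n : ℤ) : Subsingleton ((0 : D) ⟶ B⟦n⟧) := ⟨(isZero_zero D).eq_of_src⟩
      exact inferInstanceAs (Module.Finite k (⨁ n : ℤ, ((0 : D) ⟶ B⟦n⟧))))
    (fun _ a h => extFiniteTo_shift h a)
    fun T hT h₁ (_ : Module.Finite k _) => by
      have : Module.Finite k (GradedHom (T.obj₁⟦(1 : ℤ)⟧) B) := extFiniteTo_shift h₁ 1
      exact finite_of_exact <| exact_lmap fun n => exact_leftComp_obj₃ k hT (B⟦n⟧)

lemma triangulatedExtFinite_of_generates {ι : Type*} {G : ι → D} (hG : Generates G)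
    (h : ∀ i j, Module.Finite k (GradedHom (G i) (G j))) : TriangulatedExtFinite k D :=
  fun A B => hG (extFiniteTo k B) (fun i => hG (extFiniteFrom k (G i)) (h i) B) A

end ExtFinite

section SerreDualClasses

variable (k D) in
/-- The objects which have a Serre dual. -/
def hasSerreDual : ObjectProperty D := fun A =>
  ∃ (S : D) (η : Module.Dual k (A ⟶ S)), IsSerreDual η

variable (k D) in
/-- The objects which are Serre duals. -/
def isSerreDualOf : ObjectProperty D := fun S =>
  ∃ (A : D) (η : Module.Dual k (A ⟶ S)), IsSerreDual η

instance : (hasSerreDual k D).IsClosedUnderIsomorphisms where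
  of_iso e := fun ⟨S, _, h⟩ => ⟨S, _, h.of_iso e (Iso.refl S)⟩

instance : (isSerreDualOf k D).IsClosedUnderIsomorphisms where
  of_iso e := fun ⟨A, _, h⟩ => ⟨A, _, h.of_iso (Iso.refl A) e⟩

variable [∀ n : ℤ, (shiftFunctor D n).Linear k] [∀ X Y : D, Module.Finite k (X ⟶ Y)]

instance : (hasSerreDual k D).IsTriangulated :=
  isTriangulated_of_cone _ ⟨0, 0, isSerreDual_zero⟩
    (fun _ n ⟨_, _, h⟩ => by
      obtain ⟨η, h, -⟩ := h.map (shiftFunctor D n)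
      exact ⟨_, η, h⟩)
    (fun T hT ⟨S₁, η₁, h₁⟩ ⟨S₂, η₂, h₂⟩ => by
      obtain ⟨v, hv⟩ := h₂.exists_comp_eq (η₁ ∘ₗ Linear.leftComp k _ T.mor₁)
      obtain ⟨_, _, _, hT'⟩ := distinguished_cocone_triangle v
      exact ⟨_, IsSerreDual.exists_obj₃ hT hT' hv h₁ h₂⟩)

instance : (isSerreDualOf k D).IsTriangulated :=
  isTriangulated_of_cone _ ⟨0, 0, isSerreDual_zero⟩
    (fun _ n ⟨_, _, h⟩ => by
      obtain ⟨η, h, -⟩ := h.map (shiftFunctor D n)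
      exact ⟨_, η, h⟩)
    (fun T hT ⟨A₁, η₁, h₁⟩ ⟨A₂, η₂, h₂⟩ => by
      obtain ⟨u, hu⟩ := (h₁ A₂).2 (η₂ ∘ₗ Linear.rightComp k _ T.mor₁)
      obtain ⟨_, _, _, hT'⟩ := distinguished_cocone_triangle u
      exact ⟨_, IsSerreDual.exists_obj₃ hT' hT (fun g => (LinearMap.congr_fun hu g).symm) h₁ h₂⟩)

lemma nonempty_serreFunctor_of_generates {ι : Type*} {G : ι → D} (hG : Generates G)
    (h : ∀ i, hasSerreDual k D (G i)) (h' : ∀ i, isSerreDualOf k D (G i)) :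
    Nonempty (SerreFunctor k D) := by
  choose S η hS using hG (hasSerreDual k D) h
  refine nonempty_serreFunctor hS fun B => ?_
  obtain ⟨A, η', h⟩ := hG (isSerreDualOf k D) h' B
  exact ⟨A, (hS A).nonempty_iso h⟩

end SerreDualClasses

theorem triangulatedSerreDuality_of_generates [∀ n : ℤ, (shiftFunctor D n).Linear k] {ι : Type*}
    {G : ι → D} (hG : Generates G) (hfin : ∀ i j, Module.Finite k (GradedHom (G i) (G j)))
    {S : ι → D} (hS : ∀ j, ∃ (i : ι) (n : ℤ), Nonempty ((S i)⟦n⟧ ≅ G j))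
    (η : ∀ i, Module.Dual k (G i ⟶ S i))
    (hη : ∀ i j (n : ℤ), Function.Bijective (serrePairing (η i) ((G j)⟦n⟧))) :
    TriangulatedSerreDuality k D := by
  have ext_finite : TriangulatedExtFinite k D := triangulatedExtFinite_of_generates hG hfin
  have := finite_hom_of_triangulatedExtFinite ext_finite
  have dual (i : ι) : IsSerreDual (η i) := isSerreDual_of_generates (η i) hG (hη i)
  refine ⟨ext_finite, nonempty_serreFunctor_of_generates hG (fun i => ⟨_, _, dual i⟩) fun j => ?_⟩
  obtain ⟨i, n, ⟨e⟩⟩ := hS j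
  exact (isSerreDualOf k D).prop_of_iso e
    ((isSerreDualOf k D).le_shift n _ ⟨_, _, dual i⟩)

end Generation

/-! ### Effaceability of extension groups -/

section Effaceability

open Abelian DerivedCategory HomologicalComplex

variable {C : Type u} [Category.{v} C] [Abelian C]

lemma exists_single_comp_eq_map_mono {L : CochainComplex C ℤ} {i : ℤ} [L.IsStrictlyGE i] {Y : C}
    (s : (single C (ComplexShape.up ℤ) i).obj Y ⟶ L) (_ : QuasiIso s) :
    ∃ (α : Y ⟶ L.X i) (_ : Mono α) (π : L ⟶ (single C (ComplexShape.up ℤ) i).obj (L.X i)),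
      s ≫ π = (single C (ComplexShape.up ℤ) i).map α := by
  let e := L.pOpcyclesIso (i - 1) i (by simp)
    ((L.isZero_of_isStrictlyGE i (i - 1) (by simp)).eq_of_src _ _)
  let α := (singleObjHomologySelfIso _ _ _).inv ≫ homologyMap s i ≫ L.homologyι i ≫ e.inv
  have hα : s.f i = (singleObjXSelf (ComplexShape.up ℤ) i Y).hom ≫ α := by
    rw [← cancel_mono e.hom]
    simp only [α, Category.assoc, Iso.inv_hom_id, Category.comp_id]
    rw [show e.hom = L.pOpcycles i from rfl, homologyι_naturality,
      singleObjHomologySelfIso_inv_homologyι_assoc,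
      ← pOpcycles_singleObjOpcyclesSelfIso_inv_assoc, Iso.inv_hom_id_assoc, p_opcyclesMap]
  let π : L ⟶ (single C (ComplexShape.up ℤ) i).obj (L.X i) := mkHomToSingle (𝟙 _) (by
    rintro j rfl
    apply (L.isZero_of_isStrictlyGE (j + 1) j (by simp)).eq_of_src)
  refine ⟨α, by dsimp [α]; infer_instance, π, to_single_hom_ext ?_⟩
  rw [comp_f, mkHomToSingle_f, hα, single_map_f_self]
  simp

lemma exists_mono_comp_singleFunctor_map_eq_zero [HasDerivedCategory.{w} C]
    {K : CochainComplex C ℤ} {n : ℤ} [K.IsStrictlyGE n] {i : ℤ} (hi : i < n) {Y : C}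
    (φ : Q.obj K ⟶ (singleFunctor C i).obj Y) :
    ∃ (Y' : C) (f : Y ⟶ Y') (_ : Mono f), φ ≫ (singleFunctor C i).map f = 0 := by
  obtain ⟨L, _, g, s, hs, rfl⟩ :=
    left_fac_of_isStrictlyGE (Y := (CochainComplex.singleFunctor C i).obj Y) φ i
  have : QuasiIso s := by rwa [isIso_Q_map_iff_quasiIso] at hs
  obtain ⟨α, hα, π, hπ⟩ := exists_single_comp_eq_map_mono s this
  have hgπ : g ≫ π = 0 := to_single_hom_ext <| (K.isZero_of_isStrictlyGE n i hi).eq_of_src _ _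
  have hsα : inv (Q.map s) ≫ Q.map ((single C (ComplexShape.up ℤ) i).map α) = Q.map π := by
    rw [IsIso.inv_comp_eq]
    exact (congrArg Q.map hπ).symm.trans (Q.map_comp s π)
  have hφα : Q.map g ≫ Q.map π = 0 := by rw [← Q.map_comp, hgπ, Q.map_zero]
  exact ⟨L.X i, α, hα, (Category.assoc _ _ _).trans ((congrArg (Q.map g ≫ ·) hsα).trans hφα)⟩

lemma exists_mono_comp_mk₀_eq_zero [HasExt.{w} C] {X Y : C} {n : ℕ} (e : Ext X Y (n + 1)) :
    ∃ (Y' : C) (f : Y ⟶ Y') (_ : Mono f), e.comp (Ext.mk₀ f) (add_zero _) = 0 := by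
  let := HasDerivedCategory.standard C
  let σ := (singleFunctors C).shiftIso (n + 1) (-(n + 1)) 0 (by lia)
  obtain ⟨Y', f, hf, hf'⟩ := exists_mono_comp_singleFunctor_map_eq_zero
    (K := (CochainComplex.singleFunctor C 0).obj X) (by lia : (-(n + 1) : ℤ) < 0)
    (e.hom ≫ σ.hom.app Y)
  refine ⟨Y', f, hf, Ext.homEquiv.injective ?_⟩
  change (e.comp (Ext.mk₀ f) (add_zero _)).hom = (0 : Ext X Y' (n + 1)).hom
  rw [← Ext.hom_comp_singleFunctor_map_shift, Ext.zero_hom, ← cancel_mono (σ.hom.app Y'), zero_comp]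
  exact ((Category.assoc _ _ _).trans ((congrArg (e.hom ≫ ·) (σ.hom.naturality f)).trans
    (Category.assoc _ _ _).symm)).trans hf'

end Effaceability

/-! ### The bounded derived category -/

section TStructure

open Pretriangulated Triangulated

variable {D : Type u₁} [Category.{v₁} D] [Preadditive D] [HasZeroObject D] [HasShift D ℤ]
  [∀ n : ℤ, (shiftFunctor D n).Additive] [Pretriangulated D] {t : TStructure D}
  {P : ObjectProperty D} [P.IsTriangulated] [P.IsClosedUnderIsomorphisms]

lemma prop_of_heart_le (h : t.heart ≤ P) (X : D) (a : ℤ) [t.IsGE X a] [t.IsLE X a] : P X :=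
  P.prop_of_iso (shiftShiftNeg X a) <| P.le_shift (-a) _ <| h _
    ⟨(t.isLE_shift X a a 0).le, (t.isGE_shift X a a 0).ge⟩

lemma bounded_le_of_heart_le [IsTriangulated D] (h : t.heart ≤ P) : t.bounded ≤ P := by
  suffices H : ∀ (n : ℕ) (a : ℤ) (X : D), t.IsGE X a → t.IsLE X (a + n) → P X by
    rintro X ⟨⟨a, ha⟩, ⟨b, hb⟩⟩
    exact H (b - a).toNat a X ha (t.isLE_of_le X b _ (by lia))
  intro n
  induction n with
  | zero =>
    intro a X _ hX
    rw [Nat.cast_zero, add_zero] at hX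
    exact prop_of_heart_le h X a
  | succ n ih =>
    intro a X _ hX
    have : t.IsLE X (a + 1 + n) := by
      rwa [add_right_comm, add_assoc a n 1]
    exact P.ext_of_isTriangulatedClosed₂ _ (t.triangleLTGE_distinguished (a + 1) X)
      (prop_of_heart_le h ((t.truncLT (a + 1)).obj X) a)
      (ih (a + 1) ((t.truncGE (a + 1)).obj X) inferInstance inferInstance)

end TStructure

section BoundedDerivedCategory

open Pretriangulated DerivedCategory

variable {C : Type u₁} [Category.{v₁} C] [Abelian C] [HasDerivedCategory.{w} C]

variable (C) in
/-- The embedding of `C` into its bounded derived category, as complexes concentrated in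
degree zero. -/
noncomputable def boundedSingle : C ⥤ BoundedDerivedCategory C :=
  (TStructure.t (C := C)).bounded.lift (singleFunctor C 0)
    fun _ => ⟨⟨0, inferInstance⟩, ⟨0, inferInstance⟩⟩

instance : (boundedSingle C).Full :=
  Functor.Full.of_comp_faithful_iso (TStructure.t.bounded.liftCompιIso (singleFunctor C 0) _)

instance : (boundedSingle C).Faithful :=
  Functor.Faithful.of_comp_iso (TStructure.t.bounded.liftCompιIso (singleFunctor C 0) _)

instance : (boundedSingle C).Additive where
  map_add := Bounded.ι.map_injective (singleFunctor C 0).map_add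

lemma exists_boundedSingle_triangle {S : ShortComplex C} (hS : S.ShortExact) :
    ∃ h, Triangle.mk ((boundedSingle C).map S.f) ((boundedSingle C).map S.g) h ∈
      distTriang (BoundedDerivedCategory C) := by
  refine ⟨ObjectProperty.homMk
    (hS.singleδ ≫ (Bounded.ι.commShiftIso (1 : ℤ)).inv.app ((boundedSingle C).obj S.X₁)), ?_⟩
  refine isomorphic_distinguished _ hS.singleTriangle_distinguished _
    (Triangle.isoMk _ _ (Iso.refl _) (Iso.refl _) (Iso.refl _)
      ((Category.comp_id _).trans (Category.id_comp _).symm)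
      ((Category.comp_id _).trans (Category.id_comp _).symm) ?_)
  have h₁ := congrArg (hS.singleδ ≫ ·)
    ((Bounded.ι.commShiftIso (1 : ℤ)).inv_hom_id_app ((boundedSingle C).obj S.X₁))
  have h₂ := CategoryTheory.Functor.map_id (shiftFunctor (DerivedCategory C) (1 : ℤ))
    ((singleFunctor C 0).obj S.X₁)
  exact (congrArg₂ (· ≫ ·) ((Category.assoc _ _ _).trans (h₁.trans (Category.comp_id _))) h₂).trans
    ((Category.comp_id _).trans (Category.id_comp _).symm)

lemma boundedSingle_hom_shift_eq_zero {X Y : C} {n : ℤ} (hn : n < 0)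
    (f : (boundedSingle C).obj X ⟶ ((boundedSingle C).obj Y)⟦n⟧) : f = 0 := by
  apply Bounded.ι.map_injective
  rw [Functor.map_zero, ← cancel_mono ((Bounded.ι.commShiftIso n).hom.app _), zero_comp]
  have := TStructure.t.isGE_shift ((singleFunctor C 0).obj Y) 0 n (-n)
  exact TStructure.t.zero (X := (singleFunctor C 0).obj X) (Y := ((singleFunctor C 0).obj Y)⟦n⟧)
    _ 0 (-n)

section Property

variable (P : ObjectProperty (BoundedDerivedCategory C)) [P.IsTriangulated]
  [P.IsClosedUnderIsomorphisms]

lemma prop_of_boundedSingle (h : ∀ Y : C, P ((boundedSingle C).obj Y))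
    (X : BoundedDerivedCategory C) : P X := by
  refine bounded_le_of_heart_le (t := TStructure.t.onBounded) (fun X hX => ?_) X ?_
  · have : X.obj.IsLE 0 := ⟨hX.1⟩
    have : X.obj.IsGE 0 := ⟨hX.2⟩
    obtain ⟨Y, ⟨e⟩⟩ := exists_iso_singleFunctor_obj_of_isGE_of_isLE X.obj 0
    exact P.prop_of_iso (TStructure.t.bounded.fullyFaithfulι.preimageIso
      (X := (boundedSingle C).obj Y) (Y := X) e.symm) (h Y)
  · obtain ⟨⟨a, ha⟩, ⟨b, hb⟩⟩ := X.property
    exact ⟨⟨a, ⟨ha.ge⟩⟩, ⟨b, ⟨hb.le⟩⟩⟩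

instance : (P.inverseImage (boundedSingle C)).IsClosedUnderExtensions where
  prop_X₂_of_shortExact hS h₁ h₃ :=
    let ⟨_, hT⟩ := exists_boundedSingle_triangle hS
    P.ext_of_isTriangulatedClosed₂ _ hT h₁ h₃

lemma boundedSingle_prop_X₃ {S : ShortComplex C} (hS : S.ShortExact)
    (h₁ : P ((boundedSingle C).obj S.X₁)) (h₂ : P ((boundedSingle C).obj S.X₂)) :
    P ((boundedSingle C).obj S.X₃) :=
  let ⟨_, hT⟩ := exists_boundedSingle_triangle hS
  P.ext_of_isTriangulatedClosed₃ _ hT h₁ h₂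

end Property

section Linear

variable {k : Type u} [Field k] [Linear k C]

instance (n : ℤ) : (shiftFunctor (BoundedDerivedCategory C) n).Linear k where
  map_smul {X Y} f r := by
    apply Bounded.ι.map_injective
    have h (g : X ⟶ Y) := (Bounded.ι.commShiftIso n).hom.naturality g
    dsimp only [Functor.comp_map] at h
    rw [← cancel_mono ((Bounded.ι.commShiftIso n).hom.app Y), h, Functor.map_smul,
      Functor.map_smul, Functor.map_smul, Linear.smul_comp, h, Linear.comp_smul]

instance : (boundedSingle C).Linear k where
  map_smul f r := Bounded.ι.map_injective ((singleFunctor C 0).map_smul r f)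

variable [HasExt.{w'} C]

open Abelian

variable (k) in
/-- The isomorphism between `Ext^n(X, Y)` and `Hom(X, Y[n])` in the bounded derived category. -/
noncomputable def extEquiv (X Y : C) (n : ℕ) :
    Ext X Y n ≃ₗ[k] ((boundedSingle C).obj X ⟶ ((boundedSingle C).obj Y)⟦(n : ℤ)⟧) :=
  Ext.homLinearEquiv (R := k) ≪≫ₗ
  Linear.homCongr k (Iso.refl ((singleFunctor C 0).obj X))
    ((Bounded.ι.commShiftIso (n : ℤ)).symm.app ((boundedSingle C).obj Y)) ≪≫ₗ
  (mapEquiv k Bounded.ι ((boundedSingle C).obj X) (((boundedSingle C).obj Y)⟦(n : ℤ)⟧)).symm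

lemma ι_map_extEquiv {X Y : C} {n : ℕ} (ξ : Ext X Y n) :
    Bounded.ι.map (extEquiv k X Y n ξ) =
      ξ.hom ≫ (Bounded.ι.commShiftIso (n : ℤ)).inv.app ((boundedSingle C).obj Y) :=
  (LinearEquiv.apply_symm_apply
    (mapEquiv k Bounded.ι ((boundedSingle C).obj X) (((boundedSingle C).obj Y)⟦(n : ℤ)⟧)) _).trans
    (congrArg (· ≫ _) (Category.id_comp ξ.hom))

lemma extEquiv_mk₀_comp {X Y Z : C} {n : ℕ} (f : X ⟶ Y) (ξ : Ext Y Z n) :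
    extEquiv k X Z n ((Ext.mk₀ f).comp ξ (zero_add n)) =
      (boundedSingle C).map f ≫ extEquiv k Y Z n ξ := by
  apply Bounded.ι.map_injective
  rw [Functor.map_comp, ι_map_extEquiv, ι_map_extEquiv, ← Ext.singleFunctor_map_comp_hom]
  exact Category.assoc _ _ _

lemma extEquiv_comp_mk₀ {X Y Z : C} {n : ℕ} (ξ : Ext X Y n) (f : Y ⟶ Z) :
    extEquiv k X Z n (ξ.comp (Ext.mk₀ f) (add_zero n)) =
      extEquiv k X Y n ξ ≫ ((boundedSingle C).map f)⟦(n : ℤ)⟧' := by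
  apply Bounded.ι.map_injective
  rw [Functor.map_comp, ι_map_extEquiv, ι_map_extEquiv, ← Ext.hom_comp_singleFunctor_map_shift]
  have h := (Bounded.ι.commShiftIso (n : ℤ)).inv.naturality ((boundedSingle C).map f)
  exact ((Category.assoc _ _ _).trans (congrArg (ξ.hom ≫ ·) h)).trans (Category.assoc _ _ _).symm

lemma abelianExtFinite_of_triangulatedExtFinite
    (h : TriangulatedExtFinite k (BoundedDerivedCategory C)) : AbelianExtFinite.{w'} k C :=
  fun X Y =>
    have := h ((boundedSingle C).obj X) ((boundedSingle C).obj Y)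
    finite_directSum_of_injective
      (M := fun n : ℤ => (boundedSingle C).obj X ⟶ ((boundedSingle C).obj Y)⟦n⟧)
      Nat.cast_injective fun n => (extEquiv k X Y n).symm

end Linear

end BoundedDerivedCategory

/-! ### Finitely generated graded modules -/

section Graded

open Polynomial DirectSum

variable {k : Type u} [Field k] (M : GrMod k)

lemma map_map_apply {l m n : ℤ} (h : l ≤ m) (h' : m ≤ n) (z : M.obj l) :
    M.map (homOfLE h') (M.map (homOfLE h) z) = M.map (homOfLE (h.trans h')) z :=
  (ConcreteCategory.congr_hom (M.map_comp (homOfLE h) (homOfLE h')) z).symm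

lemma map_refl_apply {n : ℤ} (z : M.obj n) : M.map (homOfLE (le_refl n)) z = z :=
  ConcreteCategory.congr_hom (M.map_id n) z

/-- The inclusion of the degree `n` part of a graded module into the total module. -/
noncomputable def homogeneous (n : ℤ) : M.obj n →ₗ[k] Total M :=
  (Module.AEval'.of (mulX M)).toLinearMap ∘ₗ DirectSum.lof k ℤ (fun n => M.obj n) n

lemma of_symm_homogeneous (n : ℤ) (z : M.obj n) :
    (Module.AEval'.of (mulX M)).symm (homogeneous M n z) = DirectSum.of (fun n => M.obj n) n z :=
  LinearEquiv.symm_apply_apply _ _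

lemma X_smul_homogeneous (n : ℤ) (z : M.obj n) : (X : k[X]) • homogeneous M n z =
    homogeneous M (n + 1) (M.map (homOfLE (by lia : n ≤ n + 1)) z) :=
  (Module.AEval'.X_smul_of (mulX M) _).trans (congrArg (Module.AEval'.of (mulX M)) (mulX_lof M n z))

lemma homogeneous_map {n m : ℤ} (h : n ≤ m) (z : M.obj n) :
    homogeneous M m (M.map (homOfLE h) z) = (X ^ (m - n).toNat : k[X]) • homogeneous M n z := by
  induction m, h using Int.leInduction with
  | base => rw [map_refl_apply, sub_self, Int.toNat_zero, pow_zero, one_smul]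
  | succ m h ih =>
    rw [show (m + 1 - n).toNat = (m - n).toNat + 1 by lia, pow_succ', mul_smul, ← ih,
      X_smul_homogeneous, map_map_apply]

lemma monomial_smul_homogeneous (j : ℕ) (c : k) {n : ℤ} (z : M.obj n) :
    monomial j c • homogeneous M n z =
      c • homogeneous M (n + j) (M.map (homOfLE (by lia : n ≤ n + j)) z) := by
  rw [homogeneous_map, add_sub_cancel_left, Int.toNat_natCast, ← C_mul_X_pow_eq_monomial, mul_smul,
    Module.AEval.C_smul]

lemma span_homogeneous_eq_top :
    Submodule.span k[X] (Set.range fun z : Σ n, M.obj n => homogeneous M z.1 z.2) = ⊤ := by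
  classical
  refine eq_top_iff.2 fun y _ => ?_
  obtain ⟨y, rfl⟩ := (Module.AEval'.of (mulX M)).surjective y
  induction y using DirectSum.induction_on with
  | zero => rw [map_zero]; exact zero_mem _
  | add a b ha hb => rw [map_add]; exact add_mem (ha trivial) (hb trivial)
  | of n w => exact Submodule.subset_span ⟨⟨n, w⟩, rfl⟩

/-- The degree `n` part of the graded submodule generated by a set of homogeneous elements. -/
def spanDegree (S : Set (Σ n, M.obj n)) (n : ℤ) : Submodule k (M.obj n) :=
  Submodule.span k {w | ∃ z ∈ S, ∃ h : z.1 ≤ n, M.map (homOfLE h) z.2 = w}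

variable {M}

lemma of_symm_apply_mem_spanDegree {S : Set (Σ n, M.obj n)} {y : Total M}
    (hy : y ∈ Submodule.span k[X] ((fun z : Σ n, M.obj n => homogeneous M z.1 z.2) '' S)) (n : ℤ) :
    (Module.AEval'.of (mulX M)).symm y n ∈ spanDegree M S n := by
  classical
  induction hy using Submodule.closure_induction with
  | zero => rw [map_zero]; exact zero_mem _
  | add x y _ _ hx hy => rw [map_add]; exact add_mem hx hy
  | smul_mem p x hx =>
    obtain ⟨z, hz, rfl⟩ := hx
    induction p using Polynomial.induction_on' with
    | add p q hp hq => rw [add_smul, map_add]; exact add_mem hp hq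
    | monomial j c =>
      rw [monomial_smul_homogeneous, map_smul, of_symm_homogeneous]
      refine Submodule.smul_mem _ _ ?_
      rcases eq_or_ne (z.1 + j) n with rfl | hn
      · rw [DirectSum.of_eq_same]
        exact Submodule.subset_span ⟨z, hz, _, rfl⟩
      · rw [DirectSum.of_eq_of_ne _ _ _ hn.symm]
        exact zero_mem _

lemma isFG_iff : isFG k M ↔ ∃ S : Set (Σ n, M.obj n), S.Finite ∧ ∀ n, spanDegree M S n = ⊤ := by
  classical
  constructor
  · intro hM
    have hfg := Module.finite_def.1 hM
    rw [← span_homogeneous_eq_top M, Submodule.fg_span_iff_fg_span_finset_subset] at hfg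
    obtain ⟨T, hT, hspan⟩ := hfg
    rw [← Set.image_univ, Finset.subset_set_image_iff] at hT
    obtain ⟨S, -, rfl⟩ := hT
    rw [span_homogeneous_eq_top, Finset.coe_image] at hspan
    refine ⟨S, S.finite_toSet, fun n => eq_top_iff.2 fun w _ => ?_⟩
    have hw := of_symm_apply_mem_spanDegree (hspan ▸ Submodule.mem_top : homogeneous M n w ∈ _) n
    rwa [of_symm_homogeneous, DirectSum.of_eq_same] at hw
  · rintro ⟨S, hS, hspan⟩
    refine Module.finite_def.2 (Submodule.fg_def.2
      ⟨(fun z : Σ n, M.obj n => homogeneous M z.1 z.2) '' S, hS.image _, ?_⟩)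
    rw [eq_top_iff, ← span_homogeneous_eq_top, Submodule.span_le]
    rintro _ ⟨⟨n, w⟩, rfl⟩
    have hle : spanDegree M S n ≤ ((Submodule.span k[X]
        ((fun z : Σ n, M.obj n => homogeneous M z.1 z.2) '' S)).restrictScalars k).comap
        (homogeneous M n) := by
      refine Submodule.span_le.2 ?_
      rintro _ ⟨z, hz, h, rfl⟩
      change homogeneous M n _ ∈ Submodule.span k[X] _
      rw [homogeneous_map]
      exact Submodule.smul_mem _ _ (Submodule.subset_span ⟨z, hz, rfl⟩)
    exact hle (hspan n ▸ Submodule.mem_top)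

lemma exists_forall_lt_subsingleton (hM : isFG k M) : ∃ a : ℤ, ∀ n < a, Subsingleton (M.obj n) := by
  obtain ⟨S, hS, hspan⟩ := isFG_iff.1 hM
  obtain ⟨a, ha⟩ := (hS.image Sigma.fst).bddBelow
  refine ⟨a, fun n hn => (Submodule.subsingleton_iff k).1 ?_⟩
  refine subsingleton_of_bot_eq_top (.symm ?_)
  rw [← hspan n, spanDegree, Submodule.span_eq_bot]
  rintro _ ⟨z, hz, h, -⟩
  exact absurd (ha (Set.mem_image_of_mem _ hz)) (by lia)

lemma finite_obj (hM : isFG k M) (n : ℤ) : Module.Finite k (M.obj n) := by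
  classical
  obtain ⟨S, hS, hspan⟩ := isFG_iff.1 hM
  refine Module.finite_def.2 (Submodule.fg_def.2 ⟨_, ?_, hspan n⟩)
  refine (hS.image fun z => if h : z.1 ≤ n then M.map (homOfLE h) z.2 else 0).subset ?_
  rintro _ ⟨z, hz, h, rfl⟩
  exact ⟨z, hz, dif_pos h⟩

lemma exists_surjective_map (hM : isFG k M) :
    ∃ b : ℤ, ∀ n m (h : n ≤ m), b ≤ n → Function.Surjective (M.map (homOfLE h)) := by
  obtain ⟨S, hS, hspan⟩ := isFG_iff.1 hM
  obtain ⟨b, hb⟩ := (hS.image Sigma.fst).bddAbove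
  refine ⟨b, fun n m h hn => (LinearMap.range_eq_top (f := (M.map (homOfLE h)).hom)).1 ?_⟩
  rw [eq_top_iff, ← hspan m, spanDegree, Submodule.span_le]
  rintro _ ⟨z, hz, h', rfl⟩
  have hzb : z.1 ≤ b := hb (Set.mem_image_of_mem _ hz)
  exact ⟨M.map (homOfLE (hzb.trans hn)) z.2, map_map_apply M _ h z.2⟩

lemma exists_bijective_map (hM : isFG k M) :
    ∃ b : ℤ, ∀ n m (h : n ≤ m), b ≤ n → Function.Bijective (M.map (homOfLE h)) := by
  obtain ⟨b, hb⟩ := exists_surjective_map hM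
  have := finite_obj hM b
  let K : ℕ →o Submodule k (M.obj b) :=
    { toFun j := LinearMap.ker (M.map (homOfLE (by lia : b ≤ b + j))).hom
      monotone' i j hij z hz := by
        refine (map_map_apply M (by lia : b ≤ b + i) (by lia : b + i ≤ b + j) z).symm.trans ?_
        exact (congrArg _ hz).trans (map_zero (M.map _).hom) }
  obtain ⟨N, hN⟩ := monotone_stabilizes_iff_noetherian.2 (inferInstanceAs
    (IsNoetherian k (M.obj b))) K
  refine ⟨b + N, fun n m h hn => ⟨?_, hb n m h (by lia)⟩⟩
  rw [← AddMonoidHom.coe_coe, injective_iff_map_eq_zero]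
  intro z hz
  obtain ⟨y, rfl⟩ := hb b n (by lia) le_rfl z
  obtain ⟨i, rfl⟩ := Int.le.dest (by lia : b ≤ n)
  obtain ⟨j, rfl⟩ := Int.le.dest (by lia : b ≤ m)
  have hy : y ∈ K j := (map_map_apply M (by lia : b ≤ b + i) h y).symm.trans hz
  rwa [← hN j (by lia), hN i (by lia)] at hy

end Graded

/-! ### The graded pieces of an object -/

section JointlyFaithful

variable {C : Type u₁} [Category.{v₁} C] {ι : Type w} {D : ι → Type u₂}
  [∀ i, Category.{v₂} (D i)] {F : ∀ i, C ⥤ D i}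

lemma isZero_of_jointlyFaithful [HasZeroMorphisms C] (hF : JointlyFaithful F) {X : C}
    (h : ∀ i, IsZero ((F i).obj X)) : IsZero X :=
  (IsZero.iff_id_eq_zero X).2 (hF.map_injective fun i => (h i).eq_of_src _ _)

lemma shortExact_of_jointlyFaithful [Abelian C] [∀ i, Abelian (D i)] (hF : JointlyFaithful F)
    [∀ i, (F i).PreservesZeroMorphisms] [∀ i, (F i).PreservesHomology] (S : ShortComplex C)
    (h : ∀ i, (S.map (F i)).ShortExact) : S.ShortExact where
  exact := by
    rw [ShortComplex.exact_iff_isZero_homology]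
    exact isZero_of_jointlyFaithful hF fun i => IsZero.of_iso
      ((ShortComplex.exact_iff_isZero_homology _).1 (h i).exact) (S.mapHomologyIso (F i)).symm
  mono_f :=
    have (i : ι) : Mono ((F i).map S.f) := (h i).mono_f
    hF.jointlyReflectMonomorphisms.mono S.f
  epi_g :=
    have (i : ι) : Epi ((F i).map S.g) := (h i).epi_g
    hF.jointlyReflectEpimorphisms.epi S.g

end JointlyFaithful

section Components

variable {k : Type u} [Field k]

variable (k) in
/-- The degree `n` part `M n` of the graded module of an object. -/
noncomputable def deg (n : ℤ) : ZDCategory k ⥤ ModuleCat.{u} k :=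
  CategoricalPullback.π₂ _ _ ⋙ (isFG k).ι ⋙ (evaluation ℤ (ModuleCat.{u} k)).obj n

instance (n : ℤ) : PreservesFiniteLimits (deg k n) := by
  unfold deg; infer_instance
instance (n : ℤ) : PreservesFiniteColimits (deg k n) := by
  unfold deg; infer_instance
instance (n : ℤ) : (deg k n).Additive where
  map_add := rfl

variable (k) in
/-- The summand of `(M_x)₀` with index `i`: `V₀` for `false` and `V₁` for `true`. -/
noncomputable def vec (i : Bool) : ZDCategory k ⥤ ModuleCat.{u} k :=
  CategoricalPullback.π₁ _ _ ⋙
    (bif i then CategoryTheory.Prod.snd (Vec k) (Vec k)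
      else CategoryTheory.Prod.fst (Vec k) (Vec k)) ⋙
      (ModuleCat.isFG k).ι

instance (i : Bool) : PreservesFiniteLimits (vec k i) := by
  have : PreservesFiniteLimits (ModuleCat.isFG k).ι :=
    inferInstanceAs (PreservesFiniteLimits (forget₂ (FGModuleCat.{u} k) (ModuleCat.{u} k)))
  cases i <;> dsimp [vec] <;> infer_instance

variable (k) in
/-- Multiplication by `x ^ (m - n)`. -/
noncomputable def mulPow {n m : ℤ} (h : n ≤ m) : deg k n ⟶ deg k m where
  app X := X.snd.obj.map (homOfLE h)
  naturality _ _ f := (f.snd.hom.naturality (homOfLE h)).symm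

lemma mulPow_mulPow (X : ZDCategory k) {l m n : ℤ} (h : l ≤ m) (h' : m ≤ n)
    (z : (deg k l).obj X) :
    (mulPow k h').app X ((mulPow k h).app X z) = (mulPow k (h.trans h')).app X z :=
  map_map_apply X.snd.obj h h' z

lemma mulPow_refl (X : ZDCategory k) {l : ℤ} (z : (deg k l).obj X) :
    (mulPow k (le_refl l)).app X z = z :=
  map_refl_apply X.snd.obj z

lemma deg_map_mulPow {X Y : ZDCategory k} (f : X ⟶ Y) {n m : ℤ} (h : n ≤ m)
    (z : (deg k n).obj X) :
    (deg k m).map f ((mulPow k h).app X z) = (mulPow k h).app Y ((deg k n).map f z) :=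
  (ConcreteCategory.congr_hom ((mulPow k h).naturality f) z).symm

lemma deg_map_smul {X Y : ZDCategory k} (c : k) (f : X ⟶ Y) (n : ℤ) (z : (deg k n).obj X) :
    (deg k n).map (c • f) z = c • (deg k n).map f z := rfl

lemma deg_map_zero {X Y : ZDCategory k} (n : ℤ) (z : (deg k n).obj X) :
    (deg k n).map (0 : X ⟶ Y) z = 0 := rfl

lemma deg_map_comp {X Y Z : ZDCategory k} (f : X ⟶ Y) (g : Y ⟶ Z) (n : ℤ)
    (z : (deg k n).obj X) : (deg k n).map (f ≫ g) z = (deg k n).map g ((deg k n).map f z) := rfl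

/-- The isomorphism `(M_x)₀ ≅ V₀ ⊕ V₁` that is part of an object. -/
noncomputable def locIso (X : ZDCategory k) :
    (colimit X.snd.obj : ModuleCat.{u} k) ≅ ModuleCat.of k (X.fst.1 × X.fst.2) :=
  (ModuleCat.isFG k).ι.mapIso X.iso.symm

lemma comp_locIso_hom_iff {X Y : ZDCategory k} (f : X.snd ⟶ Y.snd) (g : X.fst ⟶ Y.fst) :
    colimMap f.hom ≫ (locIso Y).hom =
        (locIso X).hom ≫ ModuleCat.ofHom (g.1.hom.hom.prodMap g.2.hom.hom) ↔
      (sumFunctor k).map g ≫ Y.iso.hom = X.iso.hom ≫ (locDegreeZero k).map f := by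
  have hiff : X.iso.inv ≫ (sumFunctor k).map g = (locDegreeZero k).map f ≫ Y.iso.inv ↔
      (sumFunctor k).map g ≫ Y.iso.hom = X.iso.hom ≫ (locDegreeZero k).map f := by
    rw [Iso.inv_comp_eq, ← Category.assoc, Iso.eq_comp_inv]
  rw [← hiff]
  exact ⟨fun h => (ModuleCat.isFG k).ι.map_injective h.symm,
    fun h => (congrArg (ModuleCat.isFG k).ι.map h).symm⟩

/-- The components `M n ⟶ (M_x)₀ ⟶ V i`. -/
noncomputable def pr (X : ZDCategory k) (n : ℤ) : ∀ i : Bool, (deg k n).obj X ⟶ (vec k i).obj X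
  | false => ModuleCat.ofHom (LinearMap.fst k _ _ ∘ₗ (colimit.ι X.snd.obj n ≫ (locIso X).hom).hom)
  | true => ModuleCat.ofHom (LinearMap.snd k _ _ ∘ₗ (colimit.ι X.snd.obj n ≫ (locIso X).hom).hom)

lemma mulPow_pr (X : ZDCategory k) {n m : ℤ} (h : n ≤ m) (i : Bool) :
    (mulPow k h).app X ≫ pr X m i = pr X n i := by
  have hw := colimit.w X.snd.obj (homOfLE h)
  cases i
  all_goals
    dsimp only [pr, mulPow]
    rw [← hw]
    rfl

lemma pr_naturality {X Y : ZDCategory k} (f : X ⟶ Y) (n : ℤ) (i : Bool) :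
    (deg k n).map f ≫ pr Y n i = pr X n i ≫ (vec k i).map f := by
  have h : f.snd.hom.app n ≫ colimit.ι Y.snd.obj n ≫ (locIso Y).hom =
      (colimit.ι X.snd.obj n ≫ (locIso X).hom) ≫
        ModuleCat.ofHom (f.fst.1.hom.hom.prodMap f.fst.2.hom.hom) := by
    rw [Category.assoc, ← (comp_locIso_hom_iff f.snd f.fst).2 f.w, ι_colimMap_assoc]
  cases i
  · ext x
    exact congrArg Prod.fst (ConcreteCategory.congr_hom h x)
  · ext x
    exact congrArg Prod.snd (ConcreteCategory.congr_hom h x)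

/-- The morphism with given components on the graded modules and on the vector spaces. -/
noncomputable def mkHom {X Y : ZDCategory k} (f : X.snd.obj ⟶ Y.snd.obj)
    (g : ∀ i : Bool, (vec k i).obj X ⟶ (vec k i).obj Y)
    (h : ∀ n i, (f.app n : (deg k n).obj X ⟶ (deg k n).obj Y) ≫ pr Y n i = pr X n i ≫ g i) :
    X ⟶ Y where
  fst := (ObjectProperty.homMk (g false), ObjectProperty.homMk (g true))
  snd := ObjectProperty.homMk f
  w := by
    refine (comp_locIso_hom_iff _ _).1 (colimit.hom_ext fun n => ?_)
    refine (ι_colimMap_assoc _ _ _).trans (ModuleCat.hom_ext (LinearMap.ext fun x => ?_))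
    exact Prod.ext (ConcreteCategory.congr_hom (h n false) x)
      (ConcreteCategory.congr_hom (h n true) x)

instance (F : ℤ ⥤ ModuleCat.{u} k) : PreservesColimit F (forget (ModuleCat.{u} k)) :=
  haveI : PreservesFilteredColimitsOfSize.{0, 0} (forget (ModuleCat.{u} k)) :=
    preservesFilteredColimitsOfSize_shrink.{0, u, 0, u} _
  inferInstance

lemma exists_pr_eq (X : ZDCategory k) (v : ∀ i, (vec k i).obj X) :
    ∃ (n : ℤ) (z : (deg k n).obj X), ∀ i, pr X n i z = v i := by
  obtain ⟨n, z, hz⟩ := Concrete.colimit_exists_rep X.snd.obj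
    ((locIso X).inv (show X.fst.1 × X.fst.2 from (v false, v true)))
  have key : (locIso X).hom (colimit.ι X.snd.obj n z) =
      (show X.fst.1 × X.fst.2 from (v false, v true)) :=
    (congrArg (locIso X).hom hz).trans (ConcreteCategory.congr_hom (locIso X).inv_hom_id _)
  exact ⟨n, z, Bool.rec (congrArg Prod.fst key) (congrArg Prod.snd key)⟩

lemma exists_mulPow_eq_zero (X : ZDCategory k) {n : ℤ} (z : (deg k n).obj X)
    (h : ∀ i, pr X n i z = 0) : ∃ (m : ℤ) (h : n ≤ m), (mulPow k h).app X z = 0 := by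
  have key : (locIso X).hom (colimit.ι X.snd.obj n z) = 0 := Prod.ext (h false) (h true)
  have hz : colimit.ι X.snd.obj n z = 0 :=
    (ConcreteCategory.bijective_of_isIso (locIso X).hom).1
      (key.trans (map_zero (locIso X).hom.hom).symm)
  obtain ⟨m, f, hm⟩ := Concrete.colimit_rep_eq_zero k X.snd.obj n z hz
  exact ⟨m, leOfHom f, hm⟩

lemma vec_ext {X : ZDCategory k} {i : Bool} {M : ModuleCat.{u} k} {f g : (vec k i).obj X ⟶ M}
    (h : ∀ n, pr X n i ≫ f = pr X n i ≫ g) : f = g := by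
  ext a
  obtain ⟨n, z, rfl⟩ : ∃ n z, pr X n i z = a := by
    obtain ⟨n, z, hz⟩ := exists_pr_eq X (Pi.single i a)
    exact ⟨n, z, by rw [hz i, Pi.single_eq_same]⟩
  exact ConcreteCategory.congr_hom (h n) z

lemma jointlyFaithful_deg : JointlyFaithful (deg k) where
  map_injective {X Y f g} h := by
    have hvec (i : Bool) : (vec k i).map f = (vec k i).map g := vec_ext fun n => by
      rw [← pr_naturality, ← pr_naturality, h]
    refine CategoricalPullback.hom_ext (Prod.ext ?_ ?_) ?_
    · exact (ModuleCat.isFG k).ι.map_injective (hvec false)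
    · exact (ModuleCat.isFG k).ι.map_injective (hvec true)
    · exact (isFG k).ι.map_injective (NatTrans.ext (funext h))

lemma hom_ext {X Y : ZDCategory k} {f g : X ⟶ Y}
    (h : ∀ n (z : (deg k n).obj X), (deg k n).map f z = (deg k n).map g z) : f = g :=
  jointlyFaithful_deg.map_injective fun n => ModuleCat.hom_ext (LinearMap.ext (h n))

lemma epi_of_surjective_deg {X Y : ZDCategory k} (f : X ⟶ Y)
    (h : ∀ n, Function.Surjective ((deg k n).map f)) : Epi f :=
  have (n : ℤ) : Epi ((deg k n).map f) := (ModuleCat.epi_iff_surjective _).2 (h n)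
  jointlyFaithful_deg.jointlyReflectEpimorphisms.epi f

instance finite_deg (X : ZDCategory k) (n : ℤ) : Module.Finite k ((deg k n).obj X) :=
  finite_obj X.snd.property n

lemma exists_subsingleton_deg (X : ZDCategory k) :
    ∃ a : ℤ, ∀ n < a, Subsingleton ((deg k n).obj X) :=
  exists_forall_lt_subsingleton X.snd.property

lemma exists_bijective_mulPow (X : ZDCategory k) :
    ∃ b : ℤ, ∀ n m (h : n ≤ m), b ≤ n → Function.Bijective ((mulPow k h).app X) :=
  exists_bijective_map X.snd.property

end Components

/-! ### Interval modules -/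

section Interval

/-- The vector space that is `k` if `p` holds and `0` otherwise. It is cut out of `k` so that it
needs no decision on `p` and lives in the universe of `k`. -/
def cell (k : Type u) [Field k] (p : Prop) : Submodule k k where
  carrier := {c : k | ¬p → c = 0}
  add_mem' ha hb h := by rw [ha h, hb h, add_zero]
  zero_mem' _ := rfl
  smul_mem' c a ha h := by rw [ha h, smul_zero]

lemma subsingleton_cell (k : Type u) [Field k] {p : Prop} (h : ¬p) : Subsingleton (cell k p) :=
  ⟨fun a b => Subtype.ext ((a.2 h).trans (b.2 h).symm)⟩

open scoped Classical in
/-- The graded module with a copy of `k` in each degree in `s`, on which `x` acts as the identity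
whenever the target degree is in `s`. -/
noncomputable def intervalModule (k : Type u) [Field k] (s : Set ℤ) [hs : s.OrdConnected] :
    GrMod k where
  obj l := ModuleCat.of k (cell k (l ∈ s))
  map {l l'} _ := ModuleCat.ofHom
    { toFun c := ⟨if l' ∈ s then c.1 else 0, fun h => if_neg h⟩
      map_add' a b := Subtype.ext (by dsimp; split_ifs <;> simp)
      map_smul' a b := Subtype.ext (by dsimp; split_ifs <;> simp) }
  map_id l := by
    ext c
    by_cases h : l ∈ s
    · exact if_pos h
    · exact (if_neg h).trans (c.2 h).symm
  map_comp {l l' l''} f g := by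
    ext c
    change (if l'' ∈ s then c.1 else 0) = if l'' ∈ s then (if l' ∈ s then c.1 else 0) else 0
    split_ifs with h h'
    · rfl
    · exact c.2 fun h1 => h' (hs.out h1 h ⟨leOfHom f, leOfHom g⟩)
    · rfl

variable {k : Type u} [Field k]

/-- The linear form `v` identifies its source with `k` if `p` holds, and with `0` otherwise. -/
structure IsCell {V : Type*} [AddCommGroup V] [Module k V] (v : V →ₗ[k] k) (p : Prop) : Prop where
  injective : Function.Injective v
  surjective (h : p) : Function.Surjective v
  eq_zero (h : ¬p) : v = 0

namespace IsCell

variable {V : Type*} [AddCommGroup V] [Module k V] {v : V →ₗ[k] k} {p : Prop}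

lemma apply_eq_zero (hv : IsCell v p) (h : ¬p) (z : V) : v z = 0 := by
  rw [hv.eq_zero h, LinearMap.zero_apply]

lemma subsingleton (hv : IsCell v p) (h : ¬p) : Subsingleton V :=
  ⟨fun a b => hv.injective ((hv.apply_eq_zero h a).trans (hv.apply_eq_zero h b).symm)⟩

lemma surjective_of_exists_ne_zero (hv : IsCell v p) {W : Type*} [AddCommGroup W] [Module k W]
    (f : W →ₗ[k] V) (h : p → ∃ w, v (f w) ≠ 0) : Function.Surjective f := by
  intro z
  by_cases hp : p
  · obtain ⟨w, hw⟩ := h hp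
    exact ⟨(v z / v (f w)) • w, hv.injective (by
      rw [map_smul, map_smul, smul_eq_mul, div_mul_cancel₀ _ hw])⟩
  · have := hv.subsingleton hp
    exact ⟨0, Subsingleton.elim _ _⟩

end IsCell

variable {s : Set ℤ} [s.OrdConnected]

/-- The scalar given by a homogeneous element of an interval module. -/
noncomputable def val {l : ℤ} : (intervalModule k s).obj l →ₗ[k] k := Submodule.subtype _

lemma isCell_val (l : ℤ) : IsCell (val (k := k) (s := s) (l := l)) (l ∈ s) where
  injective := Subtype.val_injective
  surjective h c := ⟨⟨c, fun h' => absurd h h'⟩, rfl⟩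
  eq_zero h := LinearMap.ext fun z => z.2 h

lemma val_map {l l' : ℤ} (f : l ⟶ l') (h : l' ∈ s) (z : (intervalModule k s).obj l) :
    val ((intervalModule k s).map f z) = val z := if_pos h

/-- The morphism to an interval module given by linear forms in all degrees. -/
noncomputable def toInterval (M : GrMod k) (φ : ∀ l, M.obj l →ₗ[k] k) (h₀ : ∀ l ∉ s, φ l = 0)
    (h₁ : ∀ l l' (f : l ⟶ l') (z : M.obj l), l' ∈ s → φ l' (M.map f z) = φ l z) :
    M ⟶ intervalModule k s where
  app l := ModuleCat.ofHom ((φ l).codRestrict _ fun z h => by rw [h₀ l h]; rfl)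
  naturality l l' f := by
    ext z
    refine (isCell_val l').injective ?_
    change φ l' (M.map f z) = val ((intervalModule k s).map f _)
    by_cases h : l' ∈ s
    · rw [val_map f h, h₁ _ _ _ _ h]; rfl
    · have := (isCell_val (k := k) l').subsingleton h
      rw [h₀ _ h, Subsingleton.elim ((intervalModule k s).map f _) 0, map_zero]; rfl

lemma isFG_intervalModule (hs : BddBelow s) : isFG k (intervalModule k s) := by
  rw [isFG_iff]
  have hout {l : ℤ} (hl : l ∉ s) (S) : spanDegree (intervalModule k s) S l = ⊤ :=
    have := (isCell_val (k := k) l).subsingleton hl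
    Submodule.eq_top_iff'.2 fun w => Subsingleton.elim 0 w ▸ zero_mem _
  rcases s.eq_empty_or_nonempty with rfl | hne
  · exact ⟨∅, Set.finite_empty, fun l => hout (Set.notMem_empty l) _⟩
  obtain ⟨n, hn, hmin⟩ := Int.exists_least_of_bdd hs hne
  obtain ⟨z, hz⟩ := (isCell_val (k := k) n).surjective hn 1
  refine ⟨{⟨n, z⟩}, Set.finite_singleton _, fun l => ?_⟩
  by_cases hl : l ∈ s
  · refine Submodule.eq_top_iff'.2 fun w => ?_
    have hw : w = val w • (intervalModule k s).map (homOfLE (hmin l hl)) z :=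
      (isCell_val l).injective (by rw [map_smul, val_map _ hl, hz, smul_eq_mul, mul_one])
    rw [hw]
    exact Submodule.smul_mem _ _ (Submodule.subset_span ⟨_, rfl, hmin l hl, rfl⟩)
  · exact hout hl _

end Interval

section Construction

variable {k : Type u} [Field k]

lemma isIso_desc_of_bijective (M : GrMod k) (c : Cocone M)
    (h : ∃ n₀ : ℤ, ∀ n, n₀ ≤ n → Function.Bijective (c.ι.app n)) : IsIso (colimit.desc M c) := by
  obtain ⟨n₀, h⟩ := h
  rw [ConcreteCategory.isIso_iff_bijective]
  have hι (n : ℤ) (z : M.obj n) : colimit.desc M c (colimit.ι M n z) = c.ι.app n z :=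
    ConcreteCategory.congr_hom (colimit.ι_desc c n) z
  have exists_rep (a : (colimit M : ModuleCat.{u} k)) :
      ∃ n, n₀ ≤ n ∧ ∃ z, colimit.ι M n z = a := by
    obtain ⟨n, z, rfl⟩ := Concrete.colimit_exists_rep M a
    exact ⟨max n n₀, le_max_right n n₀, _,
      ConcreteCategory.congr_hom (colimit.w M (homOfLE (le_max_left n n₀))) z⟩
  constructor
  · refine (injective_iff_map_eq_zero (colimit.desc M c).hom).2 fun a ha => ?_
    obtain ⟨n, hn, z, rfl⟩ := exists_rep a
    have hz : z = 0 := (h n hn).1 (((hι n z).symm.trans ha).trans (map_zero _).symm)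
    rw [hz]
    exact map_zero (colimit.ι M n).hom
  · intro y
    obtain ⟨z, rfl⟩ := (h n₀ le_rfl).2 y
    exact ⟨_, hι _ z⟩

variable (M : GrMod k) (hM : isFG k M) (V : Bool → Vec k) (p : ∀ n i, M.obj n →ₗ[k] V i)
  (hp : ∀ n m (f : n ⟶ m) i z, p m i (M.map f z) = p n i z)
  (hiso : ∃ n₀ : ℤ, ∀ n, n₀ ≤ n → Function.Bijective ((p n false).prod (p n true)))

/-- The cocone on a graded module given by maps to two vector spaces. -/
noncomputable def vecCocone : Cocone M where
  pt := ModuleCat.of k (V false × V true)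
  ι := { app n := ModuleCat.ofHom ((p n false).prod (p n true))
         naturality n m f := ModuleCat.hom_ext <| LinearMap.ext fun z =>
          Prod.ext (hp n m f false z) (hp n m f true z) }

/-- The degree zero part of the localization of `M`, identified with `V₀ ⊕ V₁`. -/
noncomputable def vecColimitIso :
    (colimit M : ModuleCat.{u} k) ≅ (vecCocone M V p hp).pt :=
  haveI := isIso_desc_of_bijective M (vecCocone M V p hp) hiso
  asIso (colimit.desc M (vecCocone M V p hp))

/-- The object given by a graded module and two vector spaces, where the identification of the
degree zero part of the localization is induced by maps that are bijective in large degrees. -/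
noncomputable def mkObj : ZDCategory k where
  fst := (V false, V true)
  snd := ⟨M, hM⟩
  iso := ((ModuleCat.isFG k).fullyFaithfulι.preimageIso
    (X := (locDegreeZero k).obj ⟨M, hM⟩) (Y := (sumFunctor k).obj (V false, V true))
    (vecColimitIso M V p hp hiso)).symm

/-- The identification of the vector spaces of `mkObj`. -/
noncomputable def mkObjVecIso : ∀ i, (vec k i).obj (mkObj M hM V p hp hiso) ≅ (V i).obj
  | false => Iso.refl _
  | true => Iso.refl _

lemma mkObjVecIso_pr (n : ℤ) (i : Bool) (z : M.obj n) :
    (mkObjVecIso M hM V p hp hiso i).hom (pr (mkObj M hM V p hp hiso) n i z) = p n i z := by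
  have h := ConcreteCategory.congr_hom (colimit.ι_desc (vecCocone M V p hp) n) z
  cases i
  · exact congrArg Prod.fst h
  · exact congrArg Prod.snd h

end Construction

/-! ### The free and the torsion objects -/

section Objects

variable {k : Type u} [Field k]

/-- The projections that define `free k n j`: the identity of `k` onto the summand `j` and zero
onto the other one. -/
noncomputable def freeProj (n : ℤ) (j : Bool) (l : ℤ) (i : Bool) :
    (intervalModule k (Set.Ici n)).obj l →ₗ[k] cell k (i = j) :=
  LinearMap.codRestrict _ (if i = j then val else 0) fun z h => by rw [if_neg h]; rfl

lemma coe_freeProj (n : ℤ) (j : Bool) (l : ℤ) (i : Bool)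
    (z : (intervalModule k (Set.Ici n)).obj l) :
    (freeProj n j l i z).1 = if i = j then val z else 0 := by
  simp only [freeProj]
  split_ifs <;> rfl

lemma freeProj_map (n : ℤ) (j : Bool) (l l' : ℤ) (f : l ⟶ l') (i : Bool)
    (z : (intervalModule k (Set.Ici n)).obj l) :
    freeProj n j l' i ((intervalModule k (Set.Ici n)).map f z) = freeProj n j l i z := by
  refine Subtype.ext ?_
  rw [coe_freeProj, coe_freeProj]
  by_cases hb : l' ∈ Set.Ici n
  · rw [val_map f hb z]
  · rw [(isCell_val l').apply_eq_zero hb,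
      (isCell_val l).apply_eq_zero fun ha : l ∈ Set.Ici n => hb (le_trans ha (leOfHom f))]

lemma bijective_freeProj (n : ℤ) (j : Bool) (l : ℤ) (hl : n ≤ l) :
    Function.Bijective ((freeProj (k := k) n j l false).prod (freeProj n j l true)) := by
  have hval {z z'} (h : freeProj (k := k) n j l j z = freeProj n j l j z') : z = z' := by
    have := congrArg Subtype.val h
    rw [coe_freeProj, coe_freeProj, if_pos rfl, if_pos rfl] at this
    exact (isCell_val l).injective this
  refine ⟨fun z z' h => hval ?_, fun ⟨a, b⟩ => ?_⟩
  · cases j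
    · exact congrArg Prod.fst h
    · exact congrArg Prod.snd h
  · obtain ⟨z, hz⟩ := (isCell_val (s := Set.Ici n) l).surjective hl
      (if false = j then a.1 else b.1)
    refine ⟨z, Prod.ext (Subtype.ext ?_) (Subtype.ext ?_)⟩
    · refine (coe_freeProj _ _ _ _ _).trans ?_
      split_ifs with h
      · rw [hz, if_pos h]
      · exact (a.2 h).symm
    · refine (coe_freeProj _ _ _ _ _).trans ?_
      split_ifs with h
      · rw [hz, if_neg (by simp [← h])]
      · exact (b.2 h).symm

variable (k) in
/-- The object with graded module `k[x](-n)`, with `V j = k` and with the other vector space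
zero. -/
noncomputable def free (n : ℤ) (j : Bool) : ZDCategory k :=
  mkObj (intervalModule k (Set.Ici n)) (isFG_intervalModule bddBelow_Ici)
    (fun i => FGModuleCat.of k (cell k (i = j))) (freeProj n j)
    (freeProj_map n j) ⟨n, bijective_freeProj n j⟩

lemma bijective_zero_prod_zero (a b l : ℤ) (hl : b ≤ l) :
    Function.Bijective (LinearMap.prod
      (0 : (intervalModule k (Set.Ico a b)).obj l →ₗ[k] cell k False)
      (0 : (intervalModule k (Set.Ico a b)).obj l →ₗ[k] cell k False)) := by
  have := subsingleton_cell k id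
  have := (isCell_val (k := k) (s := Set.Ico a b) l).subsingleton fun h => hl.not_gt h.2
  exact ⟨Function.injective_of_subsingleton _, fun _ => ⟨0, Subsingleton.elim _ _⟩⟩

variable (k) in
/-- The torsion object with a copy of `k` in each degree in `[a, b)`. -/
noncomputable def torsion (a b : ℤ) : ZDCategory k :=
  mkObj (intervalModule k (Set.Ico a b)) (isFG_intervalModule bddBelow_Ico)
    (fun _ => FGModuleCat.of k (cell k False)) (fun _ _ => 0) (fun _ _ _ _ _ => rfl)
    ⟨b, bijective_zero_prod_zero a b⟩

/-- The scalar given by a homogeneous element of `free k n j`. -/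
noncomputable def freeVal (n : ℤ) (j : Bool) (l : ℤ) : (deg k l).obj (free k n j) →ₗ[k] k :=
  val (s := Set.Ici n)

/-- The scalar given by a homogeneous element of `torsion k a b`. -/
noncomputable def torsionVal (a b l : ℤ) : (deg k l).obj (torsion k a b) →ₗ[k] k :=
  val (s := Set.Ico a b)

/-- The identification of the vector spaces of `free k n j`. -/
noncomputable def freeVecIso (n : ℤ) (j i : Bool) :
    (vec k i).obj (free k n j) ≅ ModuleCat.of k (cell k (i = j)) :=
  mkObjVecIso (intervalModule k (Set.Ici n)) (isFG_intervalModule bddBelow_Ici)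
    (fun i => FGModuleCat.of k (cell k (i = j))) (freeProj n j)
    (freeProj_map n j) ⟨n, bijective_freeProj n j⟩ i

/-- The scalar given by an element of the nonzero vector space of `free k n j`. -/
noncomputable def freeVec (n : ℤ) (j : Bool) : (vec k j).obj (free k n j) →ₗ[k] k :=
  (cell k (j = j)).subtype ∘ₗ (freeVecIso n j j).hom.hom

lemma freeVec_pr (n : ℤ) (j : Bool) (l : ℤ) (z : (deg k l).obj (free k n j)) :
    freeVec n j (pr _ l j z) = freeVal n j l z := by
  refine (congrArg Subtype.val (mkObjVecIso_pr (intervalModule k (Set.Ici n)) _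
    (fun i => FGModuleCat.of k (cell k (i = j))) (freeProj n j) _ _ l j z)).trans ?_
  exact (coe_freeProj _ _ _ _ _).trans (if_pos rfl)

lemma freeVec_injective (n : ℤ) (j : Bool) : Function.Injective (freeVec (k := k) n j) :=
  Subtype.val_injective.comp (ConcreteCategory.bijective_of_isIso (freeVecIso n j j).hom).1

lemma isZero_vec_free (n : ℤ) {i j : Bool} (h : i ≠ j) :
    IsZero ((vec k i).obj (free k n j)) :=
  have := subsingleton_cell k h
  (ModuleCat.isZero_of_subsingleton (ModuleCat.of k (cell k (i = j)))).of_iso (freeVecIso n j i)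

lemma isZero_vec_torsion (a b : ℤ) (i : Bool) : IsZero ((vec k i).obj (torsion k a b)) :=
  have := subsingleton_cell k id
  (ModuleCat.isZero_of_subsingleton (ModuleCat.of k (cell k False))).of_iso
    (mkObjVecIso _ _ _ _ _ _ i)

lemma isCell_freeVal (n : ℤ) (j : Bool) (l : ℤ) : IsCell (freeVal (k := k) n j l) (n ≤ l) :=
  isCell_val l

lemma isCell_torsionVal (a b l : ℤ) : IsCell (torsionVal (k := k) a b l) (a ≤ l ∧ l < b) :=
  isCell_val l

lemma freeVal_mulPow (n : ℤ) (j : Bool) {l l' : ℤ} (h : l ≤ l')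
    (z : (deg k l).obj (free k n j)) :
    freeVal n j l' ((mulPow k h).app _ z) = freeVal n j l z := by
  rw [← freeVec_pr, ← freeVec_pr, ← mulPow_pr _ h]
  rfl

lemma torsionVal_mulPow {a b l l' : ℤ} (h : l ≤ l') (h' : l' < b)
    (z : (deg k l).obj (torsion k a b)) :
    torsionVal a b l' ((mulPow k h).app _ z) = torsionVal a b l z := by
  by_cases ha : a ≤ l
  · exact val_map (s := Set.Ico a b) (homOfLE h) ⟨ha.trans h, h'⟩ z
  · have := (isCell_torsionVal (k := k) a b l).subsingleton fun h => ha h.1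
    rw [Subsingleton.elim z 0, map_zero, map_zero, map_zero]

section Hom

variable {Y : ZDCategory k}

/-- The map to the vector spaces of `free k a j` given by a linear form on `V j`. -/
noncomputable def toFreeVec (a : ℤ) (j : Bool) (φ : (vec k j).obj Y →ₗ[k] k) (i : Bool) :
    (vec k i).obj Y ⟶ (vec k i).obj (free k a j) :=
  ModuleCat.ofHom ((Pi.single j φ : ∀ i, (vec k i).obj Y →ₗ[k] k) i |>.codRestrict
    (cell k (i = j)) fun z h => by rw [Pi.single_eq_of_ne h]; rfl) ≫ (freeVecIso a j i).inv

lemma freeVec_toFreeVec (a : ℤ) (j : Bool) (φ : (vec k j).obj Y →ₗ[k] k)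
    (y : (vec k j).obj Y) : freeVec a j (toFreeVec a j φ j y) = φ y := by
  refine (congrArg Subtype.val
    (ConcreteCategory.congr_hom (freeVecIso a j j).inv_hom_id _)).trans ?_
  exact LinearMap.congr_fun (Pi.single_eq_same (M := fun i => (vec k i).obj Y →ₗ[k] k) j φ) y

/-- The morphism to `free k a j` given by a linear form on `V j`. -/
noncomputable def toFree (a : ℤ) (j : Bool) (φ : (vec k j).obj Y →ₗ[k] k)
    (h : ∀ l < a, ∀ z, φ (pr Y l j z) = 0) : Y ⟶ free k a j :=
  mkHom (toInterval Y.snd.obj (fun l => φ ∘ₗ (pr Y l j).hom)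
      (fun l hl => LinearMap.ext fun z => h l (not_le.1 hl) z)
      (fun l l' f z _ => congrArg φ (ConcreteCategory.congr_hom (mulPow_pr Y (leOfHom f) j) z)))
    (toFreeVec a j φ)
    (fun n i => by
      rcases eq_or_ne i j with rfl | h
      · refine ModuleCat.hom_ext (LinearMap.ext fun z => freeVec_injective _ _ ?_)
        exact (freeVec_pr _ _ _ _).trans (freeVec_toFreeVec _ _ _ _).symm
      · exact (isZero_vec_free a h).eq_of_tgt _ _)

lemma freeVal_toFree (a : ℤ) (j : Bool) (φ : (vec k j).obj Y →ₗ[k] k)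
    (h : ∀ l < a, ∀ z, φ (pr Y l j z) = 0) (l : ℤ) (z : (deg k l).obj Y) :
    freeVal a j l ((deg k l).map (toFree a j φ h) z) = φ (pr Y l j z) := rfl

/-- The morphism to `torsion k a b` given by a linear form in the highest degree. -/
noncomputable def toTorsion (a b : ℤ) (φ : (deg k (b - 1)).obj Y →ₗ[k] k)
    (h : ∀ l < a, ∀ (hl : l ≤ b - 1) z, φ ((mulPow k hl).app Y z) = 0) : Y ⟶ torsion k a b :=
  mkHom (toInterval Y.snd.obj
      (fun l => if hl : l ≤ b - 1 then φ ∘ₗ ((mulPow k hl).app Y).hom else 0)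
      (fun l hl => by
        split_ifs with hl'
        · exact LinearMap.ext fun z => h l (lt_of_not_ge fun ha => hl ⟨ha, by lia⟩) hl' z
        · rfl)
      (fun l l' f z hl => by
        rw [dif_pos (Int.le_sub_one_of_lt hl.2),
          dif_pos ((leOfHom f).trans (Int.le_sub_one_of_lt hl.2))]
        exact congrArg φ (mulPow_mulPow Y (leOfHom f) _ z)))
    (fun _ => 0) (fun _ i => (isZero_vec_torsion a b i).eq_of_tgt _ _)

lemma torsionVal_toTorsion (a b : ℤ) (φ : (deg k (b - 1)).obj Y →ₗ[k] k)
    (h : ∀ l < a, ∀ (hl : l ≤ b - 1) z, φ ((mulPow k hl).app Y z) = 0) {l : ℤ} (hl : l ≤ b - 1)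
    (z : (deg k l).obj Y) :
    torsionVal a b l ((deg k l).map (toTorsion a b φ h) z) = φ ((mulPow k hl).app Y z) :=
  LinearMap.congr_fun (dif_pos hl) z

end Hom
end Objects

/-! ### Morphisms between the free and the torsion objects -/

section Maps

variable {k : Type u} [Field k]

/-- The inclusions `k[x](-m) ⊆ k[x](-a)`. -/
noncomputable def freeIncl (j : Bool) {a m : ℤ} (h : a ≤ m) : free k m j ⟶ free k a j :=
  toFree a j (freeVec m j) fun l hl z => by
    rw [freeVec_pr, (isCell_freeVal m j l).apply_eq_zero (hl.trans_le h).not_ge]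

lemma freeVal_freeIncl (j : Bool) {a m : ℤ} (h : a ≤ m) (l : ℤ) (z : (deg k l).obj (free k m j)) :
    freeVal a j l ((deg k l).map (freeIncl j h) z) = freeVal m j l z :=
  (freeVal_toFree _ _ _ _ _ _).trans (freeVec_pr _ _ _ _)

/-- The map from a free to a torsion object that is the identity of `k` in the common degrees. -/
noncomputable def freeToTorsion (j : Bool) {a n : ℤ} (b : ℤ) (h : a ≤ n) :
    free k n j ⟶ torsion k a b :=
  toTorsion a b (freeVal n j (b - 1)) fun l hl _ z => by
    rw [freeVal_mulPow, (isCell_freeVal n j l).apply_eq_zero (hl.trans_le h).not_ge]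

lemma torsionVal_freeToTorsion (j : Bool) {a b n : ℤ} (h : a ≤ n) {l : ℤ} (hl : l < b)
    (z : (deg k l).obj (free k n j)) :
    torsionVal a b l ((deg k l).map (freeToTorsion j b h) z) = freeVal n j l z :=
  (torsionVal_toTorsion _ _ _ _ (Int.le_sub_one_of_lt hl) _).trans (freeVal_mulPow _ _ _ _)

/-- The map between torsion objects that is the identity of `k` in the common degrees. -/
noncomputable def torsionMap {a a' b c : ℤ} (h : a' ≤ a) (h' : b ≤ c) :
    torsion k a c ⟶ torsion k a' b :=
  toTorsion a' b (torsionVal a c (b - 1)) fun l hl hl' z => by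
    rw [torsionVal_mulPow hl' (by lia),
      (isCell_torsionVal a c l).apply_eq_zero fun hl'' => (hl.trans_le h).not_ge hl''.1]

lemma torsionVal_torsionMap {a a' b c : ℤ} (h : a' ≤ a) (h' : b ≤ c) {l : ℤ} (hl : l < b)
    (z : (deg k l).obj (torsion k a c)) :
    torsionVal a' b l ((deg k l).map (torsionMap h h') z) = torsionVal a c l z :=
  (torsionVal_toTorsion _ _ _ _ (Int.le_sub_one_of_lt hl) _).trans
    (torsionVal_mulPow _ (by lia) _)

lemma shortExact_of_isCell (S : ShortComplex (ModuleCat.{u} k)) {v₁ : S.X₁ →ₗ[k] k}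
    {v₂ : S.X₂ →ₗ[k] k} {v₃ : S.X₃ →ₗ[k] k} {p₁ p₂ p₃ : Prop} (h₁ : IsCell v₁ p₁)
    (h₂ : IsCell v₂ p₂) (h₃ : IsCell v₃ p₃) (hp : p₂ ↔ p₁ ∨ p₃)
    (hf : p₁ → ∀ z, v₂ (S.f z) = v₁ z) (hg : p₃ → ∀ z, v₃ (S.g z) = v₂ z) : S.ShortExact where
  exact := by
    rw [ShortComplex.moduleCat_exact_iff]
    intro z hz
    by_cases hp₁ : p₁
    · obtain ⟨y, hy⟩ := h₁.surjective hp₁ (v₂ z)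
      exact ⟨y, h₂.injective ((hf hp₁ y).trans hy)⟩
    · refine ⟨0, h₂.injective ?_⟩
      rw [map_zero, map_zero]
      by_cases hp₃ : p₃
      · rw [← hg hp₃, hz, map_zero]
      · rw [h₂.apply_eq_zero (by tauto)]
  mono_f := by
    rw [ModuleCat.mono_iff_injective]
    intro y z h
    by_cases hp₁ : p₁
    · exact h₁.injective (by rw [← hf hp₁, ← hf hp₁, h])
    · exact (h₁.subsingleton hp₁).elim y z
  epi_g := by
    rw [ModuleCat.epi_iff_surjective]
    refine h₃.surjective_of_exists_ne_zero S.g.hom fun hp₃ => ?_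
    obtain ⟨z, hz⟩ := h₂.surjective (hp.2 (.inr hp₃)) 1
    exact ⟨z, by rw [hg hp₃, hz]; exact one_ne_zero⟩

variable (k) in
/-- The short exact sequence `0 ⟶ free k m j ⟶ free k a j ⟶ torsion k a m ⟶ 0`. -/
noncomputable abbrev freeSequence (j : Bool) {a m : ℤ} (h : a ≤ m) :
    ShortComplex (ZDCategory k) where
  f := freeIncl j h
  g := freeToTorsion j m le_rfl
  zero := hom_ext fun l z => by
    by_cases hl : l < m
    · have := (isCell_freeVal (k := k) m j l).subsingleton hl.not_ge
      rw [Subsingleton.elim z 0, map_zero, map_zero]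
    · exact ((isCell_torsionVal (k := k) a m l).subsingleton fun h => hl h.2).elim _ _

lemma freeSequence_shortExact (j : Bool) {a m : ℤ} (h : a ≤ m) :
    (freeSequence k j h).ShortExact :=
  shortExact_of_jointlyFaithful jointlyFaithful_deg _ fun l => shortExact_of_isCell _
    (isCell_freeVal m j l) (isCell_freeVal a j l) (isCell_torsionVal a m l) (by lia)
    (fun _ => freeVal_freeIncl j h l) (fun hl => torsionVal_freeToTorsion j le_rfl hl.2)

variable (k) in
/-- The short exact sequence `0 ⟶ torsion k b c ⟶ torsion k a c ⟶ torsion k a b ⟶ 0`. -/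
noncomputable abbrev torsionSequence {a b c : ℤ} (h : a ≤ b) (h' : b ≤ c) :
    ShortComplex (ZDCategory k) where
  f := torsionMap h (le_refl c)
  g := torsionMap (le_refl a) h'
  zero := hom_ext fun l z => by
    by_cases hl : l < b
    · have := (isCell_torsionVal (k := k) b c l).subsingleton fun h => hl.not_ge h.1
      rw [Subsingleton.elim z 0, map_zero, map_zero]
    · exact ((isCell_torsionVal (k := k) a b l).subsingleton fun h => hl h.2).elim _ _

lemma torsionSequence_shortExact {a b c : ℤ} (h : a ≤ b) (h' : b ≤ c) :
    (torsionSequence k h h').ShortExact :=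
  shortExact_of_jointlyFaithful jointlyFaithful_deg _ fun l => shortExact_of_isCell _
    (isCell_torsionVal b c l) (isCell_torsionVal a c l) (isCell_torsionVal a b l) (by lia)
    (fun hl => torsionVal_torsionMap h le_rfl hl.2)
    (fun hl => torsionVal_torsionMap le_rfl h' hl.2)

lemma freeIncl_comp (j : Bool) {a b c : ℤ} (h : a ≤ b) (h' : b ≤ c) :
    freeIncl (k := k) j h' ≫ freeIncl j h = freeIncl j (h.trans h') :=
  hom_ext fun l z => (isCell_freeVal a j l).injective <| by
    rw [deg_map_comp, freeVal_freeIncl, freeVal_freeIncl, freeVal_freeIncl]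

lemma freeIncl_freeToTorsion (j : Bool) {a b n : ℤ} (m : ℤ) (h : a ≤ b) (h' : b ≤ n) :
    freeIncl j h' ≫ freeToTorsion j m h = freeToTorsion (k := k) j m (h.trans h') := by
  refine hom_ext fun l z => ?_
  by_cases hl : l < m
  · refine (isCell_torsionVal a m l).injective ?_
    rw [deg_map_comp, torsionVal_freeToTorsion j h hl, torsionVal_freeToTorsion j _ hl,
      freeVal_freeIncl]
  · exact ((isCell_torsionVal (k := k) a m l).subsingleton fun h => hl h.2).elim _ _

variable (k) in
/-- The generator of `free k n j`. -/
noncomputable def gen (n : ℤ) (j : Bool) : (deg k n).obj (free k n j) :=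
  ((isCell_freeVal n j n).surjective le_rfl 1).choose

lemma freeVal_gen (n : ℤ) (j : Bool) : freeVal n j n (gen k n j) = 1 :=
  ((isCell_freeVal n j n).surjective le_rfl 1).choose_spec

lemma eq_smul_gen {n : ℤ} {j : Bool} {l : ℤ} (h : n ≤ l) (z : (deg k l).obj (free k n j)) :
    z = freeVal n j l z • (mulPow k h).app _ (gen k n j) :=
  (isCell_freeVal n j l).injective
    (by rw [map_smul, freeVal_mulPow, freeVal_gen, smul_eq_mul, mul_one])

lemma free_hom_ext {n : ℤ} {j : Bool} {Y : ZDCategory k} {f g : free k n j ⟶ Y}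
    (h : (deg k n).map f (gen k n j) = (deg k n).map g (gen k n j)) : f = g := by
  refine hom_ext fun l z => ?_
  by_cases hl : n ≤ l
  · rw [eq_smul_gen hl z, map_smul, map_smul, deg_map_mulPow, deg_map_mulPow, h]
  · have := (isCell_freeVal (k := k) n j l).subsingleton hl
    rw [Subsingleton.elim z 0, map_zero, map_zero]

lemma free_torsion_eq_zero {n a b : ℤ} {j : Bool} (h : ¬(a ≤ n ∧ n < b))
    (f : free k n j ⟶ torsion k a b) : f = 0 :=
  free_hom_ext (((isCell_torsionVal (k := k) a b n).subsingleton h).elim _ _)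

lemma free_torsion_eq_smul {n a b : ℤ} {j : Bool} (h : a ≤ n) (h' : n < b)
    (f : free k n j ⟶ torsion k a b) : ∃ c : k, f = c • freeToTorsion j b h :=
  ⟨torsionVal a b n ((deg k n).map f (gen k n j)),
    free_hom_ext ((isCell_torsionVal a b n).injective (by
      rw [deg_map_smul, map_smul, torsionVal_freeToTorsion j h h', freeVal_gen, smul_eq_mul,
        mul_one]))⟩

lemma free_free_eq_zero {n m : ℤ} {i j : Bool} (h : ¬(i = j ∧ m ≤ n))
    (f : free k n i ⟶ free k m j) : f = 0 := by
  refine free_hom_ext ((isCell_freeVal m j n).injective ?_)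
  by_cases hm : m ≤ n
  · have hij : j ≠ i := fun h' => h ⟨h'.symm, hm⟩
    have hpr := ConcreteCategory.congr_hom (pr_naturality f n j) (gen k n i)
    rw [(isZero_vec_free n hij).eq_of_src ((vec k j).map f) 0, comp_zero] at hpr
    rw [← freeVec_pr, deg_map_zero, map_zero]
    exact (congrArg (freeVec m j) hpr).trans (map_zero _)
  · rw [(isCell_freeVal m j n).apply_eq_zero hm, (isCell_freeVal m j n).apply_eq_zero hm]

lemma free_free_eq_smul {n m : ℤ} {j : Bool} (h : m ≤ n) (f : free k n j ⟶ free k m j) :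
    ∃ c : k, f = c • freeIncl j h :=
  ⟨freeVal m j n ((deg k n).map f (gen k n j)),
    free_hom_ext ((isCell_freeVal m j n).injective (by
      rw [deg_map_smul, map_smul, freeVal_freeIncl, freeVal_gen, smul_eq_mul, mul_one]))⟩

lemma freeIncl_ne_zero (j : Bool) {n m : ℤ} (h : m ≤ n) : freeIncl (k := k) j h ≠ 0 := by
  intro h0
  have := freeVal_freeIncl j h n (gen k n j)
  rw [h0, deg_map_zero, map_zero, freeVal_gen] at this
  exact zero_ne_one this

lemma freeToTorsion_ne_zero (j : Bool) {a n b : ℤ} (h : a ≤ n) (h' : n < b) :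
    freeToTorsion (k := k) j b h ≠ 0 := by
  intro h0
  have := torsionVal_freeToTorsion j h h' (gen k n j)
  rw [h0, deg_map_zero, map_zero, freeVal_gen] at this
  exact zero_ne_one this

lemma exists_comp_eq_freeIncl {Y : ZDCategory k} {m : ℤ} {j : Bool} (f : free k m j ⟶ Y)
    [Mono f] : ∃ (a : ℤ) (h : a ≤ m) (g : Y ⟶ free k a j), f ≫ g = freeIncl j h := by
  obtain ⟨a, ha⟩ := exists_subsingleton_deg Y
  let y := (vec k j).map f (pr (free k m j) m j (gen k m j))
  have hy : y ≠ 0 := by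
    have hinj := (ModuleCat.mono_iff_injective ((vec k j).map f)).1 inferInstance
    refine (map_ne_zero_iff ((vec k j).map f).hom hinj).2 fun h => zero_ne_one (α := k) ?_
    rw [← freeVal_gen m j, ← freeVec_pr, h, map_zero]
  obtain ⟨φ, hφ⟩ := Module.Projective.exists_dual_eq_one k hy
  refine ⟨min a m, min_le_right _ _, toFree _ j φ fun l hl z => ?_, ?_⟩
  · have := ha l (by lia)
    rw [Subsingleton.elim z 0, map_zero, map_zero]
  · refine free_hom_ext ((isCell_freeVal _ j m).injective ?_)
    rw [deg_map_comp, freeVal_freeIncl, freeVal_toFree, freeVal_gen]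
    exact (congrArg φ (ConcreteCategory.congr_hom (pr_naturality f m j) _)).trans hφ

lemma exists_comp_eq_torsionMap {Y : ZDCategory k} {a b : ℤ} (f : torsion k a b ⟶ Y) [Mono f] :
    ∃ (a' : ℤ) (h : a' ≤ a) (g : Y ⟶ torsion k a' b), f ≫ g = torsionMap h le_rfl := by
  by_cases hab : a < b
  swap
  · refine ⟨a, le_rfl, 0, hom_ext fun l z => ?_⟩
    exact ((isCell_torsionVal (k := k) a b l).subsingleton (by lia)).elim _ _
  obtain ⟨c, hc⟩ := exists_subsingleton_deg Y
  obtain ⟨t, ht⟩ := (isCell_torsionVal (k := k) a b (b - 1)).surjective (by lia) 1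
  have hft : (deg k (b - 1)).map f t ≠ 0 := by
    have hinj := (ModuleCat.mono_iff_injective ((deg k (b - 1)).map f)).1 inferInstance
    refine (map_ne_zero_iff ((deg k (b - 1)).map f).hom hinj).2 fun h => zero_ne_one (α := k) ?_
    rw [← ht, h, map_zero]
  obtain ⟨φ, hφ⟩ := Module.Projective.exists_dual_eq_one k hft
  refine ⟨min a c, min_le_left _ _, toTorsion _ b φ fun l hl h z => ?_, hom_ext fun l z => ?_⟩
  · have := hc l (by lia)
    rw [Subsingleton.elim z 0, map_zero, map_zero]
  by_cases hl : l < b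
  · have hz : (mulPow k (Int.le_sub_one_of_lt hl)).app _ z = torsionVal a b l z • t :=
      (isCell_torsionVal a b (b - 1)).injective (by
        rw [torsionVal_mulPow _ (by lia), map_smul, ht, smul_eq_mul, mul_one])
    refine (isCell_torsionVal _ b l).injective ?_
    rw [torsionVal_torsionMap _ _ hl, deg_map_comp,
      torsionVal_toTorsion _ _ _ _ (Int.le_sub_one_of_lt hl), ← deg_map_mulPow, hz, map_smul,
      map_smul, hφ, smul_eq_mul, mul_one]
  · exact ((isCell_torsionVal (k := k) (min a c) b l).subsingleton (by lia)).elim _ _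

end Maps

/-! ### Extensions between the free and the torsion objects -/

section ExtComputations

open CategoryTheory.Abelian

variable {k : Type u} [Field k]

lemma hom_torsion_eq_zero {X : ZDCategory k} {a b : ℤ}
    (hX : ∀ n < b, Subsingleton ((deg k n).obj X)) (f : X ⟶ torsion k a b) : f = 0 := by
  refine hom_ext fun l z => ?_
  by_cases hl : l < b
  · have := hX l hl
    rw [Subsingleton.elim z 0, map_zero, map_zero]
  · exact ((isCell_torsionVal (k := k) a b l).subsingleton fun h => hl h.2).elim _ _

variable [HasExt.{w'} (ZDCategory k)]

lemma exists_comp_freeIncl_eq_zero {X : ZDCategory k} {l : ℕ} {m : ℤ} {j : Bool}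
    (ξ : Ext X (free k m j) (l + 1)) : ∃ a₀ : ℤ, ∀ (a : ℤ) (h : a ≤ m), a ≤ a₀ →
      ξ.comp (Ext.mk₀ (freeIncl j h)) (add_zero _) = 0 := by
  obtain ⟨Y, f, _, hf⟩ := exists_mono_comp_mk₀_eq_zero ξ
  obtain ⟨a₀, h₀, g, hg⟩ := exists_comp_eq_freeIncl f
  refine ⟨a₀, fun a h ha => ?_⟩
  rw [← freeIncl_comp j ha h₀, ← hg, ← Ext.mk₀_comp_mk₀, ← Ext.mk₀_comp_mk₀,
    ← Ext.comp_assoc_of_third_deg_zero, ← Ext.comp_assoc_of_third_deg_zero, hf, Ext.zero_comp,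
    Ext.zero_comp]

lemma exists_comp_torsionMap_eq_zero {X : ZDCategory k} {l : ℕ} {a b : ℤ}
    (ξ : Ext X (torsion k a b) (l + 1)) : ∃ (a' : ℤ) (h : a' ≤ a),
      ξ.comp (Ext.mk₀ (torsionMap h (le_refl b))) (add_zero _) = 0 := by
  obtain ⟨Y, f, _, hf⟩ := exists_mono_comp_mk₀_eq_zero ξ
  obtain ⟨a', h, g, hg⟩ := exists_comp_eq_torsionMap f
  refine ⟨a', h, ?_⟩
  rw [← hg, ← Ext.mk₀_comp_mk₀, ← Ext.comp_assoc_of_third_deg_zero, hf, Ext.zero_comp]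

lemma ext_torsion_eq_zero {X : ZDCategory k} {a : ℤ}
    (hX : ∀ n < a, Subsingleton ((deg k n).obj X)) {b : ℤ} (hab : a ≤ b) (l : ℕ)
    (ξ : Ext X (torsion k a b) (l + 1)) : ξ = 0 := by
  induction l generalizing a b with
  | zero =>
    obtain ⟨a', h, hξ⟩ := exists_comp_torsionMap_eq_zero ξ
    obtain ⟨y, rfl⟩ := Ext.covariant_sequence_exact₁ X (torsionSequence_shortExact h hab) ξ hξ rfl
    obtain ⟨f, rfl⟩ := (Ext.mk₀_bijective _ _).2 y
    rw [hom_torsion_eq_zero hX f, Ext.mk₀_zero, Ext.zero_comp]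
  | succ l ih =>
    obtain ⟨a', h, hξ⟩ := exists_comp_torsionMap_eq_zero ξ
    obtain ⟨y, rfl⟩ := Ext.covariant_sequence_exact₁ X (torsionSequence_shortExact h hab) ξ hξ rfl
    rw [ih (fun n hn => hX n (hn.trans_le h)) h y, Ext.zero_comp]

lemma ext_free_eq_zero {X : ZDCategory k} {m : ℤ} {j : Bool} (l : ℕ)
    (ξ : Ext X (free k m j) (l + 2)) : ξ = 0 := by
  obtain ⟨c, hc⟩ := exists_subsingleton_deg X
  obtain ⟨a₀, h₀⟩ := exists_comp_freeIncl_eq_zero ξ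
  have h : min m (min c a₀) ≤ m := min_le_left _ _
  obtain ⟨y, rfl⟩ :=
    Ext.covariant_sequence_exact₁ X (freeSequence_shortExact j h) ξ (h₀ _ h (by lia)) rfl
  rw [ext_torsion_eq_zero (fun n hn => hc n (by lia)) h l y, Ext.zero_comp]

variable (k) in
/-- The class of the extension `0 ⟶ free k m j ⟶ free k a j ⟶ torsion k a m ⟶ 0`. -/
noncomputable def freeClass (j : Bool) {a m : ℤ} (h : a ≤ m) :
    Ext (torsion k a m) (free k m j) 1 :=
  (freeSequence_shortExact (k := k) j h).extClass

lemma mk₀_freeToTorsion_comp_freeClass (j : Bool) {a m : ℤ} (h : a ≤ m) :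
    (Ext.mk₀ (freeToTorsion j m (le_refl a))).comp (freeClass k j h) (zero_add 1) = 0 :=
  (freeSequence_shortExact (k := k) j h).comp_extClass

lemma exists_comp_freeToTorsion_eq {X : ZDCategory k} {a m : ℤ} {j : Bool} (h : a ≤ m)
    (f : X ⟶ torsion k a m) (hf : (Ext.mk₀ f).comp (freeClass k j h) (zero_add 1) = 0) :
    ∃ g : X ⟶ free k a j, g ≫ freeToTorsion j m le_rfl = f := by
  obtain ⟨y, hy⟩ := Ext.covariant_sequence_exact₃ X (freeSequence_shortExact (k := k) j h)
    (Ext.mk₀ f) (zero_add 1) hf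
  obtain ⟨g, rfl⟩ := (Ext.mk₀_bijective _ _).2 y
  exact ⟨g, (Ext.mk₀_bijective _ _).1 ((Ext.mk₀_comp_mk₀ _ _).symm.trans hy)⟩

lemma exists_mk₀_comp_freeClass_eq_of_comp_eq_zero {X : ZDCategory k} {a m : ℤ} {j : Bool}
    (h : a ≤ m) (ξ : Ext X (free k m j) 1)
    (hξ : ξ.comp (Ext.mk₀ (freeIncl j h)) (add_zero 1) = 0) :
    ∃ f : X ⟶ torsion k a m, (Ext.mk₀ f).comp (freeClass k j h) (zero_add 1) = ξ := by
  obtain ⟨y, rfl⟩ := Ext.covariant_sequence_exact₁ X (freeSequence_shortExact j h) ξ hξ rfl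
  obtain ⟨f, rfl⟩ := (Ext.mk₀_bijective _ _).2 y
  exact ⟨f, rfl⟩

lemma exists_mk₀_comp_freeClass_eq {X : ZDCategory k} {m : ℤ} {j : Bool}
    (ξ : Ext X (free k m j) 1) : ∃ a₀ : ℤ, ∀ (a : ℤ) (h : a ≤ m), a ≤ a₀ →
      ∃ f : X ⟶ torsion k a m, (Ext.mk₀ f).comp (freeClass k j h) (zero_add 1) = ξ := by
  obtain ⟨a₀, h₀⟩ := exists_comp_freeIncl_eq_zero ξ
  exact ⟨a₀, fun a h ha => exists_mk₀_comp_freeClass_eq_of_comp_eq_zero h ξ (h₀ a h ha)⟩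

variable (k) in
/-- The pullback of `freeClass k j h'` to `free k n i`. For `i ≠ j` and `n < m` it spans
`Ext¹(free k n i, free k m j)`. -/
noncomputable def freeExt {a n m : ℤ} (i j : Bool) (h : a ≤ n) (h' : a ≤ m) :
    Ext (free k n i) (free k m j) 1 :=
  (Ext.mk₀ (freeToTorsion i m h)).comp (freeClass k j h') (zero_add 1)

lemma mk₀_freeIncl_comp_freeExt {a n n' m : ℤ} (i j : Bool) (h : a ≤ n) (h' : a ≤ m)
    (h'' : n ≤ n') : (Ext.mk₀ (freeIncl i h'')).comp (freeExt k i j h h') (zero_add 1) =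
      freeExt k i j (h.trans h'') h' := by
  rw [freeExt, freeExt, Ext.mk₀_comp_mk₀_assoc, freeIncl_freeToTorsion]

lemma freeExt_self {a n m : ℤ} (j : Bool) (h : a ≤ n) (h' : a ≤ m) : freeExt k j j h h' = 0 := by
  rw [freeExt, ← freeIncl_freeToTorsion j m le_rfl h, ← Ext.mk₀_comp_mk₀,
    Ext.comp_assoc_of_second_deg_zero, mk₀_freeToTorsion_comp_freeClass,
    Ext.comp_zero]

lemma freeExt_ne_zero {a n m : ℤ} {i j : Bool} (hij : i ≠ j) (h : a ≤ n) (hnm : n < m) :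
    freeExt k i j h (h.trans hnm.le) ≠ 0 := by
  intro h₀
  obtain ⟨f, hf⟩ := exists_comp_freeToTorsion_eq (h.trans hnm.le) _ h₀
  rw [free_free_eq_zero (fun h => hij h.1) f, zero_comp] at hf
  exact freeToTorsion_ne_zero i h hnm hf.symm

lemma exists_eq_smul_freeExt {n m : ℤ} {i j : Bool} (hnm : n < m)
    (ξ : Ext (free k n i) (free k m j) 1) : ∃ a₀ : ℤ, ∀ (a : ℤ) (h : a ≤ n), a ≤ a₀ →
      ∃ c : k, ξ = c • freeExt k i j h (h.trans hnm.le) := by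
  obtain ⟨a₀, h₀⟩ := exists_mk₀_comp_freeClass_eq ξ
  refine ⟨a₀, fun a h ha => ?_⟩
  obtain ⟨f, rfl⟩ := h₀ _ (h.trans hnm.le) ha
  obtain ⟨c, rfl⟩ := free_torsion_eq_smul h hnm f
  exact ⟨c, by rw [Ext.mk₀_smul, Ext.smul_comp, freeExt]⟩

lemma ext_free_free_eq_zero {n m : ℤ} {i j : Bool} (h : ¬(i ≠ j ∧ n < m))
    (ξ : Ext (free k n i) (free k m j) 1) : ξ = 0 := by
  by_cases hnm : n < m
  · obtain rfl : i = j := not_not.1 fun hij => h ⟨hij, hnm⟩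
    obtain ⟨a₀, h₀⟩ := exists_eq_smul_freeExt hnm ξ
    obtain ⟨c, rfl⟩ := h₀ (min n a₀) (min_le_left _ _) (min_le_right _ _)
    rw [freeExt_self, smul_zero]
  · obtain ⟨a₀, h₀⟩ := exists_mk₀_comp_freeClass_eq ξ
    obtain ⟨f, rfl⟩ := h₀ (min m a₀) (min_le_left _ _) (min_le_right _ _)
    rw [free_torsion_eq_zero (fun h => hnm h.2) f, Ext.mk₀_zero, Ext.zero_comp]

lemma nontrivial_ext_free_free_iff {n m : ℤ} {i j : Bool} :
    Nontrivial (Ext (free k n i) (free k m j) 1) ↔ i ≠ j ∧ n < m := by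
  refine ⟨fun _ => ?_, fun h => nontrivial_of_ne _ 0 (freeExt_ne_zero h.1 le_rfl h.2)⟩
  obtain ⟨ξ, hξ⟩ := exists_ne (0 : Ext (free k n i) (free k m j) 1)
  exact not_not.1 fun h => hξ (ext_free_free_eq_zero h ξ)

lemma rank_ext_free_free_le_one (n m : ℤ) (i j : Bool) :
    Module.rank k (Ext (free k n i) (free k m j) 1) ≤ 1 := by
  by_cases h : i ≠ j ∧ n < m
  · refine rank_le_one_of_forall_exists_smul fun ξ ξ' => ?_
    obtain ⟨a₀, h₀⟩ := exists_eq_smul_freeExt h.2 ξ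
    obtain ⟨a₁, h₁⟩ := exists_eq_smul_freeExt h.2 ξ'
    have ha : min n (min a₀ a₁) ≤ n := min_le_left _ _
    obtain ⟨c, rfl⟩ := h₀ _ ha (by lia)
    obtain ⟨d, rfl⟩ := h₁ _ ha (by lia)
    exact ⟨_, c, d, rfl, rfl⟩
  · exact rank_le_one 0 fun ξ => ⟨0, by rw [ext_free_free_eq_zero h ξ, smul_zero]⟩

lemma mk₀_comp_ne_zero {n m : ℤ} {i j : Bool} {f : free k n i ⟶ free k m j} (hf : f ≠ 0)
    {ξ : Ext (free k m j) (free k (n + 1) (!i)) 1} (hξ : ξ ≠ 0) :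
    (Ext.mk₀ f).comp ξ (zero_add 1) ≠ 0 := by
  obtain ⟨rfl, h⟩ : i = j ∧ m ≤ n := not_not.1 fun h => hf (free_free_eq_zero h f)
  obtain ⟨c, rfl⟩ := free_free_eq_smul h f
  obtain ⟨a₀, h₀⟩ := exists_eq_smul_freeExt (Int.lt_add_one_of_le h) ξ
  obtain ⟨d, rfl⟩ := h₀ (min m a₀) (min_le_left _ _) (min_le_right _ _)
  rw [Ext.mk₀_smul, Ext.smul_comp, Ext.comp_smul, mk₀_freeIncl_comp_freeExt]
  exact smul_ne_zero (left_ne_zero_of_smul hf) (smul_ne_zero (left_ne_zero_of_smul hξ)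
    (freeExt_ne_zero (Bool.not_ne_self i).symm _ (Int.lt_succ n)))

lemma comp_mk₀_ne_zero {n m : ℤ} {i j : Bool} {ξ : Ext (free k n i) (free k m j) 1} (hξ : ξ ≠ 0)
    {f : free k m j ⟶ free k (n + 1) (!i)} (hf : f ≠ 0) :
    ξ.comp (Ext.mk₀ f) (add_zero 1) ≠ 0 := by
  obtain ⟨rfl, h⟩ : j = !i ∧ n + 1 ≤ m := not_not.1 fun h => hf (free_free_eq_zero h f)
  obtain ⟨c, rfl⟩ := free_free_eq_smul h f
  rw [Ext.mk₀_smul, Ext.comp_smul]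
  refine smul_ne_zero (left_ne_zero_of_smul hf) fun h₀ => hξ ?_
  obtain ⟨g, rfl⟩ := exists_mk₀_comp_freeClass_eq_of_comp_eq_zero h ξ h₀
  rw [free_torsion_eq_zero (by lia) g, Ext.mk₀_zero, Ext.zero_comp]

end ExtComputations

/-! ### Generation by the free objects -/

section Generation

variable {k : Type u} [Field k]

/-- The dimension of an object in the degrees from `a` to `b`. It is the measure for the dévissage
of an object that satisfies `IsBounded Y a b`. -/
noncomputable def size (Y : ZDCategory k) (a b : ℤ) : ℕ :=
  ∑ n ∈ Finset.Icc a b, Module.finrank k ((deg k n).obj Y)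

/-- The graded module vanishes below degree `a`, and `x` is bijective from degree `b` on. -/
structure IsBounded (Y : ZDCategory k) (a b : ℤ) : Prop where
  subsingleton : ∀ n < a, Subsingleton ((deg k n).obj Y)
  bijective : ∀ n m (h : n ≤ m), b ≤ n → Function.Bijective ((mulPow k h).app Y)

lemma exists_isBounded (Y : ZDCategory k) : ∃ a b : ℤ, IsBounded Y a b := by
  obtain ⟨a, ha⟩ := exists_subsingleton_deg Y
  obtain ⟨b, hb⟩ := exists_bijective_mulPow Y
  exact ⟨a, b, ha, hb⟩

section Kernel

variable {Y T : ZDCategory k} (g : Y ⟶ T)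

lemma deg_kernel_ι_injective (l : ℤ) : Function.Injective ((deg k l).map (kernel.ι g)) :=
  (ModuleCat.mono_iff_injective _).1 inferInstance

lemma deg_map_eq_zero_iff {l : ℤ} (z : (deg k l).obj Y) :
    (deg k l).map g z = 0 ↔ ∃ z', (deg k l).map (kernel.ι g) z' = z := by
  refine ⟨(ShortComplex.moduleCat_exact_iff _).1
    ((ShortComplex.kernelSequence_exact g).map (deg k l)) z, ?_⟩
  rintro ⟨z', rfl⟩
  rw [← deg_map_comp, kernel.condition, deg_map_zero]

lemma IsBounded.kernel {a b : ℤ} (hY : IsBounded Y a b)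
    (hT : ∀ n m (h : n ≤ m), b ≤ n → Function.Injective ((mulPow k h).app T)) :
    IsBounded (kernel g) a b where
  subsingleton n hn :=
    have := hY.subsingleton n hn
    (deg_kernel_ι_injective g n).subsingleton
  bijective n m h hn := by
    refine ⟨fun z z' hz => deg_kernel_ι_injective g n ((hY.bijective n m h hn).1 ?_), fun z => ?_⟩
    · rw [← deg_map_mulPow, ← deg_map_mulPow, hz]
    · obtain ⟨y, hy⟩ := (hY.bijective n m h hn).2 ((deg k m).map (kernel.ι g) z)
      have hgy : (deg k n).map g y = 0 := hT n m h hn <| by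
        rw [← deg_map_mulPow, hy, (deg_map_eq_zero_iff g _).2 ⟨z, rfl⟩, map_zero]
      obtain ⟨z', rfl⟩ := (deg_map_eq_zero_iff g y).1 hgy
      exact ⟨z', deg_kernel_ι_injective g m ((deg_map_mulPow _ h z').trans hy)⟩

lemma size_kernel_lt {a b n : ℤ} (ha : a ≤ n) (hb : n ≤ b) {z : (deg k n).obj Y}
    (hz : (deg k n).map g z ≠ 0) : size (kernel g) a b < size Y a b := by
  refine Finset.sum_lt_sum (fun l _ =>
    LinearMap.finrank_le_finrank_of_injective (deg_kernel_ι_injective g l))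
    ⟨n, Finset.mem_Icc.2 ⟨ha, hb⟩, ?_⟩
  rw [← LinearMap.finrank_range_of_inj (f := ((deg k n).map (kernel.ι g)).hom)
    (deg_kernel_ι_injective g n)]
  refine Submodule.finrank_lt fun h => hz ((deg_map_eq_zero_iff g z).2 ?_)
  exact LinearMap.mem_range.1 (h ▸ Submodule.mem_top)

end Kernel

section Quotients

variable {Y : ZDCategory k}

lemma exists_lowest_degree {a b : ℤ} (hY : IsBounded Y a b) (h : ¬IsZero Y) :
    ∃ n, a ≤ n ∧ n ≤ b ∧ (∀ l < n, Subsingleton ((deg k l).obj Y)) ∧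
      ∃ z : (deg k n).obj Y, z ≠ 0 := by
  have hne : ∃ n, Nontrivial ((deg k n).obj Y) := by
    by_contra! h'
    exact h (isZero_of_jointlyFaithful jointlyFaithful_deg fun n =>
      ModuleCat.isZero_of_subsingleton _)
  have ha (n : ℤ) (hn : Nontrivial ((deg k n).obj Y)) : a ≤ n :=
    not_lt.1 fun h' => not_subsingleton _ (hY.subsingleton n h')
  obtain ⟨n, hn, hmin⟩ := Int.exists_least_of_bdd ⟨a, ha⟩ hne
  have hlow (l : ℤ) (hl : l < n) : Subsingleton ((deg k l).obj Y) :=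
    not_nontrivial_iff_subsingleton.1 fun h' => (hmin l h').not_gt hl
  refine ⟨n, ha n hn, not_lt.1 fun hbn => ?_, hlow, exists_ne 0⟩
  have := hlow b hbn
  exact not_subsingleton _ (hY.bijective b n hbn.le le_rfl).2.subsingleton

lemma exists_epi_torsion {c : ℤ} (hY : ∀ l < c - 1, Subsingleton ((deg k l).obj Y))
    {z : (deg k (c - 1)).obj Y} (hz : z ≠ 0) :
    ∃ g : Y ⟶ torsion k (c - 1) c, Epi g ∧ (deg k (c - 1)).map g z ≠ 0 := by
  obtain ⟨φ, hφ⟩ := Module.Projective.exists_dual_eq_one k hz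
  let g := toTorsion (c - 1) c φ fun l hl _ z => by
    have := hY l hl
    rw [Subsingleton.elim z 0, map_zero, map_zero]
  have hg : torsionVal (c - 1) c (c - 1) ((deg k (c - 1)).map g z) ≠ 0 := by
    rw [torsionVal_toTorsion _ _ _ _ le_rfl, mulPow_refl, hφ]
    exact one_ne_zero
  refine ⟨g, epi_of_surjective_deg g fun l =>
    (isCell_torsionVal (c - 1) c l).surjective_of_exists_ne_zero _ fun hl => ?_, fun h => hg ?_⟩
  · obtain rfl : l = c - 1 := by lia
    exact ⟨z, hg⟩
  · rw [h, map_zero]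

lemma exists_epi_free {n : ℤ} {j : Bool} (hY : ∀ l < n, Subsingleton ((deg k l).obj Y))
    {z : (deg k n).obj Y} (hz : pr Y n j z ≠ 0) :
    ∃ g : Y ⟶ free k n j, Epi g ∧ (deg k n).map g z ≠ 0 := by
  obtain ⟨φ, hφ⟩ := Module.Projective.exists_dual_eq_one k hz
  let g := toFree n j φ fun l hl z => by
    have := hY l hl
    rw [Subsingleton.elim z 0, map_zero, map_zero]
  have hg : freeVal n j n ((deg k n).map g z) ≠ 0 := by
    rw [freeVal_toFree, hφ]
    exact one_ne_zero
  refine ⟨g, epi_of_surjective_deg g fun l =>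
    (isCell_freeVal n j l).surjective_of_exists_ne_zero _ fun hl => ?_, fun h => hg ?_⟩
  · refine ⟨(mulPow k hl).app Y z, fun h => hg ?_⟩
    rwa [← freeVal_mulPow n j hl, ← deg_map_mulPow]
  · rw [h, map_zero]

end Quotients

section Devissage

variable {Q : ObjectProperty (ZDCategory k)}

lemma prop_of_isZero (hQ : ∀ S : ShortComplex (ZDCategory k), S.ShortExact → Q S.X₁ → Q S.X₂ →
    Q S.X₃) {X Z : ZDCategory k} (hX : Q X) (hZ : IsZero Z) : Q Z :=
  hQ (ShortComplex.mk (𝟙 X) (0 : X ⟶ Z) comp_zero)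
    { exact := (ShortComplex.exact_iff_epi _ rfl).2 inferInstance
      mono_f := inferInstance
      epi_g := ⟨fun _ _ _ => hZ.eq_of_src _ _⟩ } hX hX

lemma exists_epi_prop (hQ : ∀ S : ShortComplex (ZDCategory k), S.ShortExact → Q S.X₁ → Q S.X₂ →
    Q S.X₃) (hfree : ∀ n j, Q (free k n j)) {Y : ZDCategory k} {a b : ℤ} (hY : IsBounded Y a b)
    (h : ¬IsZero Y) :
    ∃ (T : ZDCategory k) (g : Y ⟶ T), Epi g ∧ Q T ∧ IsBounded (kernel g) a b ∧
      size (kernel g) a b < size Y a b := by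
  obtain ⟨n, ha, hb, hlow, z, hz⟩ := exists_lowest_degree hY h
  rcases hb.lt_or_eq with hb' | rfl
  · obtain ⟨c, rfl⟩ : ∃ c, n = c - 1 := ⟨n + 1, (Int.add_sub_cancel n 1).symm⟩
    obtain ⟨g, hg, hgz⟩ := exists_epi_torsion hlow hz
    refine ⟨_, g, hg, ?_, hY.kernel g fun l m _ hl => ?_, size_kernel_lt g ha hb hgz⟩
    · exact hQ _ (freeSequence_shortExact false (Int.sub_le_self c zero_le_one))
        (hfree c false) (hfree _ _)
    · have := (isCell_torsionVal (k := k) (c - 1) c l).subsingleton (by lia)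
      exact Function.injective_of_subsingleton _
  · obtain ⟨j, hj⟩ : ∃ j, pr Y n j z ≠ 0 := by
      by_contra! h₀
      obtain ⟨m, hm, hmz⟩ := exists_mulPow_eq_zero Y z h₀
      exact hz ((hY.bijective n m hm le_rfl).1 (hmz.trans (map_zero _).symm))
    obtain ⟨g, hg, hgz⟩ := exists_epi_free hlow hj
    refine ⟨_, g, hg, hfree n j, hY.kernel g fun l m hlm _ x y hxy => ?_,
      size_kernel_lt g ha hb hgz⟩
    exact (isCell_freeVal n j l).injective
      (by rw [← freeVal_mulPow n j hlm, hxy, freeVal_mulPow])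

lemma prop_of_free [Q.IsClosedUnderExtensions]
    (hQ : ∀ S : ShortComplex (ZDCategory k), S.ShortExact → Q S.X₁ → Q S.X₂ → Q S.X₃)
    (hfree : ∀ n j, Q (free k n j)) (Y : ZDCategory k) : Q Y := by
  obtain ⟨a, b, hY⟩ := exists_isBounded Y
  induction hs : size Y a b using Nat.strong_induction_on generalizing Y with
  | _ N ih =>
    subst hs
    by_cases h : IsZero Y
    · exact prop_of_isZero hQ (hfree 0 false) h
    · obtain ⟨T, g, _, hT, hK, hsize⟩ := exists_epi_prop hQ hfree hY h
      exact Q.prop_X₂_of_shortExact (S := .mk (kernel.ι g) g (kernel.condition g))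
        { exact := ShortComplex.kernelSequence_exact g } (ih _ hsize _ hK rfl) hT

end Devissage
end Generation

/-! ### Serre duality -/

section SerreDuality

open CategoryTheory.Abelian

variable {k : Type u} [Field k]

lemma nontrivial_hom_free_free_iff {n m : ℤ} {i j : Bool} :
    Nontrivial (free k n i ⟶ free k m j) ↔ i = j ∧ m ≤ n := by
  refine ⟨fun _ => ?_, ?_⟩
  · obtain ⟨f, hf⟩ := exists_ne (0 : free k n i ⟶ free k m j)
    exact not_not.1 fun h => hf (free_free_eq_zero h f)
  · rintro ⟨rfl, h⟩
    exact nontrivial_of_ne _ 0 (freeIncl_ne_zero i h)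

lemma rank_hom_free_free_le_one (n m : ℤ) (i j : Bool) :
    Module.rank k (free k n i ⟶ free k m j) ≤ 1 := by
  by_cases h : i = j ∧ m ≤ n
  · obtain ⟨rfl, h⟩ := h
    exact rank_le_one (freeIncl i h) fun f => (free_free_eq_smul h f).imp fun _ hc => hc.symm
  · exact rank_le_one 0 fun f => ⟨0, by rw [free_free_eq_zero h f, smul_zero]⟩

variable [HasDerivedCategory.{w} (ZDCategory k)]

variable (k) in
/-- The objects `free k n j` in the bounded derived category. -/
noncomputable abbrev freeObj (p : ℤ × Bool) : BoundedDerivedCategory (ZDCategory k) :=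
  (boundedSingle (ZDCategory k)).obj (free k p.1 p.2)

variable (k) in
/-- The Serre dual of `freeObj k p`. The shift is by a cast of `(1 : ℕ)` in order to match
`extEquiv`. -/
noncomputable abbrev serreObj (p : ℤ × Bool) : BoundedDerivedCategory (ZDCategory k) :=
  (freeObj k (p.1 + 1, !p.2))⟦((1 : ℕ) : ℤ)⟧

lemma generates_freeObj : Generates (freeObj k) := fun P _ _ h =>
  prop_of_boundedSingle P <| prop_of_free (Q := P.inverseImage (boundedSingle (ZDCategory k)))
    (fun _ hS => boundedSingle_prop_X₃ P hS) fun n j => h (n, j)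

lemma exists_serreObj_shift_iso (q : ℤ × Bool) :
    ∃ (p : ℤ × Bool) (n : ℤ), Nonempty ((serreObj k p)⟦n⟧ ≅ freeObj k q) := by
  have h : freeObj k (q.1 - 1 + 1, !!q.2) = freeObj k q := by
    rw [Int.sub_add_cancel, Bool.not_not]
  exact ⟨(q.1 - 1, !q.2), -1,
    ⟨(shiftFunctorCompIsoId _ ((1 : ℕ) : ℤ) (-1) (by simp)).app _ ≪≫ eqToIso h⟩⟩

variable [HasExt.{w'} (ZDCategory k)]

lemma subsingleton_hom_freeObj (p q : ℤ × Bool) {l : ℤ} (h₀ : l ≠ 0) (h₁ : l ≠ 1) :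
    Subsingleton (freeObj k p ⟶ (freeObj k q)⟦l⟧) := by
  refine subsingleton_of_forall_eq 0 fun f => ?_
  by_cases hl : l < 0
  · exact boundedSingle_hom_shift_eq_zero hl f
  · obtain ⟨n, rfl⟩ : ∃ n : ℕ, l = (n + 2 : ℕ) := ⟨(l - 2).toNat, by lia⟩
    obtain ⟨ξ, rfl⟩ := (extEquiv k _ _ _).surjective f
    rw [ext_free_eq_zero n ξ, map_zero]

lemma subsingleton_hom_serreObj (p q : ℤ × Bool) {l : ℤ} (h₀ : l ≠ 0) (h₁ : l ≠ 1) :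
    Subsingleton ((freeObj k q)⟦l⟧ ⟶ serreObj k p) :=
  have := subsingleton_hom_freeObj (k := k) q (p.1 + 1, !p.2) (l := 1 - l) (by lia) (by lia)
  (shiftHomEquiv (k := k) (freeObj k q) (freeObj k (p.1 + 1, !p.2))
    (n := ((1 : ℕ) : ℤ)) (sub_add_cancel 1 l)).toEquiv.symm.subsingleton

lemma finite_gradedHom_freeObj (p q : ℤ × Bool) :
    Module.Finite k (GradedHom (freeObj k p) (freeObj k q)) := by
  have hfin (l : ℤ) : Module.Finite k (freeObj k p ⟶ (freeObj k q)⟦l⟧) := by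
    rcases eq_or_ne l 0 with rfl | h₀
    · have := finite_of_rank_le_one (rank_hom_free_free_le_one (k := k) p.1 q.1 p.2 q.2)
      exact Module.Finite.equiv (mapEquiv k (boundedSingle _) _ _ ≪≫ₗ Linear.homCongr k
        (Iso.refl (freeObj k p)) ((shiftFunctorZero _ ℤ).symm.app (freeObj k q)))
    rcases eq_or_ne l 1 with rfl | h₁
    · have := finite_of_rank_le_one (rank_ext_free_free_le_one (k := k) p.1 q.1 p.2 q.2)
      exact Module.Finite.equiv (extEquiv k (free k p.1 p.2) (free k q.1 q.2) 1)
    have := subsingleton_hom_freeObj (k := k) p q h₀ h₁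
    infer_instance
  refine finite_directSum_of_subsingleton (Set.toFinite {0, 1}) fun l hl => ?_
  exact subsingleton_hom_freeObj p q (fun h => hl (.inl h)) fun h => hl (.inr h)

section Pairing

variable (p q : ℤ × Bool) {η : Module.Dual k (freeObj k p ⟶ serreObj k p)}
  (hη : Function.Injective η)

include hη

lemma bijective_serrePairing_freeObj_zero :
    Function.Bijective (serrePairing η (freeObj k q)) := by
  refine bijective_serrePairing_of_rank_le_one hη (mapEquiv k (boundedSingle _) _ _)
    (extEquiv k _ _ 1) (rank_ext_free_free_le_one _ _ _ _) (fun f ξ hf hξ => ?_) ?_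
  · change (boundedSingle _).map f ≫ extEquiv k _ _ 1 ξ ≠ 0
    rw [← extEquiv_mk₀_comp]
    exact (LinearEquiv.map_ne_zero_iff _).2 (mk₀_comp_ne_zero hf hξ)
  · have hbool : p.2 = q.2 ↔ q.2 ≠ !p.2 := by cases p.2 <;> cases q.2 <;> simp
    rw [nontrivial_hom_free_free_iff, nontrivial_ext_free_free_iff, hbool, Int.lt_add_one_iff]

lemma bijective_serrePairing_freeObj_one :
    Function.Bijective (serrePairing η ((freeObj k q)⟦((1 : ℕ) : ℤ)⟧)) := by
  refine bijective_serrePairing_of_rank_le_one hη (extEquiv k _ _ 1)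
    (mapEquiv k (boundedSingle _ ⋙ shiftFunctor _ ((1 : ℕ) : ℤ)) _ _)
    (rank_hom_free_free_le_one _ _ _ _) (fun ξ f hξ hf => ?_) ?_
  · change extEquiv k _ _ 1 ξ ≫ ((boundedSingle _).map f)⟦((1 : ℕ) : ℤ)⟧' ≠ 0
    rw [← extEquiv_comp_mk₀]
    exact (LinearEquiv.map_ne_zero_iff _).2 (comp_mk₀_ne_zero hξ hf)
  · have hbool : p.2 ≠ q.2 ↔ q.2 = !p.2 := by cases p.2 <;> cases q.2 <;> simp
    rw [nontrivial_hom_free_free_iff, nontrivial_ext_free_free_iff, hbool, Int.add_one_le_iff]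

lemma bijective_serrePairing_freeObj (l : ℤ) :
    Function.Bijective (serrePairing η ((freeObj k q)⟦l⟧)) := by
  rcases eq_or_ne l 0 with rfl | h₀
  · exact bijective_serrePairing_of_iso (bijective_serrePairing_freeObj_zero p q hη)
      ((shiftFunctorZero _ ℤ).symm.app _)
  rcases eq_or_ne l 1 with rfl | h₁
  · exact bijective_serrePairing_freeObj_one p q hη
  have := subsingleton_hom_freeObj (k := k) p q h₀ h₁
  have := subsingleton_hom_serreObj (k := k) p q h₀ h₁
  exact ⟨fun _ _ _ => Subsingleton.elim _ _, fun φ => ⟨0, Subsingleton.elim _ _⟩⟩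

end Pairing

lemma exists_dual_freeObj_injective (p : ℤ × Bool) :
    ∃ η : Module.Dual k (freeObj k p ⟶ serreObj k p), Function.Injective η := by
  let e := extEquiv k (free k p.1 p.2) (free k (p.1 + 1) (!p.2)) 1
  obtain ⟨φ, hφ⟩ := exists_dual_injective_of_rank_le_one
    (rank_ext_free_free_le_one (k := k) p.1 (p.1 + 1) p.2 (!p.2))
  exact ⟨φ ∘ₗ e.symm.toLinearMap, hφ.comp e.symm.injective⟩

end SerreDuality

end ZDInf

theorem theorem3p6 (k : Type u) [Field k] [HasDerivedCategory.{w} (ZDInf.ZDCategory k)]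
    [CategoryTheory.HasExt.{w'} (ZDInf.ZDCategory k)] :
    ZDInf.SatisfiesSerreDuality.{w, w'} k (ZDInf.ZDCategory k) := by
  choose η hη using ZDInf.exists_dual_freeObj_injective.{w, w'} (k := k)
  have duality : ZDInf.TriangulatedSerreDuality k
      (ZDInf.BoundedDerivedCategory (ZDInf.ZDCategory k)) :=
    ZDInf.triangulatedSerreDuality_of_generates ZDInf.generates_freeObj
      ZDInf.finite_gradedHom_freeObj ZDInf.exists_serreObj_shift_iso η
      fun p q l => ZDInf.bijective_serrePairing_freeObj p q (hη p) l
  exact ⟨ZDInf.abelianExtFinite_of_triangulatedExtFinite duality.1, duality⟩
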